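/- **Setting.** Let $X_0$ be either (a) a reduced separated scheme of finite type over a field $k$ of characteristic zero, or (b) a reduced complex- or real-analytic space (a Hausdorff locally ringed space over $k=\mathbb C$ or $\mathbb R$, locally of the form $(Z(f_1,\dots,f_r),\mathcal O_U/(f_1,\dots,f_r))$ with $f_1,\dots,f_r$ analytic on an open $U\subset k^N$; reduced means that the structure sheaf has no nilpotents). Let $\sigma:(X,E)\to(X_0,\mathrm{Sing}\,X_0)$ be a resolution of singularities with $X$ of pure dimension $n$ (so $X_0\setminus\mathrm{Sing}\,X_0$ is smooth of pure dimension $n=\dim X_0$): $\sigma$ is a proper morphism over $k$, $X$ is smooth, $\sigma$ is an isomorphism over $X_0\setminus \mathrm{Sing}\,X_0$, and $\sigma^{-1}(\mathrm{Sing}\,X_0)$ is the support of a simple normal crossings divisor $E$ on $X$. **Notation.** * $\sigma^*\Omega^1_{X_0}$ denotes the $\mathcal O_X$-submodule of $\Omega^1_X$ generated by the pull-backs of the differential $1$-forms of $X_0$. * $\mathcal F_0(\sigma)\subset\mathcal O_X$ is the logarithmic Fitting ideal: the sheaf of ideals generated locally by the minors of order $n$ of the logarithmic Jacobian matrix of $\sigma$,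 that is, of the matrix with rows $(u_1\,\partial\sigma_m/\partial u_1,\dots,u_s\,\partial\sigma_m/\partial u_s,\ \partial\sigma_m/\partial v_1,\dots,\partial\sigma_m/\partial v_{n-s})$. Here $(u,v)=(u_1,\dots,u_s,v_1,\dots,v_{n-s})$ are local (étale or analytic) coordinates of $X$ such that $(u_i=0)$, $i=1,\dots,s$, are the components of $E$, and $\sigma_1,\dots,\sigma_N$ are the components of $\sigma$ with respect to a local embedding of $X_0$ in a smooth space with local coordinates. * For a smooth space $M$, $G(n,M)$ is the Grassmann bundle of $n$-dimensional linear subspaces of the tangent spaces to $M$. For an open $V\subset X_0$ and an embedding $V\hookrightarrow M$ in a smooth $M$, the Gauss mapping $G_V:V\setminus\mathrm{Sing}\,X_0\to G(n,M)$ sends a point to the tangent space of $X_0$ at that point. Let $V_j\hookrightarrow M_j$ ($j\in J$) be embeddings of open subspaces of $X_0$ in smooth spaces $M_j$, with $X_0=\bigcup_j V_j$ (for example a single embedding $X_0\hookrightarrow M_0$). **Theorem 2.5.** The following conditions are equivalent. 1. The pull-back of the Gauss mapping by $\sigma$ extends to a regular (respectively, analytic) morphism on $X$; i.e., for every $j\in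 J$, $\sigma^*G_{V_j}:\sigma^{-1}(V_j\setminus \mathrm{Sing}\,X_0)\to G(n,M_j)$ extends to a regular (analytic) morphism $\sigma^{-1}(V_j)\to G(n,M_j)$. 2. $\sigma^*\Omega^1_{X_0}$ is a locally free $\mathcal O_X$-module of rank $n$. 3. $\mathcal F_0(\sigma)$ is a (locally) principal ideal, not necessarily generated by a monomial in the components of $E$. -/

import Mathlib

open CategoryTheory AlgebraicGeometry TopologicalSpace Opposite Topology

universe u v w

noncomputable section

namespace GaussMap

/-! ### Locally ringed spaces over a field

Algebraic varieties over `k` and (real or complex) analytic spaces are both treated as locally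
ringed spaces whose structure sheaf is a sheaf of `k`-algebras. -/

/-- A locally ringed space over a field `k`. -/
structure KSpace (k : Type v) [Field k] where
  /-- the underlying locally ringed space -/
  space : LocallyRingedSpace.{u}
  /-- the constant functions -/
  scalars : k →+* LocallyRingedSpace.Γ.obj (op space)

namespace KSpace

variable {k : Type v} [Field k]

/-- The underlying set of points. -/
abbrev Point (X : KSpace.{u} k) : Type u := X.space.toTopCat

/-- The ring `𝒪_X(U)`. -/
def Sections (X : KSpace.{u} k) (U : Opens X.Point) : Type u := X.space.presheaf.obj (op U)

instance (X : KSpace.{u} k) (U : Opens X.Point) : CommRing (X.Sections U) :=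
  inferInstanceAs (CommRing (X.space.presheaf.obj (op U)))

/-- The local ring `𝒪_{X,x}`. -/
def Stalk (X : KSpace.{u} k) (x : X.Point) : Type u := X.space.presheaf.stalk x

instance (X : KSpace.{u} k) (x : X.Point) : CommRing (X.Stalk x) :=
  inferInstanceAs (CommRing (X.space.presheaf.stalk x))

instance (X : KSpace.{u} k) (x : X.Point) : IsLocalRing (X.Stalk x) :=
  inferInstanceAs (IsLocalRing (X.space.presheaf.stalk x))

/-- The germ at `x` of a function on `U`. -/
def germ (X : KSpace.{u} k) (U : Opens X.Point) (x : X.Point) (hx : x ∈ U) :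
    X.Sections U →+* X.Stalk x :=
  (X.space.presheaf.germ U x hx).hom

instance (X : KSpace.{u} k) (x : X.Point) : Algebra k (X.Stalk x) :=
  ((X.germ ⊤ x trivial).comp X.scalars).toAlgebra

/-- The residue field `κ(x)`. -/
abbrev Residue (X : KSpace.{u} k) (x : X.Point) : Type u := IsLocalRing.ResidueField (X.Stalk x)

/-- The value `f(x) ∈ κ(x)` of a germ of a function at `x`. -/
def eval (X : KSpace.{u} k) (x : X.Point) : X.Stalk x →+* X.Residue x :=
  IsLocalRing.residue (X.Stalk x)

/-- A morphism of locally ringed spaces over `k`. -/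
structure Hom (X Y : KSpace.{u} k) where
  /-- the underlying morphism of locally ringed spaces -/
  hom : X.space ⟶ Y.space
  comm : ∀ c : k, (LocallyRingedSpace.Γ.map hom.op).hom (Y.scalars c) = X.scalars c

/-- The map on points. -/
def Hom.pt {X Y : KSpace.{u} k} (f : Hom X Y) : X.Point → Y.Point := fun x => f.hom.base x

/-- The pull-back `f^♯ : 𝒪_{Y,f(x)} → 𝒪_{X,x}`. -/
def Hom.pull {X Y : KSpace.{u} k} (f : Hom X Y) (x : X.Point) :
    Y.Stalk (f.pt x) →+* X.Stalk x :=
  (f.hom.stalkMap x).hom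

/-- The open subspace of `X` on the open set `V`. -/
def restrict (X : KSpace.{u} k) (V : Opens X.Point) : KSpace.{u} k where
  space := X.space.restrict V.isOpenEmbedding
  scalars := (LocallyRingedSpace.Γ.map (X.space.ofRestrict V.isOpenEmbedding).op).hom.comp X.scalars

/-- The inclusion of an open subspace. -/
def inclusion (X : KSpace.{u} k) (V : Opens X.Point) : Hom (X.restrict V) X where
  hom := X.space.ofRestrict V.isOpenEmbedding
  comm _ := rfl

/-- A point of the open set `V`, as a point of the open subspace. -/
def restrictPoint (X : KSpace.{u} k) (V : Opens X.Point) (x : X.Point) (hx : x ∈ V) :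
    (X.restrict V).Point :=
  (⟨x, hx⟩ : V)

/-- The identification `𝒪_{V,x} = 𝒪_{X,x}` for `x` in the open set `V`. -/
def restrictStalk (X : KSpace.{u} k) (V : Opens X.Point) (x : X.Point) (hx : x ∈ V) :
    (X.restrict V).Stalk (X.restrictPoint V x hx) →+* X.Stalk x :=
  (X.space.restrictStalkIso V.isOpenEmbedding (⟨x, hx⟩ : V)).hom.hom

/-- Embeddings: the underlying map is a homeomorphism onto a locally closed subset, and all maps
of local rings are surjective. -/
structure Hom.IsEmbedding {X Y : KSpace.{u} k} (f : Hom X Y) : Prop where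
  isEmbedding : Topology.IsEmbedding f.pt
  isLocallyClosed : IsLocallyClosed (Set.range f.pt)
  surjective : ∀ x, Function.Surjective (f.pull x)

/-- `f` is an isomorphism over the open set `W` of `Y`, i.e. `f` restricts to an isomorphism
`f⁻¹(W) ≅ W` of locally ringed spaces. -/
def Hom.IsIsoOver {X Y : KSpace.{u} k} (f : Hom X Y) (W : Opens Y.Point) : Prop :=
  ∃ e : X.space.restrict ((Opens.map f.hom.base).obj W).isOpenEmbedding ≅
      Y.space.restrict W.isOpenEmbedding,
    e.hom ≫ Y.space.ofRestrict W.isOpenEmbedding =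
      X.space.ofRestrict ((Opens.map f.hom.base).obj W).isOpenEmbedding ≫ f.hom

/-! ### Differential forms -/

/-- The stalk at `x` of the cotangent sheaf `Ω¹_X`: the Kähler differentials of `𝒪_{X,x}` over `k`,
made separated for the topology defined by the powers of the maximal ideal `𝔪`.

For varieties over `k` the module of Kähler differentials of `𝒪_{X,x}` is finitely generated, so the
intersection below is `0` by the Krull intersection theorem and this is `Ω¹_{X,x}`. For analytic
spaces this is the usual (universally finite) module of differentials; for instance if
`𝒪_{X,x} = 𝕜{x₁, …, xₙ}` it is the free module on `dx₁, …, dxₙ` with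
`df = ∑ᵢ (∂f/∂xᵢ) dxᵢ`. -/
def Cotangent (X : KSpace.{u} k) (x : X.Point) : Type u :=
  Ω[X.Stalk x⁄k] ⧸ ⨅ i : ℕ, (IsLocalRing.maximalIdeal (X.Stalk x)) ^ i •
    (⊤ : Submodule (X.Stalk x) Ω[X.Stalk x⁄k])

instance (X : KSpace.{u} k) (x : X.Point) : AddCommGroup (X.Cotangent x) := by
  unfold Cotangent; infer_instance

instance (X : KSpace.{u} k) (x : X.Point) : Module (X.Stalk x) (X.Cotangent x) :=
  Submodule.Quotient.module (⨅ i : ℕ, (IsLocalRing.maximalIdeal (X.Stalk x)) ^ i •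
    (⊤ : Submodule (X.Stalk x) Ω[X.Stalk x⁄k]))

/-- The differential `d : 𝒪_{X,x} → Ω¹_{X,x}`. -/
def d (X : KSpace.{u} k) (x : X.Point) (f : X.Stalk x) : X.Cotangent x :=
  Submodule.Quotient.mk (p := ⨅ i : ℕ, (IsLocalRing.maximalIdeal (X.Stalk x)) ^ i •
    (⊤ : Submodule (X.Stalk x) Ω[X.Stalk x⁄k])) (KaehlerDifferential.D k (X.Stalk x) f)

/-- The stalk at `x` of the sheaf `σ^*Ω¹_{X₀}`, the submodule of `Ω¹_X` generated by the pull-backs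
of the differential forms of `X₀`. -/
def Hom.pullForms {X X₀ : KSpace.{u} k} (σ : Hom X X₀) (x : X.Point) :
    Submodule (X.Stalk x) (X.Cotangent x) :=
  Submodule.span (X.Stalk x) (Set.range fun f : X₀.Stalk (σ.pt x) => X.d x (σ.pull x f))

/-- `ω` is a section over `U` of the subsheaf `σ^*Ω¹_{X₀}` of `Ω¹_X`: locally, `ω` is a finite sum
`∑ⱼ gⱼ d(hⱼ ∘ σ)`, with functions `gⱼ` on `X` and `hⱼ` on `X₀`. -/
def Hom.IsPullForm {X X₀ : KSpace.{u} k} (σ : Hom X X₀) (U : Opens X.Point)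
    (ω : ∀ x : X.Point, X.Cotangent x) : Prop :=
  ∀ x ∈ U, ∃ (W : Opens X.Point) (W₀ : Opens X₀.Point) (m : ℕ) (g : Fin m → X.Sections W)
    (h : Fin m → X₀.Sections W₀), x ∈ W ∧ ∀ (y : X.Point) (hy : y ∈ W), ∃ hy₀ : σ.pt y ∈ W₀,
      ω y = ∑ j, X.germ W y hy (g j) • X.d y (σ.pull y (X₀.germ W₀ (σ.pt y) hy₀ (h j)))

/-- `σ^*Ω¹_{X₀}` is a locally free `𝒪_X`-module of rank `n`: every point of `X` has an open
neighbourhood over which there are `n` sections of `σ^*Ω¹_{X₀}` that form a basis of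
`σ^*Ω¹_{X₀}`. -/
def Hom.PullFormsLocallyFree {X X₀ : KSpace.{u} k} (σ : Hom X X₀) (n : ℕ) : Prop :=
  ∀ a : X.Point, ∃ (U : Opens X.Point) (ω : Fin n → ∀ x : X.Point, X.Cotangent x), a ∈ U ∧
    (∀ i, σ.IsPullForm U (ω i)) ∧
    ∀ x ∈ U, LinearIndependent (X.Stalk x) (fun i => ω i x) ∧
      Submodule.span (X.Stalk x) (Set.range fun i => ω i x) = σ.pullForms x

/-! ### Simple normal crossings divisors and logarithmic Fitting ideals -/

/-- (Étale or analytic) local coordinates `t₁, …, tₙ` of `X` at `a` adapted to a family of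
hypersurfaces `E j`: each component `E j` through `a` is near `a` the zero set of one of
the coordinates, different components corresponding to different coordinates. In the notation
`(u, v)` for adapted coordinates, the `tᵢ` with `i` in the range of `index` are the `u`'s and the
others are the `v`'s. -/
structure AdaptedCoordinates (X : KSpace.{u} k) {ι : Type w} (E : ι → Set X.Point) (n : ℕ)
    (a : X.Point) where
  t : Fin n → X.Stalk a
  /-- the differentials of the coordinates form a basis of `Ω¹_{X,a}` -/
  basis : Module.Basis (Fin n) (X.Stalk a) (X.Cotangent a)
  basis_eq : ∀ i, basis i = X.d a (t i)
  index : {j // a ∈ E j} ↪ Fin n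
  equation : ∀ j : {j // a ∈ E j}, ∃ (U : Opens X.Point) (ha : a ∈ U) (s : X.Sections U),
    X.germ U a ha s = t (index j) ∧
      ∀ (y : X.Point) (hy : y ∈ U), y ∈ E j.1 ↔ X.eval y (X.germ U y hy s) = 0

/-- The family `E` is the family of components of a simple normal crossings divisor on the smooth
space `X` of dimension `n`. (Every `E j` is then a smooth hypersurface, and the components meet
with normal crossings; the divisor is reduced, since only its support matters.) -/
structure IsSNC (X : KSpace.{u} k) {ι : Type w} (E : ι → Set X.Point) (n : ℕ) : Prop where
  isClosed : ∀ j, IsClosed (E j)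
  locallyFinite : LocallyFinite E
  adapted : ∀ a : X.Point, Nonempty (X.AdaptedCoordinates E n a)

open Classical in
/-- The row of the logarithmic Jacobian matrix of a function germ `f`: the coefficients of `df`
with respect to the logarithmic basis `duᵢ/uᵢ`, `dvⱼ`, that is, `uᵢ ∂f/∂uᵢ` and `∂f/∂vⱼ`. -/
def AdaptedCoordinates.logGrad {X : KSpace.{u} k} {ι : Type w} {E : ι → Set X.Point} {n : ℕ}
    {a : X.Point} (c : X.AdaptedCoordinates E n a) (f : X.Stalk a) (i : Fin n) : X.Stalk a :=
  (if i ∈ Set.range c.index then c.t i else 1) * c.basis.repr (X.d a f) i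

/-- The stalk at `a` of the logarithmic Fitting ideal `𝓕_l(σ)`: the ideal generated by the minors
of order `n - l` of the logarithmic Jacobian matrix of `σ` with respect to adapted coordinates.

The ideal does not depend on the adapted coordinates; it is the `l`-th Fitting ideal of
`Ω¹_X(log E)/σ^*Ω¹_{X₀}` at `a`. The rows of the Jacobian matrix are taken to be indexed by all
`f ∈ 𝒪_{X₀,σ(a)}`; the rows belonging to the components of `σ` in a local embedding of `X₀` span
the others, so they give the same ideal. -/
def Hom.logFitting {X X₀ : KSpace.{u} k} (σ : Hom X X₀) {ι : Type w} (E : ι → Set X.Point)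
    (n l : ℕ) (a : X.Point) : Ideal (X.Stalk a) :=
  Ideal.span {δ | ∃ (c : X.AdaptedCoordinates E n a) (f : Fin (n - l) → X₀.Stalk (σ.pt a))
    (e : Fin (n - l) → Fin n),
      δ = Matrix.det (Matrix.of fun i j => c.logGrad (σ.pull a (f i)) (e j))}

/-- A sheaf of ideals, given by its stalks, is principal: it is locally generated by one
function. -/
def IsPrincipalIdeal (X : KSpace.{u} k) (I : ∀ x : X.Point, Ideal (X.Stalk x)) : Prop :=
  ∀ a : X.Point, ∃ (U : Opens X.Point) (g : X.Sections U), a ∈ U ∧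
    ∀ (x : X.Point) (hx : x ∈ U), I x = Ideal.span {X.germ U x hx g}

/-! ### Tangent spaces, Grassmann bundles and the Gauss mapping -/

/-- For a local ring `A = 𝒪_{M,m}` and a point `ev : A → L` of `M` at `m` with values in the field
`L`, the tangent space of `M` at this point: the `L`-vector space of `k`-derivations of `A` with
values in `L`. (If `L = κ(m) = k` this is the dual of `𝔪/𝔪²`.) -/
def tangentSpace (k : Type v) [Field k] {A : Type u} [CommRing A] [Algebra k A] {L : Type u}
    [Field L] (ev : A →+* L) : Submodule L (A → L) where
  carrier := {D | (∀ f g, D (f + g) = D f + D g) ∧ (∀ c : k, D (algebraMap k A c) = 0) ∧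
    ∀ f g, D (f * g) = ev f * D g + ev g * D f}
  add_mem' := by
    rintro D D' ⟨h1, h2, h3⟩ ⟨h1', h2', h3'⟩
    refine ⟨fun f g => ?_, fun c => ?_, fun f g => ?_⟩
    · simp only [Pi.add_apply, h1, h1']; ring
    · simp only [Pi.add_apply, h2, h2', add_zero]
    · simp only [Pi.add_apply, h3, h3']; ring
  zero_mem' := by simp
  smul_mem' := by
    rintro r D ⟨h1, h2, h3⟩
    refine ⟨fun f g => ?_, fun c => ?_, fun f g => ?_⟩
    · simp only [Pi.smul_apply, smul_eq_mul, h1]; ring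
    · simp only [Pi.smul_apply, smul_eq_mul, h2, mul_zero]
    · simp only [Pi.smul_apply, smul_eq_mul, h3]; ring

/-- A local embedding of `X₀` in `M`: an embedding `V ↪ M` of an open subspace `V` of `X₀`. -/
structure LocalEmbedding (X₀ M : KSpace.{u} k) where
  V : Opens X₀.Point
  emb : Hom (X₀.restrict V) M
  isEmbedding : emb.IsEmbedding

namespace LocalEmbedding

variable {X X₀ M : KSpace.{u} k}

/-- The image in `M` of a point of `V`. -/
def pt (i : LocalEmbedding X₀ M) (b : X₀.Point) (hb : b ∈ i.V) : M.Point :=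
  i.emb.pt (X₀.restrictPoint i.V b hb)

/-- The restriction of functions from `M` to `X₀`, on germs. -/
def pull (i : LocalEmbedding X₀ M) (b : X₀.Point) (hb : b ∈ i.V) :
    M.Stalk (i.pt b hb) →+* X₀.Stalk b :=
  (X₀.restrictStalk i.V b hb).comp (i.emb.pull (X₀.restrictPoint i.V b hb))

/-- The evaluation at `x` of functions of `M`, composed with `σ : X → X₀`: the
`κ(x)`-valued point of `M` determined by `x`. -/
def evalAt (i : LocalEmbedding X₀ M) (σ : Hom X X₀) (x : X.Point) (hx : σ.pt x ∈ i.V) :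
    M.Stalk (i.pt (σ.pt x) hx) →+* X.Residue x :=
  (X.eval x).comp ((σ.pull x).comp (i.pull (σ.pt x) hx))

/-- The tangent space of `M` at the image of `x` (with scalars extended to `κ(x)`), i.e. the
fibre at `x` of the pull-back of `TM`. -/
def ambientTangent (i : LocalEmbedding X₀ M) (σ : Hom X X₀) (x : X.Point) (hx : σ.pt x ∈ i.V) :
    Submodule (X.Residue x) (M.Stalk (i.pt (σ.pt x) hx) → X.Residue x) :=
  tangentSpace k (i.evalAt σ x hx)

/-- The value at `x` of the pulled-back Gauss mapping `σ^*G_{X₀}`: the tangent space of `X₀` at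
`σ(x)` (with scalars extended to `κ(x)`), as a subspace of the tangent space of `M`. -/
def gauss (i : LocalEmbedding X₀ M) (σ : Hom X X₀) (x : X.Point) (hx : σ.pt x ∈ i.V) :
    Submodule (X.Residue x) (M.Stalk (i.pt (σ.pt x) hx) → X.Residue x) :=
  (tangentSpace k ((X.eval x).comp (σ.pull x))).map
    (LinearMap.funLeft (X.Residue x) (X.Residue x) (i.pull (σ.pt x) hx))

end LocalEmbedding

/-- Functions `z₁, …, z_N` on the open set `W` that are (étale or analytic) local coordinates of the
smooth space `M`: their differentials are a basis of the cotangent sheaf on `W`. -/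
def IsCoordinateSystem (M : KSpace.{u} k) (W : Opens M.Point) {N : ℕ} (z : Fin N → M.Sections W) :
    Prop :=
  ∀ (y : M.Point) (hy : y ∈ W),
    LinearIndependent (M.Stalk y) (fun i => M.d y (M.germ W y hy (z i))) ∧
      Submodule.span (M.Stalk y) (Set.range fun i => M.d y (M.germ W y hy (z i))) = ⊤

/-- A lifting of `σ : σ⁻¹(V) → V ↪ M` to the Grassmann bundle `G(n, M)`, on points: to every
`x ∈ σ⁻¹(V)` is assigned an `n`-dimensional linear subspace of the tangent space of `M` at the image
of `x`. -/
structure GrassmannLift {X X₀ M : KSpace.{u} k} (i : LocalEmbedding X₀ M) (σ : Hom X X₀)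
    (n : ℕ) where
  plane : ∀ (x : X.Point) (hx : σ.pt x ∈ i.V),
    Submodule (X.Residue x) (M.Stalk (i.pt (σ.pt x) hx) → X.Residue x)
  le : ∀ x hx, plane x hx ≤ i.ambientTangent σ x hx
  finrank_eq : ∀ x hx, Module.finrank (X.Residue x) (plane x hx) = n

/-- Regularity (analyticity) of a map `Λ : σ⁻¹(V) → G(n, M)` that lifts `σ⁻¹(V) → M`, in the standard
affine charts of the Grassmann bundle.

Over a coordinate chart `W` of `M`, with coordinates `z₁, …, z_N`, the Grassmann bundle is
`W × Grass(n, N)`, and for every `n`-element subset `I` of `{1, …, N}` it has the affine chart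
consisting of the graphs `D z_l = ∑_{m ∈ I} A_{l m} D z_m` (`l ∉ I`) of the
`(N - n) × n`-matrices `A`, with the entries of `A` as fibre coordinates. The map is regular if
locally it has values in such a chart, with entries `A_{l m}` that are regular (analytic) functions
on `X`. -/
def GrassmannLift.IsRegular {X X₀ M : KSpace.{u} k} {i : LocalEmbedding X₀ M} {σ : Hom X X₀}
    {n : ℕ} (Λ : GrassmannLift i σ n) : Prop :=
  ∀ a : X.Point, σ.pt a ∈ i.V → ∃ (N : ℕ) (W : Opens M.Point) (z : Fin N → M.Sections W)
    (I : Finset (Fin N)) (U : Opens X.Point) (A : Fin N → Fin N → X.Sections U),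
    M.IsCoordinateSystem W z ∧ I.card = n ∧ a ∈ U ∧
      ∀ (x : X.Point) (hx : x ∈ U), ∃ (hV : σ.pt x ∈ i.V) (hW : i.pt (σ.pt x) hV ∈ W),
        ∀ D ∈ i.ambientTangent σ x hV, D ∈ Λ.plane x hV ↔
          ∀ l ∉ I, D (M.germ W _ hW (z l)) =
            ∑ m ∈ I, X.eval x (X.germ U x hx (A l m)) * D (M.germ W _ hW (z m))

/-- The pull-back `σ^*G_{X₀}` of the Gauss mapping `G_{X₀} : V ∖ Sing X₀ → G(n, M)` extends to a
regular (analytic) morphism `σ⁻¹(V) → G(n, M)`. Here `S` is the open set `X₀ ∖ Sing X₀`. -/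
def LocalEmbedding.GaussExtends {X X₀ M : KSpace.{u} k} (i : LocalEmbedding X₀ M) (σ : Hom X X₀)
    (S : Opens X₀.Point) (n : ℕ) : Prop :=
  ∃ Λ : GrassmannLift i σ n, Λ.IsRegular ∧
    ∀ (x : X.Point) (hx : σ.pt x ∈ i.V), σ.pt x ∈ S → Λ.plane x hx = i.gauss σ x hx

/-- The conditions that, besides smoothness of `X` (of dimension `n`) and properness, make
`σ : (X, E) → (X₀, Sing X₀)` a resolution of singularities: `σ` is an isomorphism over
`S = X₀ ∖ Sing X₀`, and `σ⁻¹(Sing X₀)` is the support of the simple normal crossings divisor `E`.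
(In particular `σ` is birational or bimeromorphic, since the support of `E` is nowhere dense.) -/
structure Hom.ResolvesWith {X X₀ : KSpace.{u} k} (σ : Hom X X₀) (S : Opens X₀.Point)
    {ι : Type w} (E : ι → Set X.Point) (n : ℕ) : Prop where
  isIsoOver : σ.IsIsoOver S
  isSNC : X.IsSNC E n
  support : ∀ x : X.Point, (∃ j, x ∈ E j) ↔ σ.pt x ∉ S

end KSpace

/-! ### The algebraic category -/

/-- A scheme over `k` as a locally ringed space over `k`. -/
def ofScheme {k : Type u} [Field k] {X : Scheme.{u}} (s : X ⟶ Spec (CommRingCat.of k)) :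
    KSpace.{u} k where
  space := X.toLocallyRingedSpace
  scalars := ((Scheme.ΓSpecIso (CommRingCat.of k)).inv ≫ s.appTop).hom

/-- A morphism of schemes over `k` as a morphism of locally ringed spaces over `k`. -/
def homOfScheme {k : Type u} [Field k] {X Y : Scheme.{u}} (s : X ⟶ Spec (CommRingCat.of k))
    (t : Y ⟶ Spec (CommRingCat.of k)) (f : X ⟶ Y) (h : f ≫ t = s) :
    KSpace.Hom (ofScheme s) (ofScheme t) where
  hom := f.toLRSHom
  comm c := by
    subst h
    simp [ofScheme]
    rfl

/-! ### The analytic category -/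

section Analytic

variable (𝕜 : Type u) [RCLike 𝕜] (N : ℕ)

/-- The space `𝕜^N` with its usual topology. -/
abbrev coordSpace : TopCat.{u} := TopCat.of (EuclideanSpace 𝕜 (Fin N))

/-- Analyticity of functions on open subsets of `𝕜^N`, as a local condition. -/
def analyticLocal : TopCat.LocalPredicate fun _ : coordSpace 𝕜 N => 𝕜 where
  pred {U} f := ∀ x : U, ∃ g : EuclideanSpace 𝕜 (Fin N) → 𝕜, AnalyticAt 𝕜 g x.1 ∧
    ∀ᶠ y in 𝓝 x.1, ∀ hy : y ∈ U, f ⟨y, hy⟩ = g y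
  res {U V} i f hf x := by
    obtain ⟨g, hg, h⟩ := hf ⟨x.1, i.le x.2⟩
    exact ⟨g, hg, h.mono fun y hy hU => hy (i.le hU)⟩
  locality {U} f hf x := by
    obtain ⟨V, hxV, i, h⟩ := hf x
    obtain ⟨g, hg, h⟩ := h ⟨x, hxV⟩
    refine ⟨g, hg, ?_⟩
    filter_upwards [h, V.isOpen.mem_nhds hxV] with y hy hyV hU
    exact hy hyV

/-- The ring of analytic functions on the open set `U`. -/
def analyticSubring (U : Opens (coordSpace 𝕜 N)) : Subring (U → 𝕜) where
  carrier := {f | (analyticLocal 𝕜 N).pred f}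
  mul_mem' {a b} ha hb x := by
    obtain ⟨g, hg, h⟩ := ha x
    obtain ⟨g', hg', h'⟩ := hb x
    refine ⟨g * g', hg.mul hg', ?_⟩
    filter_upwards [h, h'] with y hy hy' hU
    simp [hy hU, hy' hU]
  add_mem' {a b} ha hb x := by
    obtain ⟨g, hg, h⟩ := ha x
    obtain ⟨g', hg', h'⟩ := hb x
    refine ⟨g + g', hg.add hg', ?_⟩
    filter_upwards [h, h'] with y hy hy' hU
    simp [hy hU, hy' hU]
  one_mem' x := ⟨fun _ => 1, analyticAt_const, by simp⟩
  zero_mem' x := ⟨fun _ => 0, analyticAt_const, by simp⟩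
  neg_mem' {a} ha x := by
    obtain ⟨g, hg, h⟩ := ha x
    refine ⟨-g, hg.neg, ?_⟩
    filter_upwards [h] with y hy hU
    simp [hy hU]

/-- The structure presheaf of `𝕜^N`: analytic functions on open sets. -/
def analyticPresheaf : TopCat.Presheaf CommRingCat.{u} (coordSpace 𝕜 N) where
  obj U := CommRingCat.of (analyticSubring 𝕜 N U.unop)
  map {U V} i := CommRingCat.ofHom
    { toFun := fun f => ⟨fun x => f.1 ⟨x.1, i.unop.le x.2⟩, (analyticLocal 𝕜 N).res i.unop f.1 f.2⟩
      map_add' := fun _ _ => rfl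
      map_mul' := fun _ _ => rfl
      map_one' := rfl
      map_zero' := rfl }

theorem analyticPresheaf_isSheaf : (analyticPresheaf 𝕜 N).IsSheaf := by
  refine (CategoryTheory.Presheaf.isSheaf_iff_isSheaf_forget _ _
    (CategoryTheory.forget CommRingCat)).mpr ?_
  exact (TopCat.subsheafToTypes (analyticLocal 𝕜 N)).property

theorem analyticPresheaf_isUnit (x : coordSpace 𝕜 N) (U : Opens (coordSpace 𝕜 N)) (hx : x ∈ U)
    (f : analyticSubring 𝕜 N U) (h0 : f.1 ⟨x, hx⟩ ≠ 0) :
    IsUnit ((analyticPresheaf 𝕜 N).germ U x hx f) := by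
  have hcont : ContinuousAt (fun y : U => f.1 y) ⟨x, hx⟩ := by
    obtain ⟨g, hg, h⟩ := f.2 ⟨x, hx⟩
    have : (fun y : U => f.1 y) =ᶠ[𝓝 ⟨x, hx⟩] fun y => g y.1 := by
      have := (continuous_subtype_val (p := fun y => y ∈ U)).continuousAt.eventually h
      filter_upwards [this] with y hy
      exact hy y.2
    refine ContinuousAt.congr ?_ this.symm
    exact ContinuousAt.comp (f := fun y : U => y.1) (g := g) hg.continuousAt
      continuous_subtype_val.continuousAt
  have hne := hcont.eventually_ne h0
  obtain ⟨V₀, hV₀, hoV₀, hxV₀⟩ := eventually_nhds_iff.mp hne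
  let V : Opens (coordSpace 𝕜 N) := ⟨Subtype.val '' V₀, U.2.isOpenMap_subtype_val V₀ hoV₀⟩
  have hVU : V ≤ U := by
    rintro _ ⟨y, -, rfl⟩; exact y.2
  have hxV : x ∈ V := ⟨_, hxV₀, rfl⟩
  have hV : ∀ y : V, f.1 ⟨y.1, hVU y.2⟩ ≠ 0 := by
    rintro ⟨_, ⟨y, hy, rfl⟩⟩; exact hV₀ y hy
  let g : analyticSubring 𝕜 N V := ⟨fun y => (f.1 ⟨y.1, hVU y.2⟩)⁻¹, fun y => by
    obtain ⟨g, hg, h⟩ := f.2 ⟨y.1, hVU y.2⟩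
    refine ⟨fun z => (g z)⁻¹, hg.inv ?_, ?_⟩
    · rw [← h.self_of_nhds (hVU y.2)]; exact hV y
    · filter_upwards [h] with z hz hzV
      rw [hz (hVU hzV)]⟩
  let F : (analyticPresheaf 𝕜 N).obj (op U) := f
  let G : (analyticPresheaf 𝕜 N).obj (op V) := g
  have hFG : (analyticPresheaf 𝕜 N).map (homOfLE hVU).op F * G = 1 := by
    apply Subtype.ext
    funext y
    exact mul_inv_cancel₀ (hV y)
  have hres := (analyticPresheaf 𝕜 N).germ_res_apply (homOfLE hVU) x hxV F
  refine IsUnit.of_mul_eq_one ((analyticPresheaf 𝕜 N).germ V x hxV G) ?_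
  change (analyticPresheaf 𝕜 N).germ U x hx F * _ = 1
  rw [← hres, ← map_mul, hFG, map_one]

theorem analyticPresheaf_isLocalRing (x : coordSpace 𝕜 N) :
    IsLocalRing ((analyticPresheaf 𝕜 N).stalk x) := by
  have : Nontrivial ((analyticPresheaf 𝕜 N).stalk x) := by
    refine ⟨0, 1, fun h => ?_⟩
    rw [← map_zero ((analyticPresheaf 𝕜 N).germ ⊤ x trivial).hom,
      ← map_one ((analyticPresheaf 𝕜 N).germ ⊤ x trivial).hom] at h
    obtain ⟨W, hW, i, j, h⟩ := (analyticPresheaf 𝕜 N).germ_eq x (U := ⊤) (V := ⊤) trivial trivial _ _ h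
    have := congrFun (congrArg Subtype.val h) ⟨x, hW⟩
    exact zero_ne_one (α := 𝕜) this
  refine IsLocalRing.of_isUnit_or_isUnit_one_sub_self fun a => ?_
  obtain ⟨U, hx, f, rfl⟩ := (analyticPresheaf 𝕜 N).exists_germ_eq a
  let F : analyticSubring 𝕜 N U := f
  by_cases h0 : F.1 ⟨x, hx⟩ = 0
  · right
    have h1 : (1 - F).1 ⟨x, hx⟩ ≠ 0 := by
      change 1 - F.1 ⟨x, hx⟩ ≠ 0
      rw [h0, sub_zero]
      exact one_ne_zero
    have h2 := analyticPresheaf_isUnit 𝕜 N x U hx (1 - F) h1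
    have h3 : (analyticPresheaf 𝕜 N).germ U x hx (1 - f) =
        1 - (analyticPresheaf 𝕜 N).germ U x hx f := by
      rw [map_sub, map_one]
    rw [← h3]
    exact h2
  · exact Or.inl (analyticPresheaf_isUnit 𝕜 N x U hx f h0)

/-- The space `𝕜^N` with its sheaf of analytic functions. -/
def analyticAffineSpace : KSpace.{u} 𝕜 where
  space :=
    { carrier := coordSpace 𝕜 N
      presheaf := analyticPresheaf 𝕜 N
      IsSheaf := analyticPresheaf_isSheaf 𝕜 N
      isLocalRing := analyticPresheaf_isLocalRing 𝕜 N }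
  scalars :=
    { toFun := fun c => (⟨fun _ => c, fun _ => ⟨fun _ => c, analyticAt_const, by simp⟩⟩ :
        analyticSubring 𝕜 N ⊤)
      map_add' := fun _ _ => rfl
      map_mul' := fun _ _ => rfl
      map_one' := rfl
      map_zero' := rfl }

variable {𝕜}

/-- `X` is smooth of dimension `N` at `a`: some open neighbourhood of `a` is isomorphic to an open
subspace of `𝕜^N`. -/
def IsSmoothAnalyticAt (X : KSpace.{u} 𝕜) (N : ℕ) (a : X.Point) : Prop :=
  ∃ (V : Opens X.Point) (φ : KSpace.Hom (X.restrict V) (analyticAffineSpace 𝕜 N)),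
    a ∈ V ∧ LocallyRingedSpace.IsOpenImmersion φ.hom

/-- A (real or complex) analytic manifold (its dimension may vary from point to point). -/
structure IsAnalyticManifold (X : KSpace.{u} 𝕜) : Prop where
  t2 : T2Space X.Point
  smooth : ∀ a, ∃ N, IsSmoothAnalyticAt X N a

/-- A (real or complex) analytic manifold of dimension `n`. -/
structure IsAnalyticManifoldOfDim (X : KSpace.{u} 𝕜) (n : ℕ) : Prop where
  t2 : T2Space X.Point
  smooth : ∀ a, IsSmoothAnalyticAt X n a

/-- A (real or complex) analytic space: a Hausdorff locally ringed space over `𝕜` that is locally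
isomorphic to a model, i.e. to the zero set, in an open subset `U` of some `𝕜^N`, of finitely many
analytic functions `f₁, …, f_r` on `U`, with the structure sheaf `𝒪_U/(f₁, …, f_r)`. -/
structure IsAnalyticSpace (X : KSpace.{u} 𝕜) : Prop where
  t2 : T2Space X.Point
  model : ∀ a : X.Point, ∃ (V : Opens X.Point) (N r : ℕ)
    (U : Opens (analyticAffineSpace 𝕜 N).Point) (f : Fin r → (analyticAffineSpace 𝕜 N).Sections U)
    (φ : KSpace.Hom (X.restrict V) (analyticAffineSpace 𝕜 N)),
    a ∈ V ∧ Topology.IsEmbedding φ.pt ∧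
    (∀ y, y ∈ Set.range φ.pt ↔ ∃ hy : y ∈ U, ∀ j,
      (analyticAffineSpace 𝕜 N).eval y ((analyticAffineSpace 𝕜 N).germ U y hy (f j)) = 0) ∧
    ∀ v, Function.Surjective (φ.pull v) ∧ ∃ hv : φ.pt v ∈ U,
      RingHom.ker (φ.pull v) =
        Ideal.span (Set.range fun j => (analyticAffineSpace 𝕜 N).germ U (φ.pt v) hv (f j))

/-- The complement of `Sing X`: the open set of the points at which `X` is smooth. -/
def analyticSmoothLocus (X : KSpace.{u} 𝕜) : Opens X.Point where
  carrier := {a | ∃ N, IsSmoothAnalyticAt X N a}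
  is_open' := by
    rw [isOpen_iff_forall_mem_open]
    rintro a ⟨N, V, φ, ha, h⟩
    exact ⟨V, fun b hb => ⟨N, V, φ, hb, h⟩, V.isOpen, ha⟩

end Analytic

end GaussMap

end

/-! All three conditions are compared with one intermediate property, `Hom.HasFrameAt`: near each
point of X, the module σ^*Ω¹ is generated by n exact differentials d(h_i∘σ). Only generation has to
be asked for. Off E the map σ is an isomorphism, so n generators span the whole cotangent module
there and their determinant in coordinates of X is invertible; a function invertible off E is not a
zero divisor, so the generators are independent everywhere (`Hom.ResolvesWith.det_mem`). A frame
thus gives local freeness. It also gives principality: a logarithmic minor is the local equation of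
E times an ordinary Jacobian determinant (`AdaptedCoordinates.det_logGrad`), and all these
determinants are multiples of the one formed from the frame.

Conversely, each condition produces frames. If σ^*Ω¹ is free of rank n at a point, then n of the
pulled-back ambient coordinate differentials dz_l form a basis of its stalk
(`exists_finset_span_eq`). If the Fitting ideal is principal, its generator is not a zero divisor,
so over the local ring a single minor generates; Cramer's rule then expresses every differential
through the rows of that minor (`Hom.ResolvesWith.hasFrameAt_of_isPrincipalIdeal`). If the Gauss
mapping extends, the equations D z_l = ∑ A_lm D z_m of a Grassmann chart hold for the tangent
vectors of X off E; they become identities dz_l = ∑ A_lm dz_m on X because a function vanishing off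
E is zero (`LocalEmbedding.GaussExtends.hasFrameAt`). In the other direction the extension is
explicit: the plane at x is dual to the fibre of σ^*Ω¹ at x (`LocalEmbedding.dualPlane`), and the
coefficients expressing all dz_l through n of them are its chart coordinates.

The argument runs for both categories at once. `IsRegularPoint` collects what is needed of a smooth
space: a function vanishing at all nearby points has zero germ, the cotangent sheaf has local frames
of exact differentials with regular coefficients, and a function vanishing on a smooth hypersurface
is divisible by its equation. Functions are treated as germ fields, so that "near a" is a statement
about a neighbourhood filter and identities in one stalk spread out by `eventually_eq`.

For smooth schemes these properties come from standard smooth charts, from reducedness of smooth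
algebras, and from the fact that every neighbourhood of a point contains its generizations. For
manifolds they come from Taylor series: a telescoping division (`AnalyticAt.exists_divided`) gives
Hadamard's lemma and, after straightening by the inverse function theorem, division by the equation
of a hypersurface. -/

noncomputable section

namespace GaussMap

namespace KSpace

open Filter

variable {k : Type v} [Field k]

/-! ### Germ fields -/

section GermFields

variable (X : KSpace.{u} k)

/-- Restriction of functions to a smaller open set. -/
def res {U V : Opens X.Point} (h : V ≤ U) : X.Sections U →+* X.Sections V :=
  (X.space.presheaf.map (homOfLE h).op).hom

theorem germ_res {U V : Opens X.Point} (h : V ≤ U) (x : X.Point) (hx : x ∈ V)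
    (s : X.Sections U) : X.germ V x hx (X.res h s) = X.germ U x (h hx) s :=
  X.space.presheaf.germ_res_apply (homOfLE h) x hx s

theorem exists_germ_eq {x : X.Point} (f : X.Stalk x) :
    ∃ (U : Opens X.Point) (hx : x ∈ U) (s : X.Sections U), X.germ U x hx s = f :=
  X.space.presheaf.exists_germ_eq f

theorem exists_res_eq {U V : Opens X.Point} {x : X.Point} (hU : x ∈ U) (hV : x ∈ V)
    {s : X.Sections U} {t : X.Sections V} (h : X.germ U x hU s = X.germ V x hV t) :
    ∃ (W : Opens X.Point) (_ : x ∈ W) (h₁ : W ≤ U) (h₂ : W ≤ V), X.res h₁ s = X.res h₂ t := by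
  obtain ⟨W, hW, i, j, e⟩ := X.space.presheaf.germ_eq x hU hV s t h
  exact ⟨W, hW, i.le, j.le, e⟩

/-- A germ field assigns to every point a germ of a function at this point. -/
abbrev GermField : Type u := ∀ y : X.Point, X.Stalk y

/-- The germ fields that are near `a` the germs of one function. -/
def regularAt (a : X.Point) : Subring X.GermField where
  carrier := {F | ∃ (U : Opens X.Point) (s : X.Sections U), a ∈ U ∧
    ∀ (y : X.Point) (hy : y ∈ U), F y = X.germ U y hy s}
  mul_mem' := by
    rintro F G ⟨U, s, hU, hs⟩ ⟨V, t, hV, ht⟩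
    refine ⟨U ⊓ V, X.res inf_le_left s * X.res inf_le_right t, ⟨hU, hV⟩, fun y hy => ?_⟩
    rw [map_mul, germ_res, germ_res, Pi.mul_apply, hs y hy.1, ht y hy.2]
  add_mem' := by
    rintro F G ⟨U, s, hU, hs⟩ ⟨V, t, hV, ht⟩
    refine ⟨U ⊓ V, X.res inf_le_left s + X.res inf_le_right t, ⟨hU, hV⟩, fun y hy => ?_⟩
    rw [map_add, germ_res, germ_res, Pi.add_apply, hs y hy.1, ht y hy.2]
  one_mem' := ⟨⊤, 1, trivial, fun y hy => by rw [map_one]; rfl⟩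
  zero_mem' := ⟨⊤, 0, trivial, fun y hy => by rw [map_zero]; rfl⟩
  neg_mem' := by
    rintro F ⟨U, s, hU, hs⟩
    exact ⟨U, -s, hU, fun y hy => by rw [map_neg, Pi.neg_apply, hs y hy]⟩

variable {X}

open Classical in
/-- The germ field of a function on `U`, extended by `0`. -/
def extend {U : Opens X.Point} (s : X.Sections U) : X.GermField :=
  fun y => if hy : y ∈ U then X.germ U y hy s else 0

theorem extend_apply {U : Opens X.Point} (s : X.Sections U) {y : X.Point} (hy : y ∈ U) :
    extend s y = X.germ U y hy s := dif_pos hy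

theorem extend_mem {U : Opens X.Point} (s : X.Sections U) {a : X.Point} (ha : a ∈ U) :
    extend s ∈ X.regularAt a := ⟨U, s, ha, fun _ hy => extend_apply s hy⟩

theorem exists_regularAt {a : X.Point} (f : X.Stalk a) : ∃ F ∈ X.regularAt a, F a = f := by
  obtain ⟨U, ha, s, rfl⟩ := X.exists_germ_eq f
  exact ⟨extend s, extend_mem s ha, extend_apply s ha⟩

theorem eventually_regularAt {a : X.Point} {F : X.GermField} (hF : F ∈ X.regularAt a) :
    ∀ᶠ y in 𝓝 a, F ∈ X.regularAt y := by
  obtain ⟨U, s, hU, hs⟩ := hF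
  filter_upwards [U.isOpen.mem_nhds hU] with y hy
  exact ⟨U, s, hy, hs⟩

/-- Sections with the same germ at `a` already agree on a smaller open set. This is the device by
which an identity in one stalk is spread to the nearby stalks. -/
theorem eventually_eq {a : X.Point} {F G : X.GermField} (hF : F ∈ X.regularAt a)
    (hG : G ∈ X.regularAt a) (h : F a = G a) : ∀ᶠ y in 𝓝 a, F y = G y := by
  obtain ⟨U, s, hU, hs⟩ := hF
  obtain ⟨V, t, hV, ht⟩ := hG
  rw [hs a hU, ht a hV] at h
  obtain ⟨W, hW, h₁, h₂, e⟩ := X.exists_res_eq hU hV h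
  filter_upwards [W.isOpen.mem_nhds hW] with y hy
  rw [hs y (h₁ hy), ht y (h₂ hy), ← X.germ_res h₁ y hy, ← X.germ_res h₂ y hy, e]

theorem eventually_isUnit {a : X.Point} {F : X.GermField} (hF : F ∈ X.regularAt a)
    (h : IsUnit (F a)) : ∀ᶠ y in 𝓝 a, IsUnit (F y) := by
  obtain ⟨u, hu⟩ := h
  obtain ⟨G, hG, hGa⟩ := exists_regularAt ((u⁻¹ : (X.Stalk a)ˣ) : X.Stalk a)
  have := eventually_eq (mul_mem hF hG) (one_mem _) (by simp [hGa, ← hu])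
  filter_upwards [this] with y hy
  exact IsUnit.of_mul_eq_one _ hy

theorem eval_eq_zero_iff {y : X.Point} {f : X.Stalk y} : X.eval y f = 0 ↔ ¬ IsUnit f := by
  have := IsLocalRing.residue_ne_zero_iff_isUnit f
  rw [← this, not_not]
  rfl

theorem eval_ne_zero_iff {y : X.Point} {f : X.Stalk y} : X.eval y f ≠ 0 ↔ IsUnit f := by
  rw [Ne, eval_eq_zero_iff, not_not]

theorem eval_eq_zero_of_mem {y : X.Point} {f : X.Stalk y}
    (hf : f ∈ IsLocalRing.maximalIdeal (X.Stalk y)) : X.eval y f = 0 :=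
  eval_eq_zero_iff.mpr hf

theorem sum_mem_regularAt {a : X.Point} {ι : Type*} (s : Finset ι) (F : ι → X.GermField)
    (hF : ∀ i ∈ s, F i ∈ X.regularAt a) : (fun y => ∑ i ∈ s, F i y) ∈ X.regularAt a := by
  have := sum_mem hF
  convert this using 1
  ext y
  rw [Finset.sum_apply]

theorem prod_mem_regularAt {a : X.Point} {ι : Type*} (s : Finset ι) (F : ι → X.GermField)
    (hF : ∀ i ∈ s, F i ∈ X.regularAt a) : (fun y => ∏ i ∈ s, F i y) ∈ X.regularAt a := by
  have := prod_mem hF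
  convert this using 1
  ext y
  rw [Finset.prod_apply]

theorem det_mem_regularAt {a : X.Point} {n : ℕ} (F : Fin n → Fin n → X.GermField)
    (hF : ∀ i j, F i j ∈ X.regularAt a) :
    (fun y => Matrix.det (Matrix.of fun i j => F i j y)) ∈ X.regularAt a := by
  simp only [Matrix.det_apply', Matrix.of_apply]
  refine sum_mem_regularAt (a := a) _
    (fun σ y => ((Equiv.Perm.sign σ : ℤ) : X.Stalk y) * ∏ i, F (σ i) i y) fun σ _ => ?_
  have h := mul_mem (intCast_mem (X.regularAt a) (Equiv.Perm.sign σ : ℤ))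
    (prod_mem_regularAt Finset.univ (fun i => F (σ i) i) fun i _ => hF _ _)
  exact h

end GermFields

/-! ### Pull-back of germ fields -/

section Pull

variable {X Y : KSpace.{u} k} (f : Hom X Y)

theorem Hom.continuous_pt : Continuous f.pt := f.hom.base.hom.continuous

/-- The pull-back of germ fields. -/
def Hom.pullField (H : Y.GermField) : X.GermField := fun y => f.pull y (H (f.pt y))

theorem Hom.pull_germ (U : Opens Y.Point) (x : X.Point) (hx : f.pt x ∈ U) (s : Y.Sections U) :
    f.pull x (Y.germ U (f.pt x) hx s) =
      X.germ ((Opens.map f.hom.base).obj U) x hx ((f.hom.c.app (op U)).hom s) :=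
  PresheafedSpace.stalkMap_germ_apply f.hom.toHom U x hx s

theorem Hom.pullField_mem {a : X.Point} {H : Y.GermField} (hH : H ∈ Y.regularAt (f.pt a)) :
    f.pullField H ∈ X.regularAt a := by
  obtain ⟨U, s, hU, hs⟩ := hH
  refine ⟨(Opens.map f.hom.base).obj U, (f.hom.c.app (op U)).hom s, hU, fun y hy => ?_⟩
  rw [← f.pull_germ U y hy, ← hs (f.pt y) hy]
  rfl

theorem Hom.eventually {a : X.Point} {p : Y.Point → Prop} (h : ∀ᶠ y in 𝓝 (f.pt a), p y) :
    ∀ᶠ x in 𝓝 a, p (f.pt x) :=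
  f.continuous_pt.continuousAt.eventually h

theorem Hom.pull_algebraMap (x : X.Point) (c : k) :
    f.pull x (algebraMap k _ c) = algebraMap k _ c := by
  change f.pull x (Y.germ ⊤ (f.pt x) trivial (Y.scalars c)) = X.germ ⊤ x trivial (X.scalars c)
  refine (f.pull_germ ⊤ x trivial (Y.scalars c)).trans ?_
  rw [← f.comm c]
  rfl

instance Hom.isLocalHom_pull (x : X.Point) : IsLocalHom (f.pull x) :=
  inferInstanceAs (IsLocalHom (f.hom.stalkMap x).hom)

theorem isUnit_pull_iff {x : X.Point} {g : Y.Stalk (f.pt x)} :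
    IsUnit (f.pull x g) ↔ IsUnit g :=
  isUnit_map_iff _ _

end Pull

end KSpace

end GaussMap

end

noncomputable section

namespace GaussMap

namespace KSpace

open Filter

variable {k : Type v} [Field k]

/-! ### The cotangent spaces -/

section Cotangent

variable (X : KSpace.{u} k)

theorem d_add (x : X.Point) (f g : X.Stalk x) : X.d x (f + g) = X.d x f + X.d x g := by
  unfold d
  rw [map_add]
  rfl

theorem d_mul (x : X.Point) (f g : X.Stalk x) :
    X.d x (f * g) = f • X.d x g + g • X.d x f := by
  unfold d
  rw [Derivation.leibniz]
  rfl

theorem d_algebraMap (x : X.Point) (c : k) : X.d x (algebraMap k _ c) = 0 := by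
  unfold d
  rw [Derivation.map_algebraMap]
  rfl

theorem d_zero (x : X.Point) : X.d x 0 = 0 := by
  rw [← map_zero (algebraMap k (X.Stalk x)), d_algebraMap]

theorem span_range_d (x : X.Point) :
    Submodule.span (X.Stalk x) (Set.range (X.d x)) = ⊤ := by
  have h := KaehlerDifferential.span_range_derivation k (X.Stalk x)
  have h2 := congrArg (Submodule.map (Submodule.mkQ (⨅ i : ℕ,
    (IsLocalRing.maximalIdeal (X.Stalk x)) ^ i •
      (⊤ : Submodule (X.Stalk x) Ω[X.Stalk x⁄k])))) h
  rw [Submodule.map_span, Submodule.map_top, Submodule.range_mkQ, ← Set.range_comp] at h2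
  exact h2

/-- The cotangent spaces are separated. -/
theorem cotangent_separated (x : X.Point) :
    ⨅ i : ℕ, (IsLocalRing.maximalIdeal (X.Stalk x)) ^ i •
      (⊤ : Submodule (X.Stalk x) (X.Cotangent x)) = ⊥ := by
  let N := ⨅ i : ℕ, (IsLocalRing.maximalIdeal (X.Stalk x)) ^ i •
    (⊤ : Submodule (X.Stalk x) Ω[X.Stalk x⁄k])
  change ⨅ i : ℕ, (IsLocalRing.maximalIdeal (X.Stalk x)) ^ i •
      (⊤ : Submodule (X.Stalk x) (Ω[X.Stalk x⁄k] ⧸ N)) = ⊥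
  rw [eq_bot_iff]
  intro q hq
  obtain ⟨w, rfl⟩ := N.mkQ_surjective q
  rw [Submodule.mem_bot, Submodule.mkQ_apply, Submodule.Quotient.mk_eq_zero]
  rw [Submodule.mem_iInf] at hq
  refine Submodule.mem_iInf _ |>.mpr fun i => ?_
  have h := hq i
  have e : (⊤ : Submodule (X.Stalk x) (Ω[X.Stalk x⁄k] ⧸ N)) = Submodule.map N.mkQ ⊤ := by
    rw [Submodule.map_top, Submodule.range_mkQ]
  rw [e, ← Submodule.map_smul''] at h
  obtain ⟨w', hw', he⟩ := h
  -- A lift to the Kähler differentials is determined only up to `N`, which is harmless because `N`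
  -- lies in every 𝔪^i Ω.
  have hN : w - w' ∈ N := by
    rw [← Submodule.Quotient.mk_eq_zero (p := N), Submodule.Quotient.mk_sub, sub_eq_zero]
    exact he.symm
  have := (iInf_le (fun i : ℕ => (IsLocalRing.maximalIdeal (X.Stalk x)) ^ i •
    (⊤ : Submodule (X.Stalk x) Ω[X.Stalk x⁄k])) i) hN
  simpa using Submodule.add_mem _ this hw'

variable {X}

/-- The universal property of the cotangent spaces. -/
theorem exists_cotangent_lift {x : X.Point} {B : Type*} [CommRing B] {Mo : Type*}
    [AddCommGroup Mo] [Module B Mo] (φ : X.Stalk x →+* B) (δ : X.Stalk x → Mo)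
    (hadd : ∀ f g, δ (f + g) = δ f + δ g) (hconst : ∀ c : k, δ (algebraMap k _ c) = 0)
    (hmul : ∀ f g, δ (f * g) = φ f • δ g + φ g • δ f)
    (hsep : ⨅ i : ℕ, (Ideal.map φ (IsLocalRing.maximalIdeal (X.Stalk x))) ^ i •
      (⊤ : Submodule B Mo) = ⊥) :
    ∃ T : X.Cotangent x →ₛₗ[φ] Mo, ∀ f, T (X.d x f) = δ f := by
  let _ : Module (X.Stalk x) Mo := Module.compHom Mo φ
  let _ : Module k Mo := Module.compHom Mo (algebraMap k (X.Stalk x))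
  have _ : IsScalarTower k (X.Stalk x) Mo := ⟨fun c f w => by
    rw [Algebra.smul_def, mul_smul]; rfl⟩
  have hmul' : ∀ f g, δ (f * g) = f • δ g + g • δ f := hmul
  let D : Derivation k (X.Stalk x) Mo := Derivation.mk'
    { toFun := δ
      map_add' := hadd
      map_smul' := fun c f => by
        rw [Algebra.smul_def, hmul', hconst, smul_zero, add_zero]
        rfl } hmul'
  let N := ⨅ i : ℕ, (IsLocalRing.maximalIdeal (X.Stalk x)) ^ i •
    (⊤ : Submodule (X.Stalk x) Ω[X.Stalk x⁄k])
  have key : ∀ (i : ℕ) (w : Ω[X.Stalk x⁄k]), w ∈ (IsLocalRing.maximalIdeal (X.Stalk x)) ^ i •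
      (⊤ : Submodule (X.Stalk x) Ω[X.Stalk x⁄k]) →
      D.liftKaehlerDifferential w ∈
        (Ideal.map φ (IsLocalRing.maximalIdeal (X.Stalk x))) ^ i • (⊤ : Submodule B Mo) := by
    intro i w hw
    refine Submodule.smul_induction_on hw (fun r hr w _ => ?_) (fun w w' h h' => ?_)
    · rw [map_smul]
      change φ r • D.liftKaehlerDifferential w ∈ _
      refine Submodule.smul_mem_smul ?_ trivial
      rw [← Ideal.map_pow]
      exact Ideal.mem_map_of_mem φ hr
    · rw [map_add]
      exact add_mem h h'
  -- The induced map carries 𝔪^i Ω into φ(𝔪)^i Mo, and these submodules have zero intersection by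
  -- `hsep`.
  have hN : N ≤ LinearMap.ker D.liftKaehlerDifferential := by
    intro w hw
    rw [LinearMap.mem_ker, ← Submodule.mem_bot B, ← hsep, Submodule.mem_iInf]
    exact fun i => key i w ((Submodule.mem_iInf _).mp hw i)
  let T : (Ω[X.Stalk x⁄k] ⧸ N) →ₗ[X.Stalk x] Mo := N.liftQ _ hN
  refine ⟨{ toFun := fun w => T w, map_add' := fun a b => T.map_add a b,
            map_smul' := fun r w => T.map_smul r w }, fun f => ?_⟩
  change N.liftQ _ hN (Submodule.Quotient.mk (KaehlerDifferential.D k (X.Stalk x) f)) = δ f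
  rw [Submodule.liftQ_apply, Derivation.liftKaehlerDifferential_comp_D]
  rfl

/-- Tangent vectors, as derivations with values in a field, are linear forms on the cotangent
space. -/
theorem exists_lift_of_mem_tangentSpace {x : X.Point} {L : Type u} [Field L]
    (ev : X.Stalk x →+* L) (hev : ∀ f ∈ IsLocalRing.maximalIdeal (X.Stalk x), ev f = 0)
    {D : X.Stalk x → L} (hD : D ∈ tangentSpace k ev) :
    ∃ T : X.Cotangent x →ₛₗ[ev] L, ∀ f, T (X.d x f) = D f := by
  obtain ⟨h1, h2, h3⟩ := hD
  refine exists_cotangent_lift ev D h1 h2 h3 ?_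
  rw [eq_bot_iff]
  -- Over a field separatedness is automatic: `ev` kills the maximal ideal, so the first power
  -- already gives zero.
  refine (iInf_le _ 1).trans ?_
  have : Ideal.map ev (IsLocalRing.maximalIdeal (X.Stalk x)) = ⊥ := by
    rw [eq_bot_iff, Ideal.map_le_iff_le_comap]
    exact fun f hf => hev f hf
  rw [this, pow_one, Submodule.bot_smul]

theorem mem_tangentSpace_of_lift {x : X.Point} {L : Type u} [Field L] (ev : X.Stalk x →+* L)
    (T : X.Cotangent x →ₛₗ[ev] L) : (fun f => T (X.d x f)) ∈ tangentSpace k ev := by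
  refine ⟨fun f g => ?_, fun c => ?_, fun f g => ?_⟩
  · simp only [d_add, map_add]
  · simp only [d_algebraMap, map_zero]
  · simp only []
    rw [d_mul, map_add, LinearMap.map_smulₛₗ, LinearMap.map_smulₛₗ]
    rfl

variable {Y : KSpace.{u} k}

/-- Functoriality of the cotangent spaces. -/
theorem exists_cotangent_map {x : X.Point} {y : Y.Point} (φ : Y.Stalk y →+* X.Stalk x)
    [IsLocalHom φ] (hφ : ∀ c : k, φ (algebraMap k _ c) = algebraMap k _ c) :
    ∃ T : Y.Cotangent y →ₛₗ[φ] X.Cotangent x, ∀ f, T (Y.d y f) = X.d x (φ f) := by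
  refine exists_cotangent_lift φ (fun f => X.d x (φ f)) (fun f g => ?_) (fun c => ?_)
    (fun f g => ?_) ?_
  · rw [map_add, d_add]
  · rw [hφ, d_algebraMap]
  · rw [map_mul, d_mul]
  · rw [eq_bot_iff, ← X.cotangent_separated x]
    -- Locality of `φ` puts the extended maximal ideal inside that of the target, whose cotangent
    -- space is separated.
    refine iInf_mono fun i => Submodule.smul_mono_left (Ideal.pow_right_mono ?_ i)
    exact ((IsLocalRing.local_hom_TFAE φ).out 0 2).mp ‹IsLocalHom φ›

end Cotangent

end KSpace

end GaussMap

end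

/-! ### Determinants over a commutative ring, and regular points. -/

noncomputable section

namespace GaussMap

theorem basis_det_eq {R M : Type*} [CommRing R] [AddCommGroup M] [Module R M] {n : ℕ}
    (b : Module.Basis (Fin n) R M) (v : Fin n → M) (g : Fin n → Fin n → R)
    (h : ∀ i, v i = ∑ j, g i j • b j) : b.det v = Matrix.det (Matrix.of g) := by
  rw [Module.Basis.det_apply, ← Matrix.det_transpose]
  congr 1
  ext i j
  rw [Matrix.transpose_apply, Module.Basis.toMatrix_apply, h i]
  simp [Finsupp.single_apply]

/-- Cramer's rule. -/
theorem basis_det_smul {R M : Type*} [CommRing R] [AddCommGroup M] [Module R M] {n : ℕ}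
    (b : Module.Basis (Fin n) R M) (v : Fin n → M) (w : M) :
    b.det v • w = ∑ i, b.det (Function.update v i w) • v i := by
  have h := Matrix.mulVec_cramer (b.toMatrix v) (b.repr w)
  apply b.repr.injective
  ext j
  have hj := congrFun h j
  simp only [Matrix.mulVec, dotProduct, Matrix.cramer_apply, Pi.smul_apply, smul_eq_mul] at hj
  rw [map_smul, map_sum, Finsupp.smul_apply, Finsupp.finsetSum_apply, Module.Basis.det_apply,
    smul_eq_mul, ← hj]
  refine Finset.sum_congr rfl fun i _ => ?_
  rw [map_smul, Finsupp.smul_apply, smul_eq_mul, Module.Basis.det_apply, mul_comm,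
    Module.Basis.toMatrix_update, Module.Basis.toMatrix_apply]

/-- Substituting a relation ∑ g_j v_j for the i-th vector turns the determinant into g_i · det v,
because the alternating form kills the other terms. Hence g_i · det v = 0, and no domain hypothesis
is needed. -/
theorem linearIndependent_of_det {R M : Type*} [CommRing R] [AddCommGroup M] [Module R M]
    {n : ℕ} (b : Module.Basis (Fin n) R M) (v : Fin n → M)
    (h : b.det v ∈ nonZeroDivisors R) : LinearIndependent R v := by
  rw [Fintype.linearIndependent_iff]
  intro g hg i
  have h1 : b.det (Function.update v i (∑ j, g j • v j)) = g i * b.det v := by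
    rw [AlternatingMap.map_update_sum, Finset.sum_eq_single i]
    · rw [AlternatingMap.map_update_smul, Function.update_eq_self, smul_eq_mul]
    · intro j _ hj
      rw [AlternatingMap.map_update_smul, AlternatingMap.map_update_self _ _ hj.symm, smul_zero]
    · simp
  rw [hg, AlternatingMap.map_update_zero] at h1
  exact (mem_nonZeroDivisors_iff_right.mp h) _ h1.symm

/-- The determinant of a family of combinations of `n` vectors is a multiple of the determinant of
these vectors. -/
theorem basis_det_dvd {R M : Type*} [CommRing R] [AddCommGroup M] [Module R M] {n : ℕ}
    (b : Module.Basis (Fin n) R M) (v w : Fin n → M)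
    (h : ∀ i, w i ∈ Submodule.span R (Set.range v)) : b.det v ∣ b.det w := by
  choose c hc using fun i => (Submodule.mem_span_range_iff_exists_fun R).mp (h i)
  let e := Pi.basisFun R (Fin n)
  let l : (Fin n → R) →ₗ[R] M := e.constr R v
  have hl : ∀ i, l (e i) = v i := fun i => e.constr_basis R v i
  have hw : ∀ i, w i = l (c i) := by
    intro i
    rw [← hc i, Module.Basis.constr_apply_fintype]
    simp [e]
  -- Pulled back along R^n → M, e_i ↦ v_i, the form `b.det` is an alternating n-form on R^n, hence
  -- its value on the standard basis times the standard determinant.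
  have key := (b.det.compLinearMap l).eq_smul_basis_det e
  have h1 := congrArg (fun f => f c) key
  simp only [AlternatingMap.compLinearMap_apply, AlternatingMap.smul_apply, smul_eq_mul] at h1
  refine ⟨e.det c, ?_⟩
  have h2 : (b.det fun i => l (c i)) = b.det w := by
    congr 1
    ext i
    rw [hw]
  have h3 : (b.det fun i => l (e i)) = b.det v := by
    congr 1
    ext i
    rw [hl]
  rw [← h2, ← h3]
  exact h1

namespace KSpace

open Filter

variable {k : Type v} [Field k]

section Manifold

variable {X : KSpace.{u} k}

/-- The differentials at `y` of the germs `z i y` form a basis of the cotangent space. -/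
def IsCoordinatesAt {N : ℕ} (z : Fin N → X.GermField) (y : X.Point) : Prop :=
  ∃ b : Module.Basis (Fin N) (X.Stalk y) (X.Cotangent y), ∀ i, b i = X.d y (z i y)

variable (X) in
/-- A point at which there are local coordinates, functions are determined by their values, and
functions that vanish on a smooth hypersurface are divisible by its equation. -/
structure IsRegularPoint (a : X.Point) : Prop where
  reduced : ∀ F ∈ X.regularAt a, (∀ᶠ y in 𝓝 a, X.eval y (F y) = 0) → F a = 0
  frame : ∃ (N : ℕ) (z : Fin N → X.GermField), (∀ i, z i ∈ X.regularAt a) ∧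
    (∀ᶠ y in 𝓝 a, IsCoordinatesAt z y) ∧ ∀ F ∈ X.regularAt a, ∃ g : Fin N → X.GermField,
      (∀ i, g i ∈ X.regularAt a) ∧ ∀ᶠ y in 𝓝 a, X.d y (F y) = ∑ i, g i y • X.d y (z i y)
  dvd : ∀ T ∈ X.regularAt a, ∀ T' ∈ X.regularAt a,
    (∃ φ : X.Cotangent a →ₗ[X.Stalk a] X.Stalk a, φ (X.d a (T a)) = 1) →
    (∀ᶠ y in 𝓝 a, X.eval y (T y) = 0 → X.eval y (T' y) = 0) → T a ∣ T' a

theorem basis_coeff_unique {a : X.Point} {N : ℕ} {z : Fin N → X.GermField}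
    {b : Module.Basis (Fin N) (X.Stalk a) (X.Cotangent a)} (hb : ∀ i, b i = X.d a (z i a))
    {p q : Fin N → X.Stalk a} (h : ∑ i, p i • X.d a (z i a) = ∑ i, q i • X.d a (z i a)) : p = q := by
  simp only [← hb] at h
  have := congrArg b.equivFun h
  simpa [Module.Basis.equivFun_apply, funext_iff, Finsupp.single_apply] using this

variable {a : X.Point} (hX : X.IsRegularPoint a)

include hX

/-- Relations between differentials spread out. -/
theorem IsRegularPoint.eventually_d_eq {ι : Type*} [Fintype ι] {F : X.GermField}
    (hF : F ∈ X.regularAt a) {G T : ι → X.GermField} (hG : ∀ i, G i ∈ X.regularAt a)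
    (hT : ∀ i, T i ∈ X.regularAt a) (h : X.d a (F a) = ∑ i, G i a • X.d a (T i a)) :
    ∀ᶠ y in 𝓝 a, X.d y (F y) = ∑ i, G i y • X.d y (T i y) := by
  obtain ⟨N, z, hz, hzy, hco⟩ := hX.frame
  obtain ⟨f, hf, hFf⟩ := hco F hF
  choose t ht hTt using fun i => hco (T i) (hT i)
  have hTt' : ∀ᶠ y in 𝓝 a, ∀ i, X.d y (T i y) = ∑ j, t i j y • X.d y (z j y) :=
    eventually_all.mpr hTt
  have expand : ∀ y, (∀ i, X.d y (T i y) = ∑ j, t i j y • X.d y (z j y)) →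
      ∑ i, G i y • X.d y (T i y) = ∑ j, (∑ i, G i y * t i j y) • X.d y (z j y) := by
    intro y hy
    simp only [hy, Finset.smul_sum, Finset.sum_smul, mul_smul]
    exact Finset.sum_comm
  -- In the frame `z` the relation becomes equality of coefficients, which are regular functions;
  -- their equality at `a` spreads.
  have hco' : ∀ j, f j a = ∑ i, G i a * t i j a := by
    obtain ⟨b, hb⟩ := hzy.self_of_nhds
    rw [hFf.self_of_nhds, expand a hTt'.self_of_nhds] at h
    exact fun j => congrFun (basis_coeff_unique hb h) j
  have hco2 : ∀ᶠ y in 𝓝 a, ∀ j, f j y = ∑ i, G i y * t i j y := by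
    refine eventually_all.mpr fun j => eventually_eq (hf j) ?_ (hco' j)
    exact sum_mem_regularAt Finset.univ (fun i => G i * t i j)
      fun i _ => mul_mem (hG i) (ht i j)
  filter_upwards [hFf, hTt', hco2] with y h1 h2 h3
  rw [h1, expand y h2]
  simp only [h3]

/-- Any functions whose differentials form a basis at the single point `a` may replace the given
frame. The transition determinant is a unit at `a`, hence nearby, and the coefficients of dF at `a`
extend to regular fields for which the relation spreads. -/
theorem IsRegularPoint.frame_of_basis {n : ℕ} {T : Fin n → X.GermField}
    (hT : ∀ i, T i ∈ X.regularAt a) (hTa : IsCoordinatesAt T a) :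
    (∀ᶠ y in 𝓝 a, IsCoordinatesAt T y) ∧
    ∀ F ∈ X.regularAt a, ∃ g : Fin n → X.GermField,
      (∀ i, g i ∈ X.regularAt a) ∧ ∀ᶠ y in 𝓝 a, X.d y (F y) = ∑ i, g i y • X.d y (T i y) := by
  obtain ⟨b, hb⟩ := hTa
  constructor
  · obtain ⟨N, z, hz, hzy, hco⟩ := hX.frame
    obtain ⟨bz, hbz⟩ := hzy.self_of_nhds
    obtain rfl : N = n := by simpa using Fintype.card_congr (bz.indexEquiv b)
    choose g hg hgT using fun i => hco (T i) (hT i)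
    have hgT' : ∀ᶠ y in 𝓝 a, ∀ i, X.d y (T i y) = ∑ j, g i j y • X.d y (z j y) :=
      eventually_all.mpr hgT
    have hu : ∀ᶠ y in 𝓝 a, IsUnit (Matrix.det (Matrix.of fun i j => g i j y)) := by
      refine eventually_isUnit (det_mem_regularAt g hg) ?_
      rw [← basis_det_eq bz b]
      · exact bz.isUnit_det b
      · intro i
        rw [hb, hgT'.self_of_nhds i]
        simp only [hbz]
    filter_upwards [hzy, hgT', hu] with y ⟨by', hby⟩ h1 h2
    have h3 : IsUnit (by'.det fun i => X.d y (T i y)) := by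
      rw [basis_det_eq by' _ (fun i j => g i j y)]
      · exact h2
      · intro i
        rw [h1 i]
        simp only [hby]
    obtain ⟨h4, h5⟩ := (Module.Basis.is_basis_iff_det by').mpr h3
    exact ⟨Module.Basis.mk h4 h5.ge, fun i => Module.Basis.mk_apply h4 h5.ge i⟩
  · intro F hF
    choose g hg hga using fun i => exists_regularAt (b.repr (X.d a (F a)) i)
    refine ⟨g, hg, hX.eventually_d_eq hF hg hT ?_⟩
    simp only [hga, ← hb]
    exact (b.sum_repr _).symm

theorem IsRegularPoint.eq_zero_of_sq {f : X.Stalk a} (h : f * f = 0) : f = 0 := by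
  obtain ⟨F, hF, rfl⟩ := exists_regularAt f
  refine hX.reduced F hF ?_
  have := eventually_eq (mul_mem hF hF) (zero_mem _) h
  filter_upwards [this] with y hy
  have : X.eval y (F y) * X.eval y (F y) = 0 := by
    rw [← map_mul]
    change X.eval y ((F * F) y) = 0
    rw [hy]
    exact map_zero _
  exact mul_self_eq_zero.mp this

/-- A function with a derivative equal to `1` is not a zero divisor. -/
theorem IsRegularPoint.mem_nonZeroDivisors {t : X.Stalk a}
    (ht : ∃ φ : X.Cotangent a →ₗ[X.Stalk a] X.Stalk a, φ (X.d a t) = 1) :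
    t ∈ nonZeroDivisors (X.Stalk a) := by
  obtain ⟨φ, hφ⟩ := ht
  refine mem_nonZeroDivisors_iff_right.mpr fun f hf => hX.eq_zero_of_sq ?_
  -- Apply φ∘d to f t = 0; multiplying the result by f then gives f² = 0.
  have h1 : f + t * φ (X.d a f) = 0 := by
    have := congrArg φ (congrArg (X.d a) hf)
    rwa [d_mul, map_add, map_smul, map_smul, hφ, d_zero, map_zero, smul_eq_mul, smul_eq_mul,
      mul_one] at this
  calc f * f = f * (f + t * φ (X.d a f)) - (f * t) * φ (X.d a f) := by ring
    _ = 0 := by rw [h1, hf]; ring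

end Manifold

end KSpace

end GaussMap

end

/-! ### Adapted coordinates and equations of the divisor. -/

noncomputable section

namespace GaussMap

namespace KSpace

open Filter

variable {k : Type v} [Field k]

section Adapted

variable {X : KSpace.{u} k} {ι : Type w} {E : ι → Set X.Point} {n : ℕ} {a : X.Point}

theorem AdaptedCoordinates.exists_coord (c : X.AdaptedCoordinates E n a) (i : Fin n) :
    ∃ φ : X.Cotangent a →ₗ[X.Stalk a] X.Stalk a, φ (X.d a (c.t i)) = 1 :=
  ⟨c.basis.coord i, by rw [← c.basis_eq, Module.Basis.coord_apply, Module.Basis.repr_self,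
    Finsupp.single_eq_same]⟩

open Classical in
/-- The product of the equations of the components through `a`. -/
def AdaptedCoordinates.equationProd (c : X.AdaptedCoordinates E n a) : X.Stalk a :=
  ∏ i, if i ∈ Set.range c.index then c.t i else 1

theorem AdaptedCoordinates.equationProd_mem (c : X.AdaptedCoordinates E n a)
    (hX : X.IsRegularPoint a) : c.equationProd ∈ nonZeroDivisors (X.Stalk a) := by
  refine Submonoid.prod_mem _ fun i _ => ?_
  split_ifs
  · exact hX.mem_nonZeroDivisors (c.exists_coord i)
  · exact one_mem _

/-- Functions that define the components of the divisor near `a`. -/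
structure IsAdaptedField (c : X.AdaptedCoordinates E n a) (T : Fin n → X.GermField) : Prop where
  mem : ∀ i, T i ∈ X.regularAt a
  eq : ∀ i, T i a = c.t i
  zero : ∀ j, ∀ᶠ y in 𝓝 a, y ∈ E j.1 ↔ X.eval y (T (c.index j) y) = 0

theorem AdaptedCoordinates.exists_field (c : X.AdaptedCoordinates E n a) :
    ∃ T : Fin n → X.GermField, IsAdaptedField c T := by
  choose T hT hTa using fun i => exists_regularAt (c.t i)
  refine ⟨T, hT, hTa, fun j => ?_⟩
  obtain ⟨U, ha, s, hs, h⟩ := c.equation j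
  have := eventually_eq (hT (c.index j)) (extend_mem s ha) (by rw [hTa, extend_apply s ha, hs])
  filter_upwards [this, U.isOpen.mem_nhds ha] with y h1 h2
  rw [h y h2, h1, extend_apply s h2]

theorem IsSNC.eventually_mem (hE : X.IsSNC E n) (a : X.Point) :
    ∀ᶠ y in 𝓝 a, ∀ j, y ∈ E j → a ∈ E j :=
  hE.locallyFinite.eventually_subset hE.isClosed a

variable {c : X.AdaptedCoordinates E n a} {T : Fin n → X.GermField}

open Classical in
/-- The product of the equations of the components through `a`, as a germ field. -/
def IsAdaptedField.equationProd (_ : IsAdaptedField c T) : X.GermField :=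
  fun y => ∏ i, if i ∈ Set.range c.index then T i y else 1

theorem IsAdaptedField.equationProd_mem (h : IsAdaptedField c T) :
    h.equationProd ∈ X.regularAt a := by
  classical
  refine prod_mem_regularAt Finset.univ (fun i y => if i ∈ Set.range c.index then T i y else 1)
    fun i _ => ?_
  split_ifs
  · exact h.mem i
  · exact one_mem _

theorem IsAdaptedField.equationProd_self (h : IsAdaptedField c T) :
    h.equationProd a = c.equationProd := by
  simp only [IsAdaptedField.equationProd, AdaptedCoordinates.equationProd, h.eq]

theorem IsAdaptedField.isCoordinatesAt (h : IsAdaptedField c T) : IsCoordinatesAt T a :=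
  ⟨c.basis, fun i => by rw [c.basis_eq, h.eq]⟩

theorem IsAdaptedField.eventually_zero (h : IsAdaptedField c T) :
    ∀ᶠ y in 𝓝 a, ∀ j, y ∈ E j.1 ↔ X.eval y (T (c.index j) y) = 0 := by
  have : Finite {j // a ∈ E j} := Finite.of_injective _ c.index.injective
  exact eventually_all.mpr h.zero

/-- Adapted coordinates at a point are adapted coordinates at the nearby points. -/
theorem IsAdaptedField.eventually_adapted (h : IsAdaptedField c T) (hX : X.IsRegularPoint a)
    (hE : X.IsSNC E n) :
    ∀ᶠ y in 𝓝 a, ∃ c' : X.AdaptedCoordinates E n y, (∀ i, c'.t i = T i y) ∧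
      Associated c'.equationProd (h.equationProd y) := by
  classical
  have h1 := (hX.frame_of_basis h.mem h.isCoordinatesAt).1
  have h2 := eventually_eventually_nhds.mpr h.eventually_zero
  have h3 : ∀ᶠ y in 𝓝 a, ∀ i, T i ∈ X.regularAt y :=
    eventually_all.mpr fun i => eventually_regularAt (h.mem i)
  filter_upwards [h1, h2, h3, hE.eventually_mem a] with y ⟨b, hb⟩ h2 h3 h4
  let ind : {j // y ∈ E j} ↪ Fin n :=
    ⟨fun j => c.index ⟨j.1, h4 j.1 j.2⟩, fun j j' e => by
      have := c.index.injective e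
      exact Subtype.ext (congrArg (fun q => q.1) this)⟩
  let c' : X.AdaptedCoordinates E n y :=
    { t := fun i => T i y
      basis := b
      basis_eq := hb
      index := ind
      equation := fun j => by
        obtain ⟨U, s, hU, hs⟩ := h3 (ind j)
        obtain ⟨V, hV, hVo, hyV⟩ := eventually_nhds_iff.mp h2
        have hy : y ∈ U ⊓ ⟨V, hVo⟩ := ⟨hU, hyV⟩
        refine ⟨U ⊓ ⟨V, hVo⟩, hy, X.res inf_le_left s, ?_, fun z hz => ?_⟩
        · rw [germ_res, hs]
        · rw [germ_res, ← hs z hz.1]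
          exact hV z hz.2 ⟨j.1, h4 j.1 j.2⟩ }
  refine ⟨c', fun i => rfl, ?_⟩
  -- A component through `a` may miss `y`. Its equation is then a unit at `y`, so omitting it
  -- changes the product only by a unit.
  have key : ∀ i, Associated (if i ∈ Set.range c'.index then c'.t i else 1)
      (if i ∈ Set.range c.index then T i y else 1) := by
    intro i
    by_cases hi : i ∈ Set.range c'.index
    · obtain ⟨j, rfl⟩ := hi
      rw [if_pos ⟨j, rfl⟩, if_pos ⟨_, rfl⟩]
    · rw [if_neg hi]
      by_cases hi' : i ∈ Set.range c.index
      · rw [if_pos hi']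
        obtain ⟨j, rfl⟩ := hi'
        refine (associated_one_iff_isUnit.mpr ?_).symm
        rw [← eval_ne_zero_iff, Ne, ← h2.self_of_nhds j]
        exact fun hy => hi ⟨⟨j.1, hy⟩, rfl⟩
      · rw [if_neg hi']
  exact Associated.prod Finset.univ _ _ fun i _ => key i

/-- The product of the equations vanishes on the divisor. -/
theorem IsAdaptedField.eventually_eval_equationProd (h : IsAdaptedField c T)
    (hE : X.IsSNC E n) :
    ∀ᶠ y in 𝓝 a, (∃ j, y ∈ E j) → X.eval y (h.equationProd y) = 0 := by
  classical
  filter_upwards [h.eventually_zero, hE.eventually_mem a] with y h1 h2 ⟨j, hj⟩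
  unfold IsAdaptedField.equationProd
  rw [map_prod]
  refine Finset.prod_eq_zero (Finset.mem_univ (c.index ⟨j, h2 j hj⟩)) ?_
  rw [if_pos ⟨_, rfl⟩]
  exact (h1 _).mp hj

/-- A function that vanishes outside the divisor is zero. -/
theorem IsSNC.eq_zero_of_eventually (hE : X.IsSNC E n) (hX : X.IsRegularPoint a)
    {F : X.GermField} (hF : F ∈ X.regularAt a)
    (h0 : ∀ᶠ y in 𝓝 a, (¬ ∃ j, y ∈ E j) → X.eval y (F y) = 0) : F a = 0 := by
  obtain ⟨c⟩ := hE.adapted a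
  obtain ⟨T, h⟩ := c.exists_field
  -- F times the equation of the divisor vanishes both on and off the divisor, hence is zero; the
  -- equation is then cancelled as a nonzerodivisor.
  have h1 := hX.reduced _ (mul_mem hF h.equationProd_mem) (by
    filter_upwards [h0, h.eventually_eval_equationProd hE] with y h1 h2
    rw [Pi.mul_apply, map_mul]
    by_cases hy : ∃ j, y ∈ E j
    · rw [h2 hy, mul_zero]
    · rw [h1 hy, zero_mul])
  rw [Pi.mul_apply, h.equationProd_self] at h1
  exact (mem_nonZeroDivisors_iff_right.mp (c.equationProd_mem hX)) _ h1

/-- A function that is invertible outside the divisor is not a zero divisor. -/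
theorem IsSNC.mem_nonZeroDivisors_of_eventually (hE : X.IsSNC E n) (hX : X.IsRegularPoint a)
    {F : X.GermField} (hF : F ∈ X.regularAt a)
    (h0 : ∀ᶠ y in 𝓝 a, (¬ ∃ j, y ∈ E j) → IsUnit (F y)) : F a ∈ nonZeroDivisors (X.Stalk a) := by
  refine mem_nonZeroDivisors_iff_right.mpr fun f hf => ?_
  obtain ⟨G, hG, rfl⟩ := exists_regularAt f
  refine hE.eq_zero_of_eventually hX hG ?_
  filter_upwards [h0, eventually_eq (mul_mem hG hF) (zero_mem _) hf] with y h1 h2 hy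
  have : G y = 0 := (h1 hy).mul_left_eq_zero.mp h2
  rw [this, map_zero]

/-- The equations of the components with respect to different adapted coordinates divide each
other. -/
theorem AdaptedCoordinates.equationProd_dvd (hX : X.IsRegularPoint a)
    (c c' : X.AdaptedCoordinates E n a) : c.equationProd ∣ c'.equationProd := by
  classical
  have : Fintype {j // a ∈ E j} := Fintype.ofInjective _ c.index.injective
  -- Two systems may number the same component differently, so the products are compared factor by
  -- factor only after reindexing by components.
  have key : ∀ c : X.AdaptedCoordinates E n a, c.equationProd = ∏ j, c.t (c.index j) := by
    intro c
    unfold AdaptedCoordinates.equationProd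
    rw [← Finset.prod_image (s := Finset.univ) (g := c.index) (f := c.t)
        (fun i _ j _ e => c.index.injective e)]
    have hmem : ∀ i, i ∈ Finset.univ.image c.index ↔ i ∈ Set.range c.index := by simp
    refine (Finset.prod_subset_one_on_sdiff (Finset.subset_univ _) (fun i hi => ?_)
      fun i hi => ?_).symm
    · rw [Finset.mem_sdiff, hmem] at hi
      exact if_neg hi.2
    · rw [hmem] at hi
      exact (if_pos hi).symm
  rw [key, key]
  refine Finset.prod_dvd_prod_of_dvd _ _ fun j _ => ?_
  obtain ⟨T, h⟩ := c.exists_field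
  obtain ⟨T', h'⟩ := c'.exists_field
  rw [← h.eq, ← h'.eq]
  refine hX.dvd _ (h.mem _) _ (h'.mem _) ?_ ?_
  · rw [h.eq]
    exact c.exists_coord _
  · filter_upwards [h.zero j, h'.zero j] with y h1 h2 h3
    exact h2.mp (h1.mpr h3)

end Adapted

/-! ### The logarithmic Jacobian determinant. -/

section Fitting

variable {X X₀ : KSpace.{u} k} {σ : Hom X X₀} {ι : Type w} {E : ι → Set X.Point} {n : ℕ}
  {a : X.Point}

/-- Passing to the logarithmic basis multiplies the column of each u_i by u_i and leaves the other
columns alone. -/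
theorem AdaptedCoordinates.det_logGrad (c : X.AdaptedCoordinates E n a)
    (f : Fin n → X.Stalk a) :
    Matrix.det (Matrix.of fun i j => c.logGrad (f i) j) =
      c.equationProd * c.basis.det fun i => X.d a (f i) := by
  classical
  rw [Module.Basis.det_apply, ← Matrix.det_transpose (c.basis.toMatrix _)]
  exact Matrix.det_mul_row (fun i => if i ∈ Set.range c.index then c.t i else 1) _

/-- The minors have full order n, so a choice of columns is either a permutation, which affects only
the sign, or repeats a column and gives zero. -/
theorem Hom.logFitting_eq :
    σ.logFitting E n 0 a = Ideal.span {δ | ∃ (c : X.AdaptedCoordinates E n a)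
      (f : Fin n → X₀.Stalk (σ.pt a)),
      δ = c.equationProd * c.basis.det fun i => X.d a (σ.pull a (f i))} := by
  apply le_antisymm
  · refine Ideal.span_le.mpr ?_
    rintro _ ⟨c, f, e, rfl⟩
    change Matrix.det ((Matrix.of fun i j => c.logGrad (σ.pull a (f i)) j).submatrix id e) ∈ _
    by_cases he : Function.Injective e
    · let p : Equiv.Perm (Fin n) := Equiv.ofBijective e (Finite.injective_iff_bijective.mp he)
      have := Matrix.det_permute' p (Matrix.of fun i j => c.logGrad (σ.pull a (f i)) j)
      refine (congrArg (· ∈ _) this).mpr (Ideal.mul_mem_left _ _ (Ideal.subset_span ?_))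
      exact ⟨c, f, c.det_logGrad _⟩
    · rw [Function.Injective] at he
      push Not at he
      obtain ⟨i, j, h1, h2⟩ := he
      rw [Matrix.det_zero_of_column_eq h2]
      · exact zero_mem _
      · intro l
        simp [h1]
  · refine Ideal.span_le.mpr ?_
    rintro _ ⟨c, f, rfl⟩
    refine Ideal.subset_span ⟨c, f, id, ?_⟩
    rw [← c.det_logGrad]
    rfl

end Fitting

end KSpace

end GaussMap

end

noncomputable section

namespace GaussMap

namespace KSpace

open Filter

variable {k : Type v} [Field k]

/-! ### Open subspaces and local embeddings -/

section Restrict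

variable {X : KSpace.{u} k} {V : Opens X.Point}

theorem restrictStalk_germ (U : Opens (X.restrict V).Point) {x : X.Point} (hx : x ∈ V)
    (hU : X.restrictPoint V x hx ∈ U) (s : (X.restrict V).Sections U) :
    X.restrictStalk V x hx ((X.restrict V).germ U (X.restrictPoint V x hx) hU s) =
      X.germ (V.isOpenEmbedding.functor.obj U) x ⟨⟨x, hx⟩, hU, rfl⟩ s :=
  congrArg (fun f => f.hom s) (X.space.restrictStalkIso_hom_eq_germ V.isOpenEmbedding U ⟨x, hx⟩ hU)

theorem restrictStalk_bijective {x : X.Point} (hx : x ∈ V) :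
    Function.Bijective (X.restrictStalk V x hx) :=
  (X.space.restrictStalkIso V.isOpenEmbedding (⟨x, hx⟩ : V)).commRingCatIsoToRingEquiv.bijective

instance isLocalHom_restrictStalk {x : X.Point} (hx : x ∈ V) :
    IsLocalHom (X.restrictStalk V x hx) :=
  ⟨fun f hf => by
    let e := RingEquiv.ofBijective _ (restrictStalk_bijective hx)
    have := hf.map e.symm
    rwa [show X.restrictStalk V x hx f = e f from rfl, e.symm_apply_apply] at this⟩

theorem restrictStalk_algebraMap {x : X.Point} (hx : x ∈ V) (c : k) :
    X.restrictStalk V x hx (algebraMap k _ c) = algebraMap k _ c := by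
  refine (restrictStalk_germ ⊤ hx trivial ((X.restrict V).scalars c)).trans ?_
  exact X.germ_res (le_top : V.isOpenEmbedding.functor.obj ⊤ ≤ ⊤) x ⟨⟨x, hx⟩, trivial, rfl⟩
    (X.scalars c)

end Restrict

namespace LocalEmbedding

variable {X X₀ M : KSpace.{u} k} (i : LocalEmbedding X₀ M)

instance isLocalHom_pull (b : X₀.Point) (hb : b ∈ i.V) : IsLocalHom (i.pull b hb) :=
  ⟨fun _ hf => (isUnit_pull_iff i.emb (x := X₀.restrictPoint i.V b hb)).mp
    ((isLocalHom_restrictStalk hb).map_nonunit _ hf)⟩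

theorem pull_algebraMap (b : X₀.Point) (hb : b ∈ i.V) (c : k) :
    i.pull b hb (algebraMap k _ c) = algebraMap k _ c :=
  (congrArg (X₀.restrictStalk _ b hb) (i.emb.pull_algebraMap _ c)).trans
    (restrictStalk_algebraMap hb c)

theorem pull_surjective (b : X₀.Point) (hb : b ∈ i.V) : Function.Surjective (i.pull b hb) :=
  (restrictStalk_bijective hb).2.comp (i.isEmbedding.surjective _)

theorem eventually {b : X₀.Point} (hb : b ∈ i.V) {p : M.Point → Prop}
    (h : ∀ᶠ m in 𝓝 (i.pt b hb), p m) : ∀ᶠ b' in 𝓝 b, ∃ hb', p (i.pt b' hb') := by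
  have h1 : ∀ᶠ q : i.V in 𝓝 (⟨b, hb⟩ : i.V), p (i.emb.pt q) :=
    i.emb.continuous_pt.continuousAt.eventually h
  rw [nhds_subtype_eq_comap, eventually_comap] at h1
  filter_upwards [h1, i.V.isOpen.mem_nhds hb] with b' h1 h2
  exact ⟨h2, h1 ⟨b', h2⟩ rfl⟩

open Classical in
/-- The restriction to `X₀` of germ fields on `M`. -/
def pullField (H : M.GermField) : X₀.GermField :=
  fun b => if hb : b ∈ i.V then i.pull b hb (H (i.pt b hb)) else 0

theorem pullField_apply (H : M.GermField) {b : X₀.Point} (hb : b ∈ i.V) :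
    i.pullField H b = i.pull b hb (H (i.pt b hb)) := dif_pos hb

theorem pullField_mem {b : X₀.Point} (hb : b ∈ i.V) {H : M.GermField}
    (hH : H ∈ M.regularAt (i.pt b hb)) : i.pullField H ∈ X₀.regularAt b := by
  obtain ⟨U, s, hU, hs⟩ := i.emb.pullField_mem hH
  refine ⟨i.V.isOpenEmbedding.functor.obj U, s, ⟨⟨b, hb⟩, hU, rfl⟩, ?_⟩
  rintro _ ⟨⟨y, hy⟩, hyU, rfl⟩
  refine (i.pullField_apply H hy).trans ?_
  refine Eq.trans ?_ (restrictStalk_germ U hy hyU s)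
  exact congrArg _ (hs _ hyU)

variable {i} {σ : Hom X X₀} {x : X.Point}

/-- Functions on `M` pulled back to `X`, on germs. -/
def comap (i : LocalEmbedding X₀ M) (σ : Hom X X₀) (x : X.Point) (hx : σ.pt x ∈ i.V) :
    M.Stalk (i.pt (σ.pt x) hx) →+* X.Stalk x :=
  (σ.pull x).comp (i.pull (σ.pt x) hx)

instance isLocalHom_comap (hx : σ.pt x ∈ i.V) : IsLocalHom (i.comap σ x hx) :=
  RingHom.isLocalHom_comp _ _

theorem exists_cotangent_map (hx : σ.pt x ∈ i.V) :
    ∃ T : M.Cotangent (i.pt (σ.pt x) hx) →ₛₗ[i.comap σ x hx] X.Cotangent x,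
      ∀ g, T (M.d _ g) = X.d x (i.comap σ x hx g) := by
  refine KSpace.exists_cotangent_map (i.comap σ x hx) fun c => ?_
  unfold comap
  rw [RingHom.comp_apply, pull_algebraMap, Hom.pull_algebraMap]

/-- Every germ on X₀ is the restriction of a germ on the ambient space, since the stalk maps of an
embedding are surjective. -/
theorem pullForms_eq (hx : σ.pt x ∈ i.V) :
    σ.pullForms x = Submodule.span (X.Stalk x) (Set.range fun g => X.d x (i.comap σ x hx g)) := by
  unfold Hom.pullForms
  congr 1
  ext w
  constructor
  · rintro ⟨f, rfl⟩
    obtain ⟨g, rfl⟩ := i.pull_surjective _ hx f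
    exact ⟨g, rfl⟩
  · rintro ⟨g, rfl⟩
    exact ⟨i.pull _ hx g, rfl⟩

theorem d_comap_eq (hx : σ.pt x ∈ i.V) {N : ℕ} {g : M.Stalk (i.pt (σ.pt x) hx)}
    {c z : Fin N → M.Stalk (i.pt (σ.pt x) hx)} (h : M.d _ g = ∑ m, c m • M.d _ (z m)) :
    X.d x (i.comap σ x hx g) = ∑ m, i.comap σ x hx (c m) • X.d x (i.comap σ x hx (z m)) := by
  obtain ⟨T, hT⟩ := exists_cotangent_map hx
  rw [← hT, h, map_sum]
  refine Finset.sum_congr rfl fun m _ => ?_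
  rw [LinearMap.map_smulₛₗ, hT]

theorem pullField_comap (H : M.GermField) (hx : σ.pt x ∈ i.V) :
    σ.pullField (i.pullField H) x = i.comap σ x hx (H _) := by
  unfold Hom.pullField
  rw [pullField_apply _ _ hx]
  rfl

end LocalEmbedding

/-! ### Generators of the pulled-back forms -/

section Generators

variable {X X₀ : KSpace.{u} k} {σ : Hom X X₀}

theorem Hom.d_pullField_mem (H : X₀.GermField) (y : X.Point) :
    X.d y (σ.pullField H y) ∈ σ.pullForms y :=
  Submodule.subset_span ⟨H (σ.pt y), rfl⟩

theorem pull_bijective_of_isOpenImmersion {Y : KSpace.{u} k} (f : Hom X Y)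
    (hf : LocallyRingedSpace.IsOpenImmersion f.hom) (x : X.Point) :
    Function.Bijective (f.pull x) := by
  have : IsIso (f.hom.stalkMap x) := inferInstance
  exact (asIso (f.hom.stalkMap x)).commRingCatIsoToRingEquiv.bijective

/-- Over `S` the composite of σ with the open inclusion `j` is an open immersion. Its stalk map and
that of `j` are isomorphisms, hence so is that of σ. -/
theorem Hom.IsIsoOver.pull_bijective {S : Opens X₀.Point} (h : σ.IsIsoOver S) {y : X.Point}
    (hy : σ.pt y ∈ S) : Function.Bijective (σ.pull y) := by
  obtain ⟨e, he⟩ := h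
  let j := X.space.ofRestrict ((Opens.map σ.hom.base).obj S).isOpenEmbedding
  have h1 : LocallyRingedSpace.IsOpenImmersion (j ≫ σ.hom) := by
    rw [← he]
    infer_instance
  let y' : X.space.restrict ((Opens.map σ.hom.base).obj S).isOpenEmbedding :=
    (⟨y, hy⟩ : (Opens.map σ.hom.base).obj S)
  have h2 : IsIso ((j ≫ σ.hom).stalkMap y') := inferInstance
  rw [LocallyRingedSpace.stalkMap_comp] at h2
  have h3 : IsIso (j.stalkMap y') := inferInstance
  have h4 : IsIso (σ.hom.stalkMap (j.base y')) := 
    @IsIso.of_isIso_comp_right _ _ _ _ _ (σ.hom.stalkMap (j.base y')) (j.stalkMap y') h3 h2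
  exact (@asIso _ _ _ _ _ h4).commRingCatIsoToRingEquiv.bijective

theorem Hom.IsIsoOver.pullForms_eq_top {S : Opens X₀.Point} (h : σ.IsIsoOver S) {y : X.Point}
    (hy : σ.pt y ∈ S) : σ.pullForms y = ⊤ := by
  rw [← span_range_d X y]
  unfold Hom.pullForms
  congr 1
  ext w
  constructor
  · rintro ⟨f, rfl⟩
    exact ⟨_, rfl⟩
  · rintro ⟨f, rfl⟩
    obtain ⟨g, rfl⟩ := (h.pull_bijective hy).2 f
    exact ⟨g, rfl⟩

/-- The pull-backs of the differentials of the functions `h i` generate the pulled-back forms. -/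
def Hom.IsGenerating (σ : Hom X X₀) {J : Type*} (h : J → X₀.GermField) (y : X.Point) : Prop :=
  σ.pullForms y ≤
    Submodule.span (X.Stalk y) (Set.range fun i => X.d y (σ.pullField (h i) y))

theorem Hom.IsGenerating.span_eq {J : Type*} {h : J → X₀.GermField} {y : X.Point}
    (H : σ.IsGenerating h y) :
    Submodule.span (X.Stalk y) (Set.range fun i => X.d y (σ.pullField (h i) y)) =
      σ.pullForms y := by
  refine le_antisymm (Submodule.span_le.mpr ?_) H
  rintro _ ⟨i, rfl⟩
  exact σ.d_pullField_mem _ _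

/-- Chain rule: dg is a combination of the dz_m on the ambient space, and this relation pulls back
to X. -/
theorem LocalEmbedding.isGenerating {M : KSpace.{u} k} {i : LocalEmbedding X₀ M} {N : ℕ}
    {z : Fin N → M.GermField} {y : X.Point} (hy : σ.pt y ∈ i.V)
    (hz : IsCoordinatesAt z (i.pt (σ.pt y) hy)) :
    σ.IsGenerating (fun m => i.pullField (z m)) y := by
  obtain ⟨b, hb⟩ := hz
  unfold Hom.IsGenerating
  rw [i.pullForms_eq hy]
  refine Submodule.span_le.mpr ?_
  rintro _ ⟨g, rfl⟩
  have h := (b.sum_repr (M.d _ g)).symm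
  simp only [hb] at h
  simp only [LocalEmbedding.d_comap_eq hy h, LocalEmbedding.pullField_comap _ hy]
  exact sum_mem fun m _ => Submodule.smul_mem _ _ (Submodule.subset_span ⟨m, rfl⟩)

variable {S : Opens X₀.Point} {ι : Type w} {E : ι → Set X.Point} {n : ℕ}

theorem Hom.ResolvesWith.notMem_iff (hσ : σ.ResolvesWith S E n) {y : X.Point} :
    (¬ ∃ j, y ∈ E j) ↔ σ.pt y ∈ S := by
  rw [hσ.support, not_not]

/-- If `n` differentials generate the pulled-back forms near `a`, their determinant is not a zero
divisor. -/
theorem Hom.ResolvesWith.det_mem (hσ : σ.ResolvesWith S E n) {a : X.Point}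
    (hX : X.IsRegularPoint a) {h : Fin n → X₀.GermField}
    (hreg : ∀ i, h i ∈ X₀.regularAt (σ.pt a)) (H : ∀ᶠ y in 𝓝 a, σ.IsGenerating h y)
    (c : X.AdaptedCoordinates E n a) :
    (c.basis.det fun i => X.d a (σ.pullField (h i) a)) ∈ nonZeroDivisors (X.Stalk a) := by
  obtain ⟨T, hT⟩ := c.exists_field
  obtain ⟨h1, h2⟩ := hX.frame_of_basis hT.mem hT.isCoordinatesAt
  choose g hg hgd using fun i => h2 _ (σ.pullField_mem (hreg i))
  have hgd' := eventually_all.mpr hgd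
  have hdet : ∀ (y : X.Point) (b : Module.Basis (Fin n) (X.Stalk y) (X.Cotangent y)),
      (∀ i, b i = X.d y (T i y)) →
      (∀ i, X.d y (σ.pullField (h i) y) = ∑ j, g i j y • X.d y (T j y)) →
      (b.det fun i => X.d y (σ.pullField (h i) y)) = Matrix.det (Matrix.of fun i j => g i j y) := by
    intro y b hb hgy
    refine basis_det_eq b _ (fun i j => g i j y) fun i => ?_
    simp only [hb]
    exact hgy i
  rw [hdet a c.basis (fun i => by rw [c.basis_eq, hT.eq]) hgd'.self_of_nhds]
  refine hσ.isSNC.mem_nonZeroDivisors_of_eventually hX (det_mem_regularAt g hg) ?_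
  filter_upwards [h1, hgd', H] with y ⟨b, hb⟩ hgy hy hyE
  rw [← hdet y b hb hgy]
  -- Off the divisor the pulled-back forms are all of the cotangent module. The coordinate basis is
  -- thus a combination of the n generators, and their determinant divides det b = 1.
  have h3 := basis_det_dvd b (fun i => X.d y (σ.pullField (h i) y)) b fun i => by
    rw [hy.span_eq, hσ.isIsoOver.pullForms_eq_top (hσ.notMem_iff.mp hyE)]
    trivial
  rw [b.det_self] at h3
  exact isUnit_of_dvd_one h3

theorem Hom.ResolvesWith.linearIndependent (hσ : σ.ResolvesWith S E n) {a : X.Point}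
    (hX : X.IsRegularPoint a) {h : Fin n → X₀.GermField}
    (hreg : ∀ i, h i ∈ X₀.regularAt (σ.pt a)) (H : ∀ᶠ y in 𝓝 a, σ.IsGenerating h y) :
    LinearIndependent (X.Stalk a) fun i => X.d a (σ.pullField (h i) a) := by
  obtain ⟨c⟩ := hσ.isSNC.adapted a
  exact linearIndependent_of_det c.basis _ (hσ.det_mem hX hreg H c)

end Generators

end KSpace

end GaussMap

end

/-! ### Choosing n generators and spreading them out. -/

noncomputable section

namespace GaussMap

/-- Over a local ring, `n` of the given generators of a free module of rank `n` generate it. -/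
theorem exists_finset_span_eq {R M : Type u} [CommRing R] [IsLocalRing R] [AddCommGroup M]
    [Module R M] {n N : ℕ} {ω : Fin n → M} (hω : LinearIndependent R ω) {v : Fin N → M}
    (h : Submodule.span R (Set.range ω) = Submodule.span R (Set.range v)) :
    ∃ I : Finset (Fin N), I.card = n ∧ ∀ l, ∃ c : Fin N → R, v l = ∑ m ∈ I, c m • v m := by
  classical
  let P := Submodule.span R (Set.range v)
  let bω : Module.Basis (Fin n) R P := (Module.Basis.span hω).map (LinearEquiv.ofEq _ _ h)
  let v' : ULift.{u} (Fin N) → P := fun m => ⟨v m.down, Submodule.subset_span ⟨m.down, rfl⟩⟩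
  have hv' : Submodule.span R (Set.range v') = ⊤ := by
    rw [eq_top_iff]
    rintro ⟨w, hw⟩ -
    obtain ⟨c, rfl⟩ := (Submodule.mem_span_range_iff_exists_fun R).mp hw
    rw [Submodule.mem_span_range_iff_exists_fun]
    refine ⟨fun m => c m.down, Subtype.ext ?_⟩
    rw [Submodule.coe_sum]
    exact Fintype.sum_equiv Equiv.ulift _ _ fun m => rfl
  have : Module.Free R P := Module.Free.of_basis bω
  have : Module.Finite R P := Module.Finite.of_basis bω
  have : Module.FinitePresentation R P := Module.finitePresentation_of_projective R P
  -- Nakayama: over a local ring, a generating family of a finitely presented flat module contains a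
  -- basis. Its size is n, as compared with `bω`.
  obtain ⟨κ, α, b, hb⟩ := Module.exists_basis_of_span_of_flat v' hv'
  have hα : Function.Injective α := fun i j e => b.injective (by rw [hb, hb, e])
  let e : Fin n ≃ κ := bω.indexEquiv b
  let β : Fin n ↪ Fin N := ⟨fun i => (α (e i)).down, fun i j h => e.injective (hα (ULift.ext _ _ h))⟩
  refine ⟨Finset.univ.map β, by simp, fun l => ?_⟩
  let b' := b.reindex e.symm
  have hb' : ∀ i, (b' i : M) = v (β i) := by
    intro i
    simp only [b', Module.Basis.reindex_apply, Equiv.symm_symm, hb]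
    rfl
  have h1 := congrArg Subtype.val (b'.sum_repr (v' ⟨l⟩))
  rw [Submodule.coe_sum] at h1
  simp only [Submodule.coe_smul, hb'] at h1
  -- The default value 0 outside the chosen indices is never seen, as the sum runs over them only.
  refine ⟨Function.extend β (fun i => b'.repr (v' ⟨l⟩) i) 0, ?_⟩
  rw [Finset.sum_map]
  simp only [β.injective.extend_apply]
  exact h1.symm

namespace KSpace

open Filter

variable {k : Type v} [Field k] {X X₀ : KSpace.{u} k} {σ : Hom X X₀} {S : Opens X₀.Point}
  {ι : Type w} {E : ι → Set X.Point} {n : ℕ}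

/-- Near `a`, the pulled-back forms are generated by the pull-backs of `n` exact differentials. -/
def Hom.HasFrameAt (σ : Hom X X₀) (n : ℕ) (a : X.Point) : Prop :=
  ∃ h : Fin n → X₀.GermField, (∀ i, h i ∈ X₀.regularAt (σ.pt a)) ∧
    ∀ᶠ y in 𝓝 a, σ.IsGenerating h y

/-- Among the pull-backs of the coordinate differentials `dz l`, those with index in `I`
generate. -/
def LocalEmbedding.IsReduction {M : KSpace.{u} k} (i : LocalEmbedding X₀ M) (σ : Hom X X₀) {N : ℕ}
    (z : Fin N → M.GermField) (I : Finset (Fin N)) (A : Fin N → Fin N → X.GermField)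
    (y : X.Point) : Prop :=
  ∀ l, X.d y (σ.pullField (i.pullField (z l)) y) =
    ∑ m ∈ I, A l m y • X.d y (σ.pullField (i.pullField (z m)) y)

theorem IsRegularPoint.eventually_isReduction {M : KSpace.{u} k} {i : LocalEmbedding X₀ M} {N : ℕ}
    {z : Fin N → M.GermField} {I : Finset (Fin N)} {A : Fin N → Fin N → X.GermField}
    {a : X.Point} (hX : X.IsRegularPoint a) (ha : σ.pt a ∈ i.V)
    (hz : ∀ l, z l ∈ M.regularAt (i.pt (σ.pt a) ha)) (hA : ∀ l m, A l m ∈ X.regularAt a)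
    (h : i.IsReduction σ z I A a) : ∀ᶠ y in 𝓝 a, i.IsReduction σ z I A y := by
  have hreg := fun l => σ.pullField_mem (i.pullField_mem ha (hz l))
  refine eventually_all.mpr fun l => ?_
  have := hX.eventually_d_eq (ι := I) (hreg l) (G := fun m => A l m)
    (T := fun m => σ.pullField (i.pullField (z m))) (fun m => hA l m) (fun m => hreg m)
    ((h l).trans (Finset.sum_coe_sort I fun m =>
      A l m a • X.d a (σ.pullField (i.pullField (z m)) a)).symm)
  filter_upwards [this] with y hy
  rw [hy]
  exact Finset.sum_coe_sort I fun m => A l m y • X.d y (σ.pullField (i.pullField (z m)) y)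

/-- All dz_l generate by the chain rule and those with index in `I` generate all dz_l, so the n
ambient coordinates indexed by `I` restrict to a frame. -/
theorem LocalEmbedding.hasFrameAt {M : KSpace.{u} k} {i : LocalEmbedding X₀ M} {N : ℕ}
    {z : Fin N → M.GermField} {I : Finset (Fin N)} {A : Fin N → Fin N → X.GermField}
    {a : X.Point} (ha : σ.pt a ∈ i.V) (hI : I.card = n)
    (hz : ∀ l, z l ∈ M.regularAt (i.pt (σ.pt a) ha))
    (hz' : ∀ᶠ m in 𝓝 (i.pt (σ.pt a) ha), IsCoordinatesAt z m)
    (h : ∀ᶠ y in 𝓝 a, i.IsReduction σ z I A y) : σ.HasFrameAt n a := by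
  subst hI
  refine ⟨fun q => i.pullField (z (I.equivFin.symm q)), fun q => i.pullField_mem ha (hz _), ?_⟩
  filter_upwards [h, σ.eventually (i.eventually ha hz')] with y h1 ⟨hy, h2⟩
  refine (i.isGenerating hy h2).trans (Submodule.span_le.mpr ?_)
  rintro _ ⟨l, rfl⟩
  simp only [h1 l]
  refine sum_mem fun m hm => Submodule.smul_mem _ _ (Submodule.subset_span ?_)
  exact ⟨I.equivFin ⟨m, hm⟩, by simp only [Equiv.symm_apply_apply]⟩

/-! ### Frames and local freeness -/

theorem Hom.ResolvesWith.pullFormsLocallyFree (hσ : σ.ResolvesWith S E n)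
    (hX : ∀ a, X.IsRegularPoint a) (H : ∀ a, σ.HasFrameAt n a) : σ.PullFormsLocallyFree n := by
  intro a
  obtain ⟨h, hreg, hgen⟩ := H a
  -- Being a frame is an open condition, so the same functions are a frame at every nearby x and
  -- independence can be applied at x itself.
  have h1 : ∀ᶠ x in 𝓝 a, (∀ i, h i ∈ X₀.regularAt (σ.pt x)) ∧ ∀ᶠ y in 𝓝 x, σ.IsGenerating h y :=
    (eventually_all.mpr fun i => σ.eventually (eventually_regularAt (hreg i))).and
      (eventually_eventually_nhds.mpr hgen)
  obtain ⟨U, hU, hUo, haU⟩ := eventually_nhds_iff.mp h1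
  refine ⟨⟨U, hUo⟩, fun i x => X.d x (σ.pullField (h i) x), haU, fun i x hx => ?_, fun x hx => ?_⟩
  · obtain ⟨W₀, s, hW₀, hs⟩ := (hU x hx).1 i
    refine ⟨(Opens.map σ.hom.base).obj W₀, W₀, 1, fun _ => 1, fun _ => s, hW₀, fun y hy =>
      ⟨hy, ?_⟩⟩
    rw [Fin.sum_univ_one, map_one, one_smul]
    exact congrArg (fun q => X.d y (σ.pull y q)) (hs (σ.pt y) hy)
  · exact ⟨hσ.linearIndependent (hX x) (hU x hx).1 (hU x hx).2,
      (hU x hx).2.self_of_nhds.span_eq⟩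

/-- Only freeness of the stalk at `a` is used: n of the dz_l form a basis there, and the resulting
finitely many relations spread out. -/
theorem Hom.PullFormsLocallyFree.exists_isReduction (h : σ.PullFormsLocallyFree n)
    {M : KSpace.{u} k} {i : LocalEmbedding X₀ M} {N : ℕ} {z : Fin N → M.GermField}
    {a : X.Point} (hX : X.IsRegularPoint a) (ha : σ.pt a ∈ i.V)
    (hz : ∀ l, z l ∈ M.regularAt (i.pt (σ.pt a) ha))
    (hz' : IsCoordinatesAt z (i.pt (σ.pt a) ha)) :
    ∃ (I : Finset (Fin N)) (A : Fin N → Fin N → X.GermField), I.card = n ∧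
      (∀ l m, A l m ∈ X.regularAt a) ∧ ∀ᶠ y in 𝓝 a, i.IsReduction σ z I A y := by
  obtain ⟨U, ω, haU, -, hω⟩ := h a
  obtain ⟨hli, hsp⟩ := hω a haU
  obtain ⟨I, hI, hc⟩ := exists_finset_span_eq hli
    (v := fun l => X.d a (σ.pullField (i.pullField (z l)) a))
    (hsp.trans (i.isGenerating ha hz').span_eq.symm)
  choose c hc using hc
  choose A hA hAa using fun l m => exists_regularAt (c l m)
  refine ⟨I, A, hI, hA, hX.eventually_isReduction ha hz hA fun l => ?_⟩
  rw [hc l]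
  simp only [hAa]

/-! ### Frames and the logarithmic Fitting ideal -/

/-- Off the divisor there are no logarithmic factors, and the coordinates themselves are pulled back
from X₀; their minor is 1. -/
theorem Hom.ResolvesWith.logFitting_eq_top (hσ : σ.ResolvesWith S E n) {y : X.Point}
    (hy : σ.pt y ∈ S) : σ.logFitting E n 0 y = ⊤ := by
  classical
  obtain ⟨c⟩ := hσ.isSNC.adapted y
  choose f hf using fun i => (hσ.isIsoOver.pull_bijective hy).2 (c.t i)
  rw [Hom.logFitting_eq, Ideal.eq_top_iff_one]
  refine Ideal.subset_span ⟨c, f, ?_⟩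
  have h1 : c.equationProd = 1 := by
    refine Finset.prod_eq_one fun i _ => if_neg ?_
    rintro ⟨j, -⟩
    exact hσ.notMem_iff.mpr hy ⟨j.1, j.2⟩
  simp only [hf, ← c.basis_eq]
  rw [h1, c.basis.det_self, mul_one]

/-- If every element of `s` were u g with u in 𝔪, then g itself would lie in 𝔪 g. Thus (1 - u) g = 0
for some u in 𝔪, and cancelling g would put 1 in 𝔪. -/
theorem exists_generator {R : Type*} [CommRing R] [IsLocalRing R] {s : Set R} {g : R}
    (h : Ideal.span s = Ideal.span {g}) (hg : g ∈ nonZeroDivisors R) :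
    ∃ δ ∈ s, Ideal.span s = Ideal.span {δ} := by
  by_contra! hne
  have hs : ∀ δ ∈ s, ∃ u ∈ IsLocalRing.maximalIdeal R, δ = u * g := by
    intro δ hδ
    have h1 : δ ∈ Ideal.span {g} := h ▸ Ideal.subset_span hδ
    obtain ⟨u, rfl⟩ := Ideal.mem_span_singleton'.mp h1
    refine ⟨u, ?_, rfl⟩
    by_contra hu
    rw [IsLocalRing.mem_maximalIdeal, mem_nonunits_iff, not_not] at hu
    refine hne _ hδ (h.trans ?_)
    exact (Ideal.span_singleton_mul_left_unit hu g).symm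
  have h2 : Ideal.span s ≤ IsLocalRing.maximalIdeal R * Ideal.span {g} := by
    refine Ideal.span_le.mpr fun δ hδ => ?_
    obtain ⟨u, hu, rfl⟩ := hs δ hδ
    exact Ideal.mul_mem_mul hu (Ideal.mem_span_singleton_self g)
  have h3 : g ∈ IsLocalRing.maximalIdeal R * Ideal.span {g} :=
    h2 (h ▸ Ideal.mem_span_singleton_self g)
  obtain ⟨u, hu, hug⟩ := Ideal.mem_mul_span_singleton.mp h3
  have h4 : (1 - u) * g = 0 := by rw [sub_mul, one_mul, hug, sub_self]
  have h5 : 1 - u = 0 := (mem_nonZeroDivisors_iff_right.mp hg) _ h4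
  rw [sub_eq_zero] at h5
  exact (Ideal.ne_top_iff_one _).mp (IsLocalRing.maximalIdeal.isMaximal R).ne_top (h5 ▸ hu)

/-- A single minor δ generates the ideal at `a`. Replacing one of its functions by an arbitrary q
gives another minor, hence a multiple of δ; by Cramer's rule dq is then a combination of the
differentials occurring in δ. -/
theorem Hom.ResolvesWith.hasFrameAt_of_isPrincipalIdeal (hσ : σ.ResolvesWith S E n)
    {M : KSpace.{u} k} {i : LocalEmbedding X₀ M} {a : X.Point} (hX : X.IsRegularPoint a)
    (ha : σ.pt a ∈ i.V) (hM : M.IsRegularPoint (i.pt (σ.pt a) ha))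
    (h : X.IsPrincipalIdeal (σ.logFitting E n 0)) : σ.HasFrameAt n a := by
  classical
  obtain ⟨U, g, haU, hg⟩ := h a
  -- The ideal is trivial off the divisor, so its generator is invertible there.
  have hga : extend g a ∈ nonZeroDivisors (X.Stalk a) := by
    refine hσ.isSNC.mem_nonZeroDivisors_of_eventually hX (extend_mem g haU) ?_
    filter_upwards [U.isOpen.mem_nhds haU] with y hy hyE
    have h1 := hg y hy
    rw [hσ.logFitting_eq_top (hσ.notMem_iff.mp hyE), eq_comm,
      Ideal.span_singleton_eq_top] at h1
    rwa [extend_apply g hy]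
  have h1 := hg a haU
  rw [← extend_apply g haU, Hom.logFitting_eq] at h1
  obtain ⟨_, ⟨c, f, rfl⟩, h2⟩ := exists_generator h1 hga
  have hδ : c.equationProd * (c.basis.det fun i => X.d a (σ.pull a (f i))) ∈
      nonZeroDivisors (X.Stalk a) := by
    have : extend g a ∈ Ideal.span
        {c.equationProd * (c.basis.det fun i => X.d a (σ.pull a (f i)))} := by
      rw [← h2, h1]
      exact Ideal.mem_span_singleton_self _
    obtain ⟨q, hq⟩ := Ideal.mem_span_singleton'.mp this
    rw [← hq] at hga
    exact (mul_mem_nonZeroDivisors.mp hga).2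
  obtain ⟨hP, hD⟩ := mul_mem_nonZeroDivisors.mp hδ
  have hgen : ∀ q : X₀.Stalk (σ.pt a), X.d a (σ.pull a q) ∈
      Submodule.span (X.Stalk a) (Set.range fun i => X.d a (σ.pull a (f i))) := by
    intro q
    -- The modified minor uses the same coordinates `c`, so the equation of the divisor occurs on
    -- both sides and can be cancelled.
    have hb : ∀ i, ∃ b, c.basis.det (Function.update (fun i => X.d a (σ.pull a (f i))) i
        (X.d a (σ.pull a q))) = b * c.basis.det fun i => X.d a (σ.pull a (f i)) := by
      intro i
      have : c.equationProd * c.basis.det (Function.update (fun i => X.d a (σ.pull a (f i))) i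
        (X.d a (σ.pull a q))) ∈ Ideal.span
          {c.equationProd * (c.basis.det fun i => X.d a (σ.pull a (f i)))} := by
        rw [← h2]
        refine Ideal.subset_span ⟨c, Function.update f i q, ?_⟩
        congr 2
        ext m
        by_cases hm : m = i
        · subst hm
          simp
        · simp [hm]
      obtain ⟨b, hb⟩ := Ideal.mem_span_singleton'.mp this
      refine ⟨b, ?_⟩
      have h3 : c.equationProd * (c.basis.det (Function.update
          (fun i => X.d a (σ.pull a (f i))) i (X.d a (σ.pull a q))) -
          b * c.basis.det fun i => X.d a (σ.pull a (f i))) = 0 := by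
        rw [mul_sub, ← hb]
        ring
      exact sub_eq_zero.mp ((mem_nonZeroDivisors_iff_left.mp hP) _ h3)
    choose b hb using hb
    have h3 := basis_det_smul c.basis (fun i => X.d a (σ.pull a (f i))) (X.d a (σ.pull a q))
    have h4 : X.d a (σ.pull a q) = ∑ i, b i • X.d a (σ.pull a (f i)) := by
      apply c.basis.repr.injective
      ext m
      have h5 := congrArg (fun w => c.basis.repr w m) h3
      simp only [hb, mul_comm (b _), mul_smul, ← Finset.smul_sum, map_smul, Finsupp.smul_apply,
        smul_eq_mul] at h5
      refine sub_eq_zero.mp ((mem_nonZeroDivisors_iff_left.mp hD) _ ?_)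
      rw [mul_sub, h5, sub_self]
    rw [h4]
    exact sum_mem fun i _ => Submodule.smul_mem _ _ (Submodule.subset_span ⟨i, rfl⟩)
  choose F hF hFa using fun i => exists_regularAt (f i)
  have hFa' : ∀ i, σ.pullField (F i) a = σ.pull a (f i) := by
    intro i
    rw [← hFa]
    rfl
  refine ⟨F, hF, ?_⟩
  obtain ⟨N, z, hz, hz', -⟩ := hM.frame
  -- The relations in `hgen` concern all germs q and cannot be spread together. The finitely many
  -- ambient coordinates suffice, since their differentials generate at every nearby point.
  have hspread : ∀ᶠ y in 𝓝 a, ∀ l, X.d y (σ.pullField (i.pullField (z l)) y) ∈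
      Submodule.span (X.Stalk y) (Set.range fun i => X.d y (σ.pullField (F i) y)) := by
    refine eventually_all.mpr fun l => ?_
    obtain ⟨b, hb⟩ := (Submodule.mem_span_range_iff_exists_fun _).mp
      (hgen (i.pullField (z l) (σ.pt a)))
    choose B hB hBa using fun i => exists_regularAt (b i)
    have := hX.eventually_d_eq (σ.pullField_mem (i.pullField_mem ha (hz l))) hB
      (fun i => σ.pullField_mem (hF i)) (by
        simp only [hBa, hFa']
        exact hb.symm)
    filter_upwards [this] with y hy
    rw [hy]
    exact sum_mem fun i _ => Submodule.smul_mem _ _ (Submodule.subset_span ⟨i, rfl⟩)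
  filter_upwards [hspread, σ.eventually (i.eventually ha hz')] with y h1 ⟨hy, h2⟩
  refine (i.isGenerating hy h2).trans (Submodule.span_le.mpr ?_)
  rintro _ ⟨l, rfl⟩
  exact h1 l

/-- The local generator is the equation of the divisor times the Jacobian determinant of the frame;
both are regular near `a`. -/
theorem Hom.ResolvesWith.isPrincipalIdeal (hσ : σ.ResolvesWith S E n)
    (hX : ∀ a, X.IsRegularPoint a) (H : ∀ a, σ.HasFrameAt n a) :
    X.IsPrincipalIdeal (σ.logFitting E n 0) := by
  intro a
  obtain ⟨h, hreg, hgen⟩ := H a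
  obtain ⟨c⟩ := hσ.isSNC.adapted a
  obtain ⟨T, hT⟩ := c.exists_field
  obtain ⟨-, h2⟩ := (hX a).frame_of_basis hT.mem hT.isCoordinatesAt
  choose g hg hgd using fun i => h2 _ (σ.pullField_mem (hreg i))
  obtain ⟨U, s, haU, hs⟩ := mul_mem hT.equationProd_mem (det_mem_regularAt g hg)
  obtain ⟨V, hV, hVo, haV⟩ := eventually_nhds_iff.mp
    ((hT.eventually_adapted (hX a) hσ.isSNC).and ((eventually_all.mpr hgd).and hgen))
  refine ⟨U ⊓ ⟨V, hVo⟩, X.res inf_le_left s, ⟨haU, haV⟩, fun y hy => ?_⟩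
  have hyV : y ∈ V := hy.2
  refine Eq.trans ?_ (congrArg (fun q => Ideal.span {q}) ((hs y hy.1).trans
    (X.germ_res inf_le_left y hy s).symm))
  obtain ⟨⟨c', hc', hass⟩, hgy, hy'⟩ := hV y hyV
  have hdet : (c'.basis.det fun i => X.d y (σ.pullField (h i) y)) =
      Matrix.det (Matrix.of fun i j => g i j y) := by
    refine basis_det_eq c'.basis _ (fun i j => g i j y) fun i => ?_
    simp only [c'.basis_eq, hc']
    exact hgy i
  rw [Pi.mul_apply, ← hdet, Hom.logFitting_eq]
  apply le_antisymm
  · refine Ideal.span_le.mpr ?_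
    rintro _ ⟨c'', f, rfl⟩
    refine Ideal.mem_span_singleton.mpr (mul_dvd_mul ?_ ?_)
    · exact hass.symm.dvd.trans (AdaptedCoordinates.equationProd_dvd (hX y) c' c'')
    -- Changing coordinates multiplies the determinant by a factor, and in the fixed coordinates the
    -- rows are combinations of the frame.
    · have h3 := congrArg (fun q => q fun i => X.d y (σ.pull y (f i)))
        (c''.basis.det.eq_smul_basis_det c'.basis)
      simp only [AlternatingMap.smul_apply, smul_eq_mul] at h3
      rw [h3]
      refine Dvd.dvd.mul_left (basis_det_dvd c'.basis _ _ fun i => ?_) _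
      rw [hy'.span_eq]
      exact Submodule.subset_span ⟨f i, rfl⟩
  · refine (Ideal.span_singleton_le_iff_mem _).mpr ?_
    -- The generator contains the equations of all components through `a`, while a minor at `y` uses
    -- only those through `y`; they differ by a unit.
    refine (Ideal.mem_iff_of_associated (hass.mul_right _)).mp ?_
    exact Ideal.subset_span ⟨c', fun i => h i (σ.pt y), rfl⟩

end KSpace

end GaussMap

end

/-! ### From an extended Gauss mapping to frames. -/

noncomputable section

namespace GaussMap

namespace KSpace

open Filter

variable {k : Type v} [Field k] {X X₀ M : KSpace.{u} k} {σ : Hom X X₀} {S : Opens X₀.Point}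
  {ι : Type w} {E : ι → Set X.Point} {n : ℕ} {i : LocalEmbedding X₀ M}

/-- Finitely many regular germ fields are given by functions on a common neighbourhood. -/
theorem exists_sections {J : Type*} [Finite J] {a : X.Point} {F : J → X.GermField}
    (hF : ∀ j, F j ∈ X.regularAt a) {p : X.Point → Prop} (hp : ∀ᶠ y in 𝓝 a, p y) :
    ∃ (U : Opens X.Point) (s : J → X.Sections U), a ∈ U ∧
      ∀ (y : X.Point) (hy : y ∈ U), p y ∧ ∀ j, F j y = X.germ U y hy (s j) := by
  choose U s haU hs using hF
  have h1 : ∀ᶠ y in 𝓝 a, p y ∧ ∀ j, y ∈ U j :=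
    hp.and (eventually_all.mpr fun j => (U j).isOpen.mem_nhds (haU j))
  obtain ⟨V, hV, hVo, haV⟩ := eventually_nhds_iff.mp h1
  have hle : ∀ j, (⟨V, hVo⟩ : Opens X.Point) ≤ U j := fun j y hy => (hV y hy).2 j
  refine ⟨⟨V, hVo⟩, fun j => X.res (hle j) (s j), haV, fun y hy => ⟨(hV y hy).1, fun j => ?_⟩⟩
  exact (hs j y (hle j hy)).trans (X.germ_res (hle j) y hy (s j)).symm

theorem IsCoordinateSystem.isCoordinatesAt {W : Opens M.Point} {N : ℕ}
    {z : Fin N → M.Sections W} (h : M.IsCoordinateSystem W z) {y : M.Point} (hy : y ∈ W) :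
    IsCoordinatesAt (fun l => extend (z l)) y := by
  obtain ⟨h1, h2⟩ := h y hy
  refine ⟨Module.Basis.mk h1 h2.ge, fun l => ?_⟩
  rw [Module.Basis.mk_apply]
  exact congrArg (M.d y) (extend_apply (z l) hy).symm

theorem tangentSpace_comp {A B L : Type u} [CommRing A] [Algebra k A] [CommRing B] [Algebra k B]
    [Field L] {ev : B →+* L} {D : B → L} (hD : D ∈ tangentSpace k ev) (φ : A →+* B)
    (hφ : ∀ c : k, φ (algebraMap k _ c) = algebraMap k _ c) :
    (fun f => D (φ f)) ∈ tangentSpace k (ev.comp φ) := by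
  obtain ⟨h1, h2, h3⟩ := hD
  refine ⟨fun f g => ?_, fun c => ?_, fun f g => ?_⟩
  · simp only [map_add, h1]
  · simp only [hφ, h2]
  · simp only [map_mul, h3, RingHom.comp_apply]

/-- The linear form on the fibre of the cotangent sheaf at `y` given by a linear form on the
stalk. -/
def evalForm {y : X.Point} (φ : X.Cotangent y →ₗ[X.Stalk y] X.Stalk y) :
    X.Cotangent y →ₛₗ[X.eval y] X.Residue y where
  toFun w := X.eval y (φ w)
  map_add' _ _ := by rw [map_add, map_add]
  map_smul' _ _ := by rw [map_smul, smul_eq_mul, map_mul, smul_eq_mul]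

/-- The chart equations of the extended planes are turned into relations between the dz_l: they hold
on tangent vectors off the divisor, and extend across it coefficient by coefficient. -/
theorem LocalEmbedding.GaussExtends.hasFrameAt (h : i.GaussExtends σ S n)
    (hσ : σ.ResolvesWith S E n) {a : X.Point} (hX : X.IsRegularPoint a) (ha : σ.pt a ∈ i.V) :
    σ.HasFrameAt n a := by
  classical
  obtain ⟨Λ, hreg, hext⟩ := h
  obtain ⟨N, W, z, I, U, A, hz, hI, haU, hΛ⟩ := hreg a ha
  obtain ⟨_, haW, _⟩ := hΛ a haU
  have hZ : ∀ l, extend (z l) ∈ M.regularAt (i.pt (σ.pt a) ha) := fun l => extend_mem (z l) haW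
  have hF := fun l => σ.pullField_mem (i.pullField_mem ha (hZ l))
  have hA : ∀ l m, extend (A l m) ∈ X.regularAt a := fun l m => extend_mem _ haU
  obtain ⟨c⟩ := hσ.isSNC.adapted a
  obtain ⟨T, hT⟩ := c.exists_field
  obtain ⟨h1, h2⟩ := hX.frame_of_basis hT.mem hT.isCoordinatesAt
  choose p hp hpd using fun l => h2 _ (hF l)
  have hpd' := eventually_all.mpr hpd
  -- Here `p l j` is the j-th partial derivative of z_l∘σ. The difference of the two sides is
  -- regular, so it suffices that its values vanish off the divisor.
  have hq : ∀ l ∉ I, ∀ j, p l j a = ∑ m ∈ I, extend (A l m) a * p m j a := by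
    intro l hl j
    refine sub_eq_zero.mp (hσ.isSNC.eq_zero_of_eventually hX
      (F := fun y => p l j y - ∑ m ∈ I, extend (A l m) y * p m j y)
      (sub_mem (hp l j) (sum_mem_regularAt I (fun m => extend (A l m) * p m j)
        fun m _ => mul_mem (hA l m) (hp m j))) ?_)
    filter_upwards [h1, hpd', U.isOpen.mem_nhds haU] with y ⟨b, hb⟩ hpy hyU hyE
    obtain ⟨hV, hW, hch⟩ := hΛ y hyU
    have hyS := hσ.notMem_iff.mp hyE
    -- The j-th coordinate tangent vector of X at y. Over `S` its image under dσ lies in the Gauss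
    -- plane, so the chart equations apply to it.
    let φ := evalForm (b.coord j)
    have hco : ∀ l, φ (X.d y (i.comap σ y hV (M.germ W _ hW (z l)))) = X.eval y (p l j y) := by
      intro l
      have h3 := hpy l
      rw [i.pullField_comap _ hV, extend_apply _ hW] at h3
      rw [h3]
      refine congrArg (X.eval y) ?_
      simp only [← hb, map_sum, map_smul, Module.Basis.coord_apply, Module.Basis.repr_self]
      simp [Finsupp.single_apply]
    have hD := tangentSpace_comp (mem_tangentSpace_of_lift (X.eval y) φ) (σ.pull y)
      (σ.pull_algebraMap y)
    have hD' : (fun g => φ (X.d y (i.comap σ y hV g))) ∈ Λ.plane y hV := by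
      rw [hext y hV hyS]
      exact Submodule.mem_map_of_mem hD
    have h4 := (hch _ (Λ.le y hV hD')).mp hD' l hl
    simp only [hco] at h4
    rw [map_sub, map_sum, h4, sub_eq_zero]
    refine Finset.sum_congr rfl fun m _ => ?_
    rw [map_mul, extend_apply _ hyU]
  -- The chart says nothing about the rows of `A` with index in `I`; they are replaced by rows of
  -- the identity matrix.
  let A' : Fin N → Fin N → X.GermField := fun l m =>
    if l ∈ I then (if l = m then 1 else 0) else extend (A l m)
  have hA' : ∀ l m, A' l m ∈ X.regularAt a := by
    intro l m
    simp only [A']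
    split_ifs
    exacts [one_mem _, zero_mem _, hA l m]
  refine i.hasFrameAt ha hI hZ ?_ (hX.eventually_isReduction (A := A') ha hZ hA' fun l => ?_)
  · filter_upwards [W.isOpen.mem_nhds haW] with m hm
    exact hz.isCoordinatesAt hm
  · by_cases hl : l ∈ I
    · rw [Finset.sum_eq_single l]
      · simp [A', hl]
      · intro m _ hm
        simp [A', hl, hm.symm]
      · exact fun h => absurd hl h
    · simp only [A', if_neg hl]
      rw [hpd'.self_of_nhds l]
      simp only [hpd'.self_of_nhds, hq l hl, Finset.sum_smul, Finset.smul_sum, mul_smul]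
      exact Finset.sum_comm

/-! ### The extended Gauss mapping -/

/-- The pull-back of the differential of a function on `X₀`. -/
def Hom.dPull (σ : Hom X X₀) (x : X.Point) (f : X₀.Stalk (σ.pt x)) : σ.pullForms x :=
  ⟨X.d x (σ.pull x f), Submodule.subset_span ⟨f, rfl⟩⟩

theorem Hom.dPull_add (x : X.Point) (f g : X₀.Stalk (σ.pt x)) :
    σ.dPull x (f + g) = σ.dPull x f + σ.dPull x g :=
  Subtype.ext ((congrArg (X.d x) (map_add _ f g)).trans (X.d_add x _ _))

theorem Hom.dPull_mul (x : X.Point) (f g : X₀.Stalk (σ.pt x)) :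
    σ.dPull x (f * g) = σ.pull x f • σ.dPull x g + σ.pull x g • σ.dPull x f :=
  Subtype.ext ((congrArg (X.d x) (map_mul _ f g)).trans (X.d_mul x _ _))

theorem Hom.dPull_algebraMap (x : X.Point) (c : k) :
    σ.dPull x (algebraMap k _ c) = 0 :=
  Subtype.ext ((congrArg (X.d x) (σ.pull_algebraMap x c)).trans (X.d_algebraMap x c))

theorem Hom.dPull_mem_tangentSpace {x : X.Point}
    (φ : σ.pullForms x →ₛₗ[X.eval x] X.Residue x) :
    (fun f => φ (σ.dPull x f)) ∈ tangentSpace k ((X.eval x).comp (σ.pull x)) := by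
  refine ⟨fun f g => ?_, fun c => ?_, fun f g => ?_⟩
  · simp only [Hom.dPull_add, map_add]
  · simp only [Hom.dPull_algebraMap, map_zero]
  · simp only [Hom.dPull_mul, map_add, LinearMap.map_smulₛₗ, RingHom.comp_apply, smul_eq_mul]

/-- The differential of a function on `M`, as a pulled-back form. -/
def LocalEmbedding.dPull (i : LocalEmbedding X₀ M) (σ : Hom X X₀) (x : X.Point)
    (hx : σ.pt x ∈ i.V) (g : M.Stalk (i.pt (σ.pt x) hx)) : σ.pullForms x :=
  σ.dPull x (i.pull _ hx g)

/-- The linear subspace of the tangent space of `M` dual to the fibre at `x` of `σ^*Ω¹`. -/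
def LocalEmbedding.dualPlane (i : LocalEmbedding X₀ M) (σ : Hom X X₀) (x : X.Point)
    (hx : σ.pt x ∈ i.V) :
    Submodule (X.Residue x) (M.Stalk (i.pt (σ.pt x) hx) → X.Residue x) where
  carrier := {D | ∃ φ : σ.pullForms x →ₛₗ[X.eval x] X.Residue x, ∀ g, D g = φ (i.dPull σ x hx g)}
  add_mem' := by
    rintro D D' ⟨φ, h⟩ ⟨φ', h'⟩
    exact ⟨φ + φ', fun g => by rw [Pi.add_apply, h, h']; rfl⟩
  zero_mem' := ⟨0, fun g => rfl⟩
  smul_mem' := by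
    rintro r D ⟨φ, h⟩
    exact ⟨r • φ, fun g => by rw [Pi.smul_apply, h]; rfl⟩

theorem LocalEmbedding.span_dPull {x : X.Point} (hx : σ.pt x ∈ i.V) :
    Submodule.span (X.Stalk x) (Set.range (i.dPull σ x hx)) = ⊤ := by
  rw [← top_le_iff]
  rintro ⟨w, hw⟩ -
  have hw' := hw
  rw [i.pullForms_eq hx] at hw'
  obtain ⟨c, hc⟩ := (Finsupp.mem_span_range_iff_exists_finsupp).mp hw'
  refine (Finsupp.mem_span_range_iff_exists_finsupp).mpr ⟨c, Subtype.ext (Eq.trans ?_ hc)⟩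
  rw [Finsupp.sum, Submodule.coe_sum]
  rfl

theorem LocalEmbedding.dualPlane_le {x : X.Point} (hx : σ.pt x ∈ i.V) :
    i.dualPlane σ x hx ≤ i.ambientTangent σ x hx := by
  rintro D ⟨φ, hφ⟩
  obtain rfl : D = _ := funext hφ
  exact tangentSpace_comp (σ.dPull_mem_tangentSpace φ) (i.pull _ hx) (i.pull_algebraMap _ hx)

/-- Over `S` a derivation of the stalk of X₀ can be transported to the stalk of X through the
isomorphism given by σ. There it is a linear form on the cotangent space, which restricts to the
pulled-back forms. -/
theorem LocalEmbedding.dualPlane_eq_gauss (hσ : σ.ResolvesWith S E n) {x : X.Point}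
    (hx : σ.pt x ∈ i.V) (hS : σ.pt x ∈ S) : i.dualPlane σ x hx = i.gauss σ x hx := by
  apply le_antisymm
  · rintro D ⟨φ, hφ⟩
    exact ⟨_, σ.dPull_mem_tangentSpace φ, (funext hφ).symm⟩
  · rintro _ ⟨D, hD, rfl⟩
    let e := RingEquiv.ofBijective _ (hσ.isIsoOver.pull_bijective hS)
    have he : ∀ f, e.symm (σ.pull x f) = f := e.symm_apply_apply
    have h1 : (fun g => D (e.symm g)) ∈ tangentSpace k (X.eval x) := by
      have h2 := tangentSpace_comp hD e.symm.toRingHom fun c => by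
        rw [← σ.pull_algebraMap x c]
        exact he _
      have h3 : ((X.eval x).comp (σ.pull x)).comp e.symm.toRingHom = X.eval x := by
        ext g
        exact congrArg (X.eval x) (e.apply_symm_apply g)
      rw [h3] at h2
      exact h2
    obtain ⟨T, hT⟩ := exists_lift_of_mem_tangentSpace (X.eval x)
      (fun f hf => eval_eq_zero_of_mem hf) h1
    refine ⟨T.comp (σ.pullForms x).subtype, fun g => ?_⟩
    refine Eq.trans ?_ (hT _).symm
    exact congrArg D (he _).symm

/-- Semilinear forms with prescribed values on a basis. -/
theorem exists_semilinear {A P L J : Type*} [CommRing A] [AddCommGroup P] [Module A P] [Field L]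
    [Fintype J] (ev : A →+* L) (b : Module.Basis J A P) (v : J → L) :
    ∃ φ : P →ₛₗ[ev] L, ∀ j, φ (b j) = v j := by
  classical
  refine ⟨{ toFun := fun w => ∑ j, ev (b.repr w j) * v j
            map_add' := fun w w' => ?_
            map_smul' := fun r w => ?_ }, fun j => ?_⟩
  · simp only [map_add, Finsupp.add_apply, add_mul, Finset.sum_add_distrib]
  · simp only [map_smul, Finsupp.smul_apply, smul_eq_mul, map_mul, Finset.mul_sum, mul_assoc]
  · simp [Finsupp.single_apply]

/-- A semilinear form is freely prescribed by its values on the basis `b`, and is recovered from its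
derivation because the differentials of ambient functions generate. The plane is thus a copy of
κ(x)^n. -/
theorem LocalEmbedding.finrank_dualPlane {x : X.Point} (hx : σ.pt x ∈ i.V)
    (b : Module.Basis (Fin n) (X.Stalk x) (σ.pullForms x)) :
    Module.finrank (X.Residue x) (i.dualPlane σ x hx) = n := by
  choose ψ hψ using fun v => exists_semilinear (X.eval x) b v
  let L : (Fin n → X.Residue x) →ₗ[X.Residue x] i.dualPlane σ x hx :=
    { toFun := fun v => ⟨fun g => ψ v (i.dPull σ x hx g), ψ v, fun g => rfl⟩
      map_add' := fun v w => by
        have : ψ (v + w) = ψ v + ψ w := LinearMap.ext_on b.span_eq (by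
          rintro _ ⟨j, rfl⟩
          rw [LinearMap.add_apply, hψ, hψ, hψ]
          rfl)
        ext g
        simp only [this]
        rfl
      map_smul' := fun r v => by
        have : ψ (r • v) = r • ψ v := LinearMap.ext_on b.span_eq (by
          rintro _ ⟨j, rfl⟩
          rw [LinearMap.smul_apply, hψ, hψ]
          rfl)
        ext g
        simp only [this]
        rfl }
  have hL : Function.Bijective L := by
    constructor
    · intro v w h
      have h1 : ψ v = ψ w := by
        refine LinearMap.ext_on (i.span_dPull hx) ?_
        rintro _ ⟨g, rfl⟩
        exact congrFun (congrArg Subtype.val h) g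
      funext j
      rw [← hψ v, ← hψ w, h1]
    · rintro ⟨D, φ, hφ⟩
      refine ⟨fun j => φ (b j), Subtype.ext (funext fun g => ?_)⟩
      have h1 : ψ (fun j => φ (b j)) = φ := LinearMap.ext_on b.span_eq (by
        rintro _ ⟨j, rfl⟩
        rw [hψ])
      change ψ (fun j => φ (b j)) _ = D g
      rw [h1, hφ]
  rw [← (LinearEquiv.ofBijective L hL).finrank_eq, Module.finrank_fin_fun]

/-- The n forms dz_m with m in `I` generate a free module of rank n, hence are a basis. A form φ
with the values D z_m on them exists, and the chart equations say exactly that φ also has the value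
D z_l on the remaining dz_l. -/
theorem LocalEmbedding.mem_dualPlane_iff {x : X.Point} (hx : σ.pt x ∈ i.V) {N : ℕ}
    {z : Fin N → M.GermField} {I : Finset (Fin N)} {A : Fin N → Fin N → X.GermField}
    (hI : I.card = n) (b : Module.Basis (Fin n) (X.Stalk x) (σ.pullForms x))
    (hz : IsCoordinatesAt z (i.pt (σ.pt x) hx)) (hA : i.IsReduction σ z I A x)
    {D : M.Stalk (i.pt (σ.pt x) hx) → X.Residue x} (hD : D ∈ i.ambientTangent σ x hx) :
    D ∈ i.dualPlane σ x hx ↔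
      ∀ l ∉ I, D (z l _) = ∑ m ∈ I, X.eval x (A l m x) * D (z m _) := by
  classical
  have hA' : ∀ l, i.dPull σ x hx (z l _) = ∑ m ∈ I, A l m x • i.dPull σ x hx (z m _) := by
    intro l
    have h1 := hA l
    simp only [i.pullField_comap _ hx] at h1
    refine Subtype.ext (h1.trans ?_)
    rw [Submodule.coe_sum]
    rfl
  constructor
  · rintro ⟨φ, hφ⟩ l -
    rw [hφ, hA' l, map_sum]
    refine Finset.sum_congr rfl fun m _ => ?_
    rw [LinearMap.map_smulₛₗ, hφ]
    rfl
  · intro h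
    obtain ⟨T, hT⟩ := exists_lift_of_mem_tangentSpace (i.evalAt σ x hx) (fun f hf => by
      refine eval_eq_zero_of_mem (f := i.comap σ x hx f) ?_
      exact fun hu => hf ((isUnit_map_iff (i.comap σ x hx) f).mp hu)) hD
    obtain ⟨bz, hbz⟩ := hz
    have hexp : ∀ g, i.dPull σ x hx g =
        ∑ l, i.comap σ x hx (bz.repr (M.d _ g) l) • i.dPull σ x hx (z l _) := by
      intro g
      have h1 := (bz.sum_repr (M.d _ g)).symm
      simp only [hbz] at h1
      refine Subtype.ext ((i.d_comap_eq hx h1).trans ?_)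
      rw [Submodule.coe_sum]
      rfl
    have hspan : ⊤ ≤ Submodule.span (X.Stalk x)
        (Set.range fun m : I => i.dPull σ x hx (z m _)) := by
      rw [← i.span_dPull hx]
      refine Submodule.span_le.mpr ?_
      rintro _ ⟨g, rfl⟩
      rw [hexp g]
      refine sum_mem fun l _ => Submodule.smul_mem _ _ ?_
      rw [hA' l]
      exact sum_mem fun m hm => Submodule.smul_mem _ _ (Submodule.subset_span ⟨⟨m, hm⟩, rfl⟩)
    have e : Fin n ≃ I := (I.equivFinOfCardEq hI).symm
    have hli : LinearIndependent (X.Stalk x) fun m : I => i.dPull σ x hx (z m _) := by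
      refine (linearIndependent_equiv e).mp (linearIndependent_of_det b _ ?_)
      -- Since the family generates, its determinant divides det b = 1.
      have h1 := basis_det_dvd b ((fun m : I => i.dPull σ x hx (z m _)) ∘ e) b fun j => by
        rw [e.surjective.range_comp]
        exact hspan trivial
      rw [b.det_self] at h1
      exact (isUnit_of_dvd_one h1).mem_nonZeroDivisors
    let β := Module.Basis.mk hli hspan
    obtain ⟨φ, hφ⟩ := exists_semilinear (X.eval x) β fun m => D (z m _)
    have hφ' : ∀ m ∈ I, φ (i.dPull σ x hx (z m _)) = D (z m _) := by
      intro m hm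
      have := hφ ⟨m, hm⟩
      rwa [Module.Basis.mk_apply] at this
    have hφl : ∀ l, φ (i.dPull σ x hx (z l _)) = D (z l _) := by
      intro l
      by_cases hl : l ∈ I
      · exact hφ' l hl
      · rw [hA' l, map_sum, h l hl]
        refine Finset.sum_congr rfl fun m hm => ?_
        rw [LinearMap.map_smulₛₗ, hφ' m hm]
        rfl
    refine ⟨φ, fun g => ?_⟩
    rw [hexp g, map_sum, ← hT, ← bz.sum_repr (M.d _ g), map_sum]
    refine Finset.sum_congr rfl fun l _ => ?_
    rw [LinearMap.map_smulₛₗ, LinearMap.map_smulₛₗ, hφl, hbz, hT, bz.sum_repr]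
    rfl

theorem Hom.PullFormsLocallyFree.exists_basis (h : σ.PullFormsLocallyFree n) (x : X.Point) :
    Nonempty (Module.Basis (Fin n) (X.Stalk x) (σ.pullForms x)) := by
  obtain ⟨U, ω, hx, -, hω⟩ := h x
  obtain ⟨h1, h2⟩ := hω x hx
  exact ⟨(Module.Basis.span h1).map (LinearEquiv.ofEq _ _ h2)⟩

theorem Hom.PullFormsLocallyFree.gaussExtends (h : σ.PullFormsLocallyFree n)
    (hσ : σ.ResolvesWith S E n) (hX : ∀ a, X.IsRegularPoint a) (hM : ∀ m, M.IsRegularPoint m) :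
    i.GaussExtends σ S n := by
  have b := fun x => (h.exists_basis x).some
  refine ⟨⟨i.dualPlane σ, fun x hx => i.dualPlane_le hx, fun x hx => i.finrank_dualPlane hx (b x)⟩,
    fun a ha => ?_, fun x hx hS => i.dualPlane_eq_gauss hσ hx hS⟩
  obtain ⟨N, z, hz, hz', -⟩ := (hM (i.pt (σ.pt a) ha)).frame
  -- The coefficients `A` of the reduction are the entries of the matrix of the plane in the
  -- Grassmann chart of `I`.
  obtain ⟨I, A, hI, hA, hred⟩ := h.exists_isReduction (hX a) ha hz hz'.self_of_nhds
  obtain ⟨W, s, haW, hs⟩ := exists_sections hz hz'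
  obtain ⟨U, B, haU, hB⟩ := exists_sections (J := Fin N × Fin N) (F := fun q => A q.1 q.2)
    (fun q => hA q.1 q.2)
    (hred.and (σ.eventually (i.eventually ha (W.isOpen.mem_nhds haW))))
  refine ⟨N, W, s, I, U, fun l m => B (l, m), fun y hy => ?_, hI, haU, fun x hx => ?_⟩
  · obtain ⟨⟨c, hc⟩, hsy⟩ := hs y hy
    have : (fun l => M.d y (M.germ W y hy (s l))) = c := by
      funext l
      rw [hc, hsy]
    rw [this]
    exact ⟨c.linearIndependent, c.span_eq⟩
  · obtain ⟨⟨hredx, hxV, hxW⟩, hBx⟩ := hB x hx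
    refine ⟨hxV, hxW, fun D hD => ?_⟩
    obtain ⟨hc, hsx⟩ := hs _ hxW
    refine (i.mem_dualPlane_iff hxV hI (b x) hc hredx hD).trans ?_
    simp only [hsx, ← hBx (_, _)]

/-! ### The equivalence -/

theorem Hom.ResolvesWith.tfae {J : Type*} (hσ : σ.ResolvesWith S E n)
    (hX : ∀ a, X.IsRegularPoint a) {M : J → KSpace.{u} k} (hM : ∀ j m, (M j).IsRegularPoint m)
    (i : ∀ j, LocalEmbedding X₀ (M j)) (hi : ∀ b, ∃ j, b ∈ (i j).V) :
    [∀ j, (i j).GaussExtends σ S n, σ.PullFormsLocallyFree n,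
      X.IsPrincipalIdeal (σ.logFitting E n 0)].TFAE := by
  have frame_of_free : σ.PullFormsLocallyFree n → ∀ a, σ.HasFrameAt n a := by
    intro h a
    obtain ⟨j, hj⟩ := hi (σ.pt a)
    obtain ⟨N, z, hz, hz', -⟩ := (hM j ((i j).pt (σ.pt a) hj)).frame
    obtain ⟨I, A, hI, hA, hred⟩ := h.exists_isReduction (hX a) hj hz hz'.self_of_nhds
    exact (i j).hasFrameAt hj hI hz hz' hred
  tfae_have 1 → 2 := fun h => hσ.pullFormsLocallyFree hX fun a => by
    obtain ⟨j, hj⟩ := hi (σ.pt a)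
    exact (h j).hasFrameAt hσ (hX a) hj
  tfae_have 2 → 1 := fun h j => h.gaussExtends hσ hX (hM j)
  tfae_have 2 → 3 := fun h => hσ.isPrincipalIdeal hX (frame_of_free h)
  tfae_have 3 → 2 := fun h => hσ.pullFormsLocallyFree hX fun a => by
    obtain ⟨j, hj⟩ := hi (σ.pt a)
    exact hσ.hasFrameAt_of_isPrincipalIdeal (hX a) hj (hM j _) h
  tfae_finish

end KSpace

end GaussMap

end

noncomputable section

namespace GaussMap

open scoped TensorProduct

/-! ### Smooth algebras over a field -/

/-- By flatness B embeds in its generic fibre, which is étale over a field and therefore reduced. -/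
theorem isReduced_of_etale {P B : Type*} [CommRing P] [IsDomain P] [CommRing B] [Algebra P B]
    [Algebra.Etale P B] : _root_.IsReduced B := by
  let K := FractionRing P
  have h1 : Algebra.Etale K (K ⊗[P] B) := inferInstance
  have h2 : _root_.IsReduced (K ⊗[P] B) :=
    Algebra.FormallyUnramified.isReduced_of_field K (K ⊗[P] B)
  have h3 : Module.Flat P B := inferInstance
  have h4 : Function.Injective (Algebra.TensorProduct.includeRight : B →ₐ[P] K ⊗[P] B) :=
    Algebra.TensorProduct.includeRight_injective (IsFractionRing.injective P K)
  exact isReduced_of_injective _ h4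

/-- Near a smooth point S is étale over a polynomial ring, so some S_f with f outside p is reduced.
A nilpotent of S_p, after clearing denominators, comes from a nilpotent of S; this dies in S_f and
hence in S_p. -/
theorem isReduced_localization {k S : Type*} [Field k] [CommRing S] [Algebra k S]
    [Algebra.FinitePresentation k S] (p : Ideal S) [p.IsPrime] [Algebra.IsSmoothAt k p] :
    _root_.IsReduced (Localization.AtPrime p) := by
  obtain ⟨f, hf, n, _, _, h⟩ := Algebra.IsSmoothAt.exists_isStandardEtale_mvPolynomial (R := k)
    (p := p)
  have h1 : _root_.IsReduced (Localization.Away f) :=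
    isReduced_of_etale (P := MvPolynomial (Fin n) k)
  refine ⟨fun x ⟨m, hx⟩ => ?_⟩
  obtain ⟨⟨r, s⟩, hrs⟩ := IsLocalization.surj p.primeCompl x
  have h2 : algebraMap S (Localization.AtPrime p) (r ^ m) = 0 := by
    rw [map_pow, ← hrs, mul_pow, hx, zero_mul]
  obtain ⟨⟨c, hc⟩, h3⟩ := (IsLocalization.map_eq_zero_iff p.primeCompl _ _).mp h2
  have h4 : IsNilpotent (c * r) := ⟨m + 1, by
    rw [mul_pow, pow_succ c, pow_succ r]
    calc c ^ m * c * (r ^ m * r) = c ^ m * r * (c * r ^ m) := by ring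
      _ = 0 := by rw [h3, mul_zero]⟩
  have h5 := (h4.map (algebraMap S (Localization.Away f))).eq_zero
  obtain ⟨⟨_, j, rfl⟩, h6⟩ := (IsLocalization.map_eq_zero_iff (Submonoid.powers f) _ _).mp h5
  have h7 : algebraMap S (Localization.AtPrime p) r = 0 := by
    refine (IsLocalization.map_eq_zero_iff p.primeCompl _ _).mpr ⟨⟨f ^ j * c, ?_⟩, ?_⟩
    · exact p.primeCompl.mul_mem (p.primeCompl.pow_mem hf j) hc
    · rw [mul_assoc]
      exact h6
  rw [h7] at hrs
  exact (IsLocalization.map_units (Localization.AtPrime p) s).mul_left_eq_zero.mp hrs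

theorem isReduced_of_formallySmooth (k : Type*) {B : Type*} [Field k] [CommRing B] [IsLocalRing B]
    [Algebra k B] [Algebra.EssFiniteType k B] [Algebra.FormallySmooth k B] :
    _root_.IsReduced B := by
  let S := Algebra.EssFiniteType.subalgebra k B
  let M := Algebra.EssFiniteType.submonoid k B
  have h1 : Algebra.FinitePresentation k S :=
    Algebra.FinitePresentation.of_finiteType.mp inferInstance
  let p : Ideal S := (IsLocalRing.maximalIdeal B).comap (algebraMap S B)
  -- As B is local, the elements of the finite type subalgebra that are invertible in B are those
  -- outside the contracted maximal ideal. So B is its localization at a prime.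
  have hM : M = p.primeCompl := by
    ext s
    simp only [M, p, Algebra.EssFiniteType.submonoid, Submonoid.mem_comap, IsUnit.mem_submonoid_iff,
      Ideal.primeCompl, Ideal.mem_comap, Submonoid.mem_mk, Subsemigroup.mem_mk, Set.mem_compl_iff,
      SetLike.mem_coe, IsLocalRing.mem_maximalIdeal, mem_nonunits_iff, not_not]
    rfl
  have h2 : IsLocalization p.primeCompl B := hM ▸ Algebra.EssFiniteType.isLocalization k B
  let e : B ≃ₐ[S] Localization.AtPrime p := IsLocalization.algEquiv p.primeCompl _ _
  have h3 : Algebra.IsSmoothAt k p := Algebra.FormallySmooth.of_equiv (e.restrictScalars k)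
  have := isReduced_localization (k := k) p
  exact isReduced_of_injective e e.injective

/-- Jacobian criterion: φ induces a map from the restricted differentials to A/(t) taking dt to 1,
and sending 1 to the class of t gives a retraction of the conormal map. -/
theorem formallySmooth_quotient {k A : Type*} [Field k] [CommRing A] [Algebra k A]
    [Algebra.FormallySmooth k A] (t : A) (φ : Ω[A⁄k] →ₗ[A] A)
    (hφ : φ (KaehlerDifferential.D k A t) = 1) :
    Algebra.FormallySmooth k (A ⧸ Ideal.span {t}) := by
  have hs : Function.Surjective (algebraMap A (A ⧸ Ideal.span {t})) := Ideal.Quotient.mk_surjective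
  refine (Algebra.FormallySmooth.iff_split_injection (R := k) (P := A) hs).mpr ?_
  let I := RingHom.ker (algebraMap A (A ⧸ Ideal.span {t}))
  have hI : I = Ideal.span {t} := Ideal.mk_ker
  have ht : t ∈ I := hI ▸ Ideal.mem_span_singleton_self t
  let τ : I.Cotangent := I.toCotangent ⟨t, ht⟩
  let ψ : (A ⧸ Ideal.span {t}) →ₗ[A] I.Cotangent :=
    Submodule.liftQ (Ideal.span {t}) (LinearMap.toSpanSingleton A I.Cotangent τ) (by
      rw [Ideal.span, Submodule.span_le, Set.singleton_subset_iff]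
      change t • τ = 0
      rw [← map_smul]
      refine (I.toCotangent_eq_zero _).mpr ?_
      change t * t ∈ I ^ 2
      rw [pow_two]
      exact Ideal.mul_mem_mul ht ht)
  refine ⟨ψ ∘ₗ (TensorProduct.rid A _).toLinearMap ∘ₗ φ.lTensor _, ?_⟩
  ext x
  obtain ⟨⟨y, hy⟩, rfl⟩ := I.toCotangent_surjective x
  obtain ⟨a, rfl⟩ := Ideal.mem_span_singleton'.mp (hI ▸ hy)
  -- By Leibniz φ(d(at)) = a + t φ(da), which is a modulo t.
  have h1 : φ (KaehlerDifferential.D k A (a * t)) • (1 : A ⧸ Ideal.span {t}) =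
      Submodule.Quotient.mk a := by
    rw [← Algebra.algebraMap_eq_smul_one, Derivation.leibniz, map_add, map_smul, map_smul, hφ]
    refine (Ideal.Quotient.mk_eq_mk_iff_sub_mem _ _).mpr ?_
    refine Ideal.mem_span_singleton'.mpr ⟨φ (KaehlerDifferential.D k A a), ?_⟩
    simp only [smul_eq_mul]
    ring
  change ψ (φ (KaehlerDifferential.D k A (a * t)) • (1 : A ⧸ Ideal.span {t})) = _
  rw [h1]
  change a • τ = _
  rw [← map_smul]
  rfl

/-- Over a field, the ideal of a smooth hypersurface germ is radical. -/
theorem dvd_of_forall_prime {k A : Type*} [Field k] [CommRing A] [IsLocalRing A] [Algebra k A]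
    [Algebra.EssFiniteType k A] [Algebra.FormallySmooth k A] {t t' : A} (φ : Ω[A⁄k] →ₗ[A] A)
    (hφ : φ (KaehlerDifferential.D k A t) = 1)
    (h : ∀ p : Ideal A, p.IsPrime → t ∈ p → t' ∈ p) : t ∣ t' := by
  -- For non-units the quotient by t is nonzero, hence local, as the reducedness lemma requires.
  by_cases ht : IsUnit t
  · exact ht.dvd
  have h1 : Nontrivial (A ⧸ Ideal.span {t}) :=
    Ideal.Quotient.nontrivial_iff.mpr fun h => ht (Ideal.span_singleton_eq_top.mp h)
  have h2 : IsLocalRing (A ⧸ Ideal.span {t}) :=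
    IsLocalRing.of_surjective' (Ideal.Quotient.mk _) Ideal.Quotient.mk_surjective
  have h3 := formallySmooth_quotient t φ hφ
  have h4 : _root_.IsReduced (A ⧸ Ideal.span {t}) := isReduced_of_formallySmooth k
  have h5 : (Ideal.span {t}).IsRadical := (Ideal.isRadical_iff_quotient_reduced _).mpr h4
  rw [← Ideal.mem_span_singleton]
  refine h5 ?_
  rw [Ideal.radical_eq_sInf, Submodule.mem_sInf]
  rintro p ⟨hp, hpr⟩
  exact h p hpr (hp (Ideal.mem_span_singleton_self t))

theorem exists_basis_of_isLocalization {k R A : Type*} [Field k] [CommRing R] [CommRing A]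
    [Algebra k R] [Algebra R A] [Algebra k A] [IsScalarTower k R A] (M : Submonoid R)
    [IsLocalization M A] {ι : Type*} (b : Module.Basis ι R Ω[R⁄k]) (x : ι → R)
    (hb : ∀ i, b i = KaehlerDifferential.D k R (x i)) :
    ∃ b' : Module.Basis ι A Ω[A⁄k],
      ∀ i, b' i = KaehlerDifferential.D k A (algebraMap R A (x i)) := by
  refine ⟨b.ofIsLocalizedModule A M (KaehlerDifferential.map k k R A), fun i => ?_⟩
  rw [Module.Basis.ofIsLocalizedModule_apply, hb, KaehlerDifferential.map_D]

end GaussMap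

end

noncomputable section

namespace GaussMap

namespace KSpace

open Filter

/-! ### Smooth varieties -/

theorem eventually_of_specializes {α : Type*} [TopologicalSpace α] {x y : α} (hy : y ⤳ x)
    {p : α → Prop} (h : ∀ᶠ z in 𝓝 x, p z) : p y :=
  (h.filter_mono hy).self_of_nhds

section Krull

variable {k : Type v} [Field k] (X : KSpace.{u} k) (x : X.Point)

/-- Krull's intersection theorem: over the Noetherian stalk the finite module of differentials is
already separated. -/
theorem exists_cotangent_equiv [Algebra.EssFiniteType k (X.Stalk x)] :
    ∃ e : Ω[X.Stalk x⁄k] ≃ₗ[X.Stalk x] X.Cotangent x,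
      ∀ f, e (KaehlerDifferential.D k (X.Stalk x) f) = X.d x f := by
  let N := ⨅ i : ℕ, (IsLocalRing.maximalIdeal (X.Stalk x)) ^ i •
    (⊤ : Submodule (X.Stalk x) Ω[X.Stalk x⁄k])
  have h1 : IsNoetherianRing (X.Stalk x) := Algebra.EssFiniteType.isNoetherianRing k _
  have hN : N = ⊥ := Ideal.iInf_pow_smul_eq_bot_of_isLocalRing
    (IsLocalRing.maximalIdeal (X.Stalk x)) (IsLocalRing.maximalIdeal.isMaximal _).ne_top
  exact ⟨(N.quotEquivOfEqBot hN).symm, fun f => rfl⟩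

end Krull

section Scheme

variable {k : Type u} [Field k] {X : Scheme.{u}} (s : X ⟶ Spec (CommRingCat.of k))

/-- The constant functions on an open set. -/
def scalarsOn (V : Opens (ofScheme s).Point) : k →+* (ofScheme s).Sections V :=
  ((ofScheme s).res le_top).comp (ofScheme s).scalars

theorem germ_scalarsOn (V : Opens (ofScheme s).Point) (y : (ofScheme s).Point) (hy : y ∈ V)
    (c : k) : (ofScheme s).germ V y hy (scalarsOn s V c) = algebraMap k _ c :=
  (ofScheme s).germ_res le_top y hy _

theorem exists_isStandardSmooth [Smooth s] (a : (ofScheme s).Point) :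
    ∃ V : Opens (ofScheme s).Point, a ∈ V ∧ (scalarsOn s V).IsStandardSmooth ∧
      ∀ (y : (ofScheme s).Point) (hy : y ∈ V),
        ∃ (p : Ideal ((ofScheme s).Sections V)) (_ : p.IsPrime),
          letI := ((ofScheme s).germ V y hy).toAlgebra
          IsLocalization.AtPrime ((ofScheme s).Stalk y) p := by
  obtain ⟨U, hU, V, hV, ha, e, h⟩ := Smooth.exists_isStandardSmooth s a
  refine ⟨V, ha, ?_, fun y hy => ?_⟩
  -- Spec k has one point, so an open set containing the image of `a` is everything.
  · obtain rfl : U = ⊤ := by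
      ext y
      simp only [Opens.coe_top, Set.mem_univ, iff_true]
      have : y = s a := Subsingleton.elim (α := PrimeSpectrum k) _ _
      rw [this]
      exact e ha
    have h2 := RingHom.isStandardSmooth_respectsIso.2 (s.appLE ⊤ V e).hom
      (Scheme.ΓSpecIso (CommRingCat.of k)).symm.commRingCatIsoToRingEquiv h
    exact h2
  · exact ⟨(hV.primeIdealOf ⟨y, hy⟩).asIdeal, (hV.primeIdealOf ⟨y, hy⟩).isPrime, hV.isLocalization_stalk ⟨y, hy⟩⟩

/-- The point y is the image of q under Spec 𝒪_{X,a} → X, and the preimage of the locus where f is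
invertible is the basic open set of its germ at `a`. -/
theorem _root_.AlgebraicGeometry.Scheme.exists_generization (X : Scheme.{u}) (a : X) (q : Ideal (X.presheaf.stalk a))
    [hq : q.IsPrime] : ∃ y : X, y ⤳ a ∧ ∀ (U : X.Opens) (f : Γ(X, U)) (hU : a ∈ U) (hy : y ∈ U),
      IsUnit (X.presheaf.germ U y hy f) ↔ X.presheaf.germ U a hU f ∉ q := by
  let q' : PrimeSpectrum (X.presheaf.stalk a) := ⟨q, hq⟩
  have hr : ∀ z : PrimeSpectrum (X.presheaf.stalk a), X.fromSpecStalk a z ⤳ a := by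
    intro z
    have : X.fromSpecStalk a z ∈ Set.range (X.fromSpecStalk a) := ⟨z, rfl⟩
    rwa [Scheme.range_fromSpecStalk] at this
  refine ⟨X.fromSpecStalk a q', hr q', fun U f hU hyU => ?_⟩
  rw [← X.mem_basicOpen f _ hyU]
  have h2 : X.fromSpecStalk a ⁻¹ᵁ X.basicOpen f =
      PrimeSpectrum.basicOpen (X.presheaf.germ U a hU f) := by
    rw [Scheme.preimage_basicOpen, Scheme.fromSpecStalk_app hU, ← basicOpen_eq_of_affine]
    simp only [CommRingCat.comp_apply]
    rw [Scheme.basicOpen_res]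
    exact inf_eq_right.mpr fun z _ => (hr z).mem_open U.isOpen hU
  have h3 : X.fromSpecStalk a q' ∈ X.basicOpen f ↔
      q' ∈ PrimeSpectrum.basicOpen (X.presheaf.germ U a hU f) := by
    rw [← h2]
    rfl
  rw [h3]
  rfl

theorem exists_generization (a : (ofScheme s).Point) (q : Ideal ((ofScheme s).Stalk a))
    (hq : q.IsPrime) : ∃ y : (ofScheme s).Point, y ⤳ a ∧
      ∀ F ∈ (ofScheme s).regularAt a, (ofScheme s).eval y (F y) = 0 ↔ F a ∈ q := by
  obtain ⟨y, hy, h⟩ := Scheme.exists_generization X a q (hq := hq)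
  refine ⟨y, hy, ?_⟩
  rintro F ⟨U, f, hU, hf⟩
  rw [hf a hU, hf y (hy.mem_open U.isOpen hU)]
  refine eval_eq_zero_iff.trans ?_
  rw [not_iff_comm]
  exact (h U f hU (hy.mem_open U.isOpen hU)).symm

variable [Smooth s]

theorem stalk_isSmooth (a : (ofScheme s).Point) :
    Algebra.EssFiniteType k ((ofScheme s).Stalk a) ∧
      Algebra.FormallySmooth k ((ofScheme s).Stalk a) := by
  obtain ⟨V, ha, h, hp⟩ := exists_isStandardSmooth s a
  obtain ⟨p, _, hloc⟩ := hp a ha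
  let _ := (scalarsOn s V).toAlgebra
  let _ := ((ofScheme s).germ V a ha).toAlgebra
  have _ : IsScalarTower k ((ofScheme s).Sections V) ((ofScheme s).Stalk a) :=
    .of_algebraMap_eq fun c => (germ_scalarsOn s V a ha c).symm
  have _ : Algebra.IsStandardSmooth k ((ofScheme s).Sections V) := h
  have h1 : Algebra.EssFiniteType ((ofScheme s).Sections V) ((ofScheme s).Stalk a) :=
    .of_isLocalization _ p.primeCompl
  have h2 : Algebra.FormallySmooth ((ofScheme s).Sections V) ((ofScheme s).Stalk a) :=
    .of_isLocalization p.primeCompl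
  exact ⟨.comp k ((ofScheme s).Sections V) _, .comp k ((ofScheme s).Sections V) _⟩

/-- Near every point, there are local coordinates, and the coordinates of differentials of
functions are functions. -/
theorem exists_coordinates (a : (ofScheme s).Point) :
    ∃ (V : Opens (ofScheme s).Point) (N : ℕ) (x : Fin N → (ofScheme s).Sections V)
      (c : (ofScheme s).Sections V → Fin N → (ofScheme s).Sections V), a ∈ V ∧
      (∀ f : (ofScheme s).Stalk a, ∀ ha : a ∈ V, ∃ r u : (ofScheme s).Sections V,
        IsUnit ((ofScheme s).germ V a ha u) ∧
          (ofScheme s).germ V a ha u * f = (ofScheme s).germ V a ha r) ∧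
      ∀ (y : (ofScheme s).Point) (hy : y ∈ V),
        (∃ b : Module.Basis (Fin N) ((ofScheme s).Stalk y) ((ofScheme s).Cotangent y),
          ∀ i, b i = (ofScheme s).d y ((ofScheme s).germ V y hy (x i))) ∧
        ∀ r, (ofScheme s).d y ((ofScheme s).germ V y hy r) =
          ∑ i, (ofScheme s).germ V y hy (c r i) •
            (ofScheme s).d y ((ofScheme s).germ V y hy (x i)) := by
  obtain ⟨V, ha, h, hp⟩ := exists_isStandardSmooth s a
  let R := (ofScheme s).Sections V
  let _ : Algebra k R := (scalarsOn s V).toAlgebra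
  have _ : Algebra.IsStandardSmooth k R := h
  obtain ⟨I, b, hb⟩ := (Algebra.IsStandardSmooth.iff_exists_basis_kaehlerDifferential
    (R := k) (S := R)).mp h |>.2
  have hI : Finite I := by
    have : Nontrivial R := ((ofScheme s).germ V a ha).domain_nontrivial
    exact Module.Finite.finite_basis b
  obtain ⟨N, ⟨e⟩⟩ := Finite.exists_equiv_fin I
  choose x hx using fun i => hb ⟨e.symm i, rfl⟩
  let b' := b.reindex e
  have hb' : ∀ i, b' i = KaehlerDifferential.D k R (x i) := fun i => by
    rw [hx, b.reindex_apply]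
  refine ⟨V, N, x, fun r i => b'.repr (KaehlerDifferential.D k R r) i, ha, fun f ha => ?_,
    fun y hy => ?_⟩
  · obtain ⟨p, _, hloc⟩ := hp a ha
    let _ := ((ofScheme s).germ V a ha).toAlgebra
    obtain ⟨⟨r, u⟩, h⟩ := IsLocalization.surj p.primeCompl f
    exact ⟨r, u, IsLocalization.map_units _ u, by rw [mul_comm]; exact h⟩
  · obtain ⟨p, _, hloc⟩ := hp y hy
    let _ := ((ofScheme s).germ V y hy).toAlgebra
    have _ : IsScalarTower k R ((ofScheme s).Stalk y) :=
      .of_algebraMap_eq fun c => (germ_scalarsOn s V y hy c).symm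
    obtain ⟨b₂, hb₂⟩ := exists_basis_of_isLocalization (A := (ofScheme s).Stalk y)
      p.primeCompl b' x hb'
    have := (stalk_isSmooth s y).1
    obtain ⟨E, hE⟩ := exists_cotangent_equiv (ofScheme s) y
    refine ⟨⟨b₂.map E, fun i => ?_⟩, fun r => ?_⟩
    · rw [Module.Basis.map_apply, hb₂, hE]
      rfl
    · have h1 := (b'.sum_repr (KaehlerDifferential.D k R r)).symm
      simp only [hb'] at h1
      have h2 := congrArg E (congrArg (KaehlerDifferential.map k k R ((ofScheme s).Stalk y)) h1)
      simp only [map_sum, map_smul, KaehlerDifferential.map_D, hE] at h2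
      refine h2.trans (Finset.sum_congr rfl fun i _ => ?_)
      rw [← algebraMap_smul ((ofScheme s).Stalk y), map_smul, hE]
      rfl

/-- A condition holding near `a` holds at all generizations of `a`, hence at every prime of the
stalk. Vanishing of values then means membership in primes, so the first property follows from
reducedness of the stalk and the third from that of its quotient by T. -/
theorem isRegularPoint_ofScheme (a : (ofScheme s).Point) : (ofScheme s).IsRegularPoint a where
  reduced F hF h := by
    obtain ⟨_, _⟩ := stalk_isSmooth s a
    have : _root_.IsReduced ((ofScheme s).Stalk a) := isReduced_of_formallySmooth k
    have hn : F a ∈ nilradical ((ofScheme s).Stalk a) := by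
      rw [nilradical_eq_sInf, Submodule.mem_sInf]
      intro q hq
      obtain ⟨y, hy, hev⟩ := exists_generization s a q hq
      exact (hev F hF).mp (eventually_of_specializes hy h)
    exact IsNilpotent.eq_zero hn
  frame := by
    obtain ⟨V, N, x, c, ha, hfrac, hV⟩ := exists_coordinates s a
    have hVa := V.isOpen.mem_nhds ha
    refine ⟨N, fun i => extend (x i), fun i => extend_mem _ ha, ?_, fun F hF => ?_⟩
    · filter_upwards [hVa] with y hy
      obtain ⟨⟨b, hb⟩, -⟩ := hV y hy
      refine ⟨b, fun i => ?_⟩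
      rw [hb]
      exact congrArg _ (extend_apply _ hy).symm
    -- Write F = r/u with sections r, u on the chart. By the quotient rule the coefficients of dF
    -- are u⁻¹(c_r - F c_u), and `w` plays the role of u⁻¹.
    · obtain ⟨r, u, hu, hur⟩ := hfrac (F a) ha
      obtain ⟨w', hw'⟩ := hu.exists_left_inv
      obtain ⟨w, hw, rfl⟩ := exists_regularAt w'
      have e1 := eventually_eq (mul_mem (extend_mem u ha) hF) (extend_mem r ha) (by
        rw [Pi.mul_apply, extend_apply _ ha, extend_apply _ ha, hur])
      have e2 := eventually_eq (mul_mem hw (extend_mem u ha)) (one_mem _) (by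
        rw [Pi.mul_apply, extend_apply _ ha, hw']; rfl)
      refine ⟨fun i => w * (extend (c r i) - F * extend (c u i)), fun i => mul_mem hw
        (sub_mem (extend_mem _ ha) (mul_mem hF (extend_mem _ ha))), ?_⟩
      filter_upwards [e1, e2, hVa] with y h1 h2 hy
      obtain ⟨-, hd⟩ := hV y hy
      simp only [Pi.mul_apply, Pi.sub_apply, Pi.one_apply, extend_apply _ hy] at h1 h2 ⊢
      have h3 := congrArg ((ofScheme s).d y) h1
      rw [d_mul, hd r, hd u] at h3
      have h4 : (ofScheme s).germ V y hy u • (ofScheme s).d y (F y) =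
          ∑ i, ((ofScheme s).germ V y hy (c r i) - F y * (ofScheme s).germ V y hy (c u i)) •
            (ofScheme s).d y ((ofScheme s).germ V y hy (x i)) := by
        simp only [sub_smul, mul_smul, Finset.sum_sub_distrib]
        rw [← Finset.smul_sum, ← h3, add_sub_cancel_right]
      have h5 := congrArg (w y • ·) h4
      simp only [← mul_smul, h2, one_smul, Finset.smul_sum] at h5
      exact h5
  dvd T hT T' hT' := by
    rintro ⟨φ, hφ⟩ h
    obtain ⟨_, _⟩ := stalk_isSmooth s a
    obtain ⟨E, hE⟩ := exists_cotangent_equiv (ofScheme s) a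
    refine dvd_of_forall_prime (k := k) (φ ∘ₗ E.toLinearMap) ?_ fun q hq hTq => ?_
    · rw [← hφ, ← hE]
      rfl
    · obtain ⟨y, hy, hev⟩ := exists_generization s a q hq
      exact (hev T' hT').mp (eventually_of_specializes hy h ((hev T hT).mpr hTq))

end Scheme

end KSpace

end GaussMap

end

noncomputable section

namespace GaussMap

namespace KSpace

open Filter

variable {k : Type v} [Field k]

/-! ### Regular points and open immersions -/

section StalkEquiv

variable {X Y : KSpace.{u} k} {x : X.Point} {y : Y.Point} (e : Y.Stalk y ≃+* X.Stalk x)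
  (he : ∀ c : k, e (algebraMap k _ c) = algebraMap k _ c)

include he

theorem exists_cotangent_map_of_equiv :
    ∃ T : Y.Cotangent y →+ X.Cotangent x, (∀ r w, T (r • w) = e r • T w) ∧
      ∀ f, T (Y.d y f) = X.d x (e f) := by
  have : IsLocalHom (e : Y.Stalk y →+* X.Stalk x) :=
    ⟨fun f hf => (MulEquiv.isUnit_map e).mp hf⟩
  obtain ⟨T, hT⟩ := exists_cotangent_map (X := X) (Y := Y) (e : Y.Stalk y →+* X.Stalk x) he
  exact ⟨T.toAddMonoidHom, fun r w => T.map_smulₛₗ r w, hT⟩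

theorem symm_algebraMap (c : k) : e.symm (algebraMap k _ c) = algebraMap k _ c := by
  rw [← he, e.symm_apply_apply]

theorem exists_cotangent_equiv_of_equiv :
    ∃ T : Y.Cotangent y ≃+ X.Cotangent x, (∀ r w, T (r • w) = e r • T w) ∧
      ∀ f, T (Y.d y f) = X.d x (e f) := by
  obtain ⟨T, hT, hTd⟩ := exists_cotangent_map_of_equiv e he
  obtain ⟨T', hT', hTd'⟩ := exists_cotangent_map_of_equiv e.symm (symm_algebraMap e he)
  have h1 : ∀ w, T' (T w) = w := by
    intro w
    have hw : w ∈ Submodule.span (Y.Stalk y) (Set.range (Y.d y)) := by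
      rw [span_range_d]; trivial
    induction hw using Submodule.span_induction with
    | mem w hw => obtain ⟨f, rfl⟩ := hw; rw [hTd, hTd', e.symm_apply_apply]
    | zero => rw [map_zero, map_zero]
    | add w w' _ _ h h' => rw [map_add, map_add, h, h']
    | smul r w _ h => rw [hT, hT', h, e.symm_apply_apply]
  have h2 : ∀ w, T (T' w) = w := by
    intro w
    have hw : w ∈ Submodule.span (X.Stalk x) (Set.range (X.d x)) := by
      rw [span_range_d]; trivial
    induction hw using Submodule.span_induction with
    | mem w hw => obtain ⟨f, rfl⟩ := hw; rw [hTd', hTd, e.apply_symm_apply]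
    | zero => rw [map_zero, map_zero]
    | add w w' _ _ h h' => rw [map_add, map_add, h, h']
    | smul r w _ h => rw [hT', hT, h, e.apply_symm_apply]
  exact ⟨{ T with invFun := T', left_inv := h1, right_inv := h2 }, hT, hTd⟩

theorem exists_basis_of_equiv {N : ℕ} {t : Fin N → Y.Stalk y}
    (h : ∃ b : Module.Basis (Fin N) (Y.Stalk y) (Y.Cotangent y), ∀ i, b i = Y.d y (t i)) :
    ∃ b : Module.Basis (Fin N) (X.Stalk x) (X.Cotangent x), ∀ i, b i = X.d x (e (t i)) := by
  obtain ⟨b, hb⟩ := h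
  obtain ⟨T, hT, hTd⟩ := exists_cotangent_equiv_of_equiv e he
  let _ : Module (Y.Stalk y) (X.Cotangent x) :=
    Module.compHom (X.Cotangent x) (e : Y.Stalk y →+* X.Stalk x)
  let T' : Y.Cotangent y ≃ₗ[Y.Stalk y] X.Cotangent x := { T with map_smul' := hT }
  have hc : ∀ (c : Y.Stalk y) (w : X.Cotangent x), e c • w = c • w := fun c w => rfl
  refine ⟨(b.map T').mapCoeffs e hc, fun i => ?_⟩
  refine ((b.map T').mapCoeffs_apply e hc i).trans ?_
  rw [Module.Basis.map_apply, hb]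
  exact hTd _

theorem exists_form_of_equiv {t : Y.Stalk y}
    (h : ∃ φ : Y.Cotangent y →ₗ[Y.Stalk y] Y.Stalk y, φ (Y.d y t) = 1) :
    ∃ φ : X.Cotangent x →ₗ[X.Stalk x] X.Stalk x, φ (X.d x (e t)) = 1 := by
  obtain ⟨φ, hφ⟩ := h
  obtain ⟨T, hT, hTd⟩ := exists_cotangent_map_of_equiv e.symm (symm_algebraMap e he)
  refine ⟨{ toFun := fun w => e (φ (T w))
            map_add' := fun w w' => by rw [map_add, map_add, map_add]
            map_smul' := fun r w => by
              rw [hT, map_smul, smul_eq_mul, map_mul, e.apply_symm_apply]; rfl }, ?_⟩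
  change e (φ (T (X.d x (e t)))) = 1
  rw [hTd, e.symm_apply_apply, hφ, map_one]

theorem d_eq_of_equiv {N : ℕ} {f : Y.Stalk y} {g t : Fin N → Y.Stalk y}
    (h : Y.d y f = ∑ i, g i • Y.d y (t i)) :
    X.d x (e f) = ∑ i, e (g i) • X.d x (e (t i)) := by
  obtain ⟨T, hT, hTd⟩ := exists_cotangent_map_of_equiv e he
  rw [← hTd, h, map_sum]
  simp only [hT, hTd]

end StalkEquiv

section OpenImmersion

variable {X Y : KSpace.{u} k}

/-- Open immersions of locally ringed spaces, described on points and stalks. -/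
structure Hom.IsOpenImm (f : Hom X Y) : Prop where
  isOpenEmbedding : IsOpenEmbedding f.pt
  bijective : ∀ y, Function.Bijective (f.pull y)

theorem Hom.isOpenImm (f : Hom X Y) (hf : LocallyRingedSpace.IsOpenImmersion f.hom) :
    f.IsOpenImm where
  isOpenEmbedding := hf.base_open
  bijective := pull_bijective_of_isOpenImmersion f hf

theorem Hom.eval_pullField_eq_zero_iff (f : Hom X Y) (H : Y.GermField) (y : X.Point) :
    X.eval y (f.pullField H y) = 0 ↔ Y.eval (f.pt y) (H (f.pt y)) = 0 := by
  rw [eval_eq_zero_iff, eval_eq_zero_iff]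
  exact not_congr (isUnit_pull_iff f)

namespace Hom.IsOpenImm

variable {f : Hom X Y} (hf : f.IsOpenImm)

/-- The isomorphism of stalks. -/
def equiv (y : X.Point) : Y.Stalk (f.pt y) ≃+* X.Stalk y :=
  RingEquiv.ofBijective (f.pull y) (hf.bijective y)

theorem equiv_algebraMap (y : X.Point) (c : k) :
    hf.equiv y (algebraMap k _ c) = algebraMap k _ c := f.pull_algebraMap y c

include hf

theorem eventually_iff {x : X.Point} {p : Y.Point → Prop} :
    (∀ᶠ y in 𝓝 (f.pt x), p y) ↔ ∀ᶠ y in 𝓝 x, p (f.pt y) := by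
  rw [← hf.isOpenEmbedding.map_nhds_eq x, eventually_map]

theorem exists_pullField {x : X.Point} {F : X.GermField} (hF : F ∈ X.regularAt x) :
    ∃ H ∈ Y.regularAt (f.pt x), ∀ᶠ y in 𝓝 x, F y = f.pullField H y := by
  obtain ⟨g, hg⟩ := (hf.bijective x).2 (F x)
  obtain ⟨H, hH, rfl⟩ := exists_regularAt g
  exact ⟨H, hH, eventually_eq hF (f.pullField_mem hH) hg.symm⟩

theorem isRegularPoint_of_target {x : X.Point} (h : Y.IsRegularPoint (f.pt x)) :
    X.IsRegularPoint x where
  reduced F hF h0 := by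
    obtain ⟨H, hH, e⟩ := hf.exists_pullField hF
    have h1 := h.reduced H hH (hf.eventually_iff.mpr (by
      filter_upwards [h0, e] with y h1 h2
      rwa [h2, f.eval_pullField_eq_zero_iff] at h1))
    rw [e.self_of_nhds]
    exact (congrArg (f.pull x) h1).trans (map_zero _)
  frame := by
    obtain ⟨N, z, hz, hzy, hco⟩ := h.frame
    refine ⟨N, fun i => f.pullField (z i), fun i => f.pullField_mem (hz i), ?_, fun F hF => ?_⟩
    · filter_upwards [hf.eventually_iff.mp hzy] with y hy
      exact exists_basis_of_equiv (hf.equiv y) (hf.equiv_algebraMap y) hy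
    · obtain ⟨H, hH, e⟩ := hf.exists_pullField hF
      obtain ⟨g, hg, hgd⟩ := hco H hH
      refine ⟨fun i => f.pullField (g i), fun i => f.pullField_mem (hg i), ?_⟩
      filter_upwards [hf.eventually_iff.mp hgd, e] with y h1 h2
      rw [h2]
      exact d_eq_of_equiv (hf.equiv y) (hf.equiv_algebraMap y) h1
  dvd T hT T' hT' := by
    intro hφ h0
    obtain ⟨H, hH, e⟩ := hf.exists_pullField hT
    obtain ⟨H', hH', e'⟩ := hf.exists_pullField hT'
    have h1 := h.dvd H hH H' hH' (by
      have := exists_form_of_equiv (hf.equiv x).symm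
        (symm_algebraMap _ (hf.equiv_algebraMap x)) hφ
      rw [e.self_of_nhds] at this
      rwa [show f.pullField H x = hf.equiv x (H (f.pt x)) from rfl,
        (hf.equiv x).symm_apply_apply] at this) (hf.eventually_iff.mpr (by
      filter_upwards [h0, e, e'] with y h1 h2 h3
      rwa [h2, h3, f.eval_pullField_eq_zero_iff, f.eval_pullField_eq_zero_iff] at h1))
    rw [e.self_of_nhds, e'.self_of_nhds]
    exact map_dvd (f.pull x) h1

theorem isRegularPoint_of_source {x : X.Point} (h : X.IsRegularPoint x) :
    Y.IsRegularPoint (f.pt x) where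
  reduced F hF h0 := by
    refine (hf.bijective x).1 (Eq.trans ?_ (map_zero _).symm)
    refine h.reduced _ (f.pullField_mem hF) ?_
    filter_upwards [hf.eventually_iff.mp h0] with y hy
    rwa [f.eval_pullField_eq_zero_iff]
  frame := by
    obtain ⟨N, z, hz, hzy, hco⟩ := h.frame
    choose Z hZ e using fun i => hf.exists_pullField (hz i)
    have e' := eventually_all.mpr e
    refine ⟨N, Z, hZ, ?_, fun F hF => ?_⟩
    · refine hf.eventually_iff.mpr ?_
      filter_upwards [hzy, e'] with y hy hy'
      obtain ⟨b, hb⟩ := exists_basis_of_equiv (hf.equiv y).symm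
        (symm_algebraMap _ (hf.equiv_algebraMap y)) hy
      refine ⟨b, fun i => ?_⟩
      rw [hb, hy', show f.pullField (Z i) y = hf.equiv y (Z i (f.pt y)) from rfl,
        (hf.equiv y).symm_apply_apply]
    · obtain ⟨g, hg, hgd⟩ := hco _ (f.pullField_mem hF)
      choose G hG eg using fun i => hf.exists_pullField (hg i)
      refine ⟨G, hG, hf.eventually_iff.mpr ?_⟩
      filter_upwards [hgd, e', eventually_all.mpr eg] with y h1 h2 h3
      have h4 := d_eq_of_equiv (hf.equiv y).symm (symm_algebraMap _ (hf.equiv_algebraMap y)) h1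
      have h5 : ∀ H : Y.GermField, (hf.equiv y).symm (f.pullField H y) = H (f.pt y) :=
        fun H => (hf.equiv y).symm_apply_apply _
      simp only [h2, h3, h5] at h4
      exact h4
  dvd T hT T' hT' := by
    intro hφ h0
    have h1 := h.dvd _ (f.pullField_mem hT) _ (f.pullField_mem hT')
      (exists_form_of_equiv (hf.equiv x) (hf.equiv_algebraMap x) hφ) (by
      filter_upwards [hf.eventually_iff.mp h0] with y h1 h2
      rw [f.eval_pullField_eq_zero_iff] at h2 ⊢
      exact h1 h2)
    exact (map_dvd_iff (hf.equiv x)).mp h1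

end Hom.IsOpenImm

theorem inclusion_isOpenImm (V : Opens X.Point) : (X.inclusion V).IsOpenImm :=
  (X.inclusion V).isOpenImm (inferInstanceAs (LocallyRingedSpace.IsOpenImmersion
    (X.space.ofRestrict V.isOpenEmbedding)))

end OpenImmersion

end KSpace

/-- Regularity depends only on nearby stalks and passes in both directions along open immersions;
here it moves from 𝕜^N to V and from V to X. -/
theorem IsSmoothAnalyticAt.isRegularPoint {𝕜 : Type u} [RCLike 𝕜] {X : KSpace.{u} 𝕜} {N : ℕ}
    {a : X.Point} (h : IsSmoothAnalyticAt X N a)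
    (hN : ∀ y, (analyticAffineSpace 𝕜 N).IsRegularPoint y) : X.IsRegularPoint a := by
  obtain ⟨V, φ, ha, hφ⟩ := h
  exact (KSpace.inclusion_isOpenImm V).isRegularPoint_of_source (x := X.restrictPoint V a ha)
    ((φ.isOpenImm hφ).isRegularPoint_of_target (hN _))

end GaussMap

end

noncomputable section

namespace GaussMap

open Filter Asymptotics

/-! ### Division of analytic functions -/

section Division

variable {𝕜 E F : Type*} [RCLike 𝕜] [NormedAddCommGroup E] [NormedSpace 𝕜 E]
  [NormedAddCommGroup F] [NormedSpace 𝕜 F]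

/-- The coefficients of the power series `G` with `f x - f (P x) = G x (x - P x)`, if `p` is the
power series of `f`. -/
def dividedSeries (p : FormalMultilinearSeries 𝕜 E F) (P : E →L[𝕜] E) :
    FormalMultilinearSeries 𝕜 E (E →L[𝕜] F) := fun n =>
  ∑ i : Fin (n + 1), (ContinuousLinearMap.flipMultilinear ((p (n + 1)).curryMid i)
    ).compContinuousLinearMap
      fun j : Fin n => if j.castSucc < i then ContinuousLinearMap.id 𝕜 E else P

theorem dividedSeries_apply (p : FormalMultilinearSeries 𝕜 E F) (P : E →L[𝕜] E) (n : ℕ) (h v : E) :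
    dividedSeries p P n (fun _ => h) v = ∑ i : Fin (n + 1), p (n + 1)
      (i.insertNth v fun j : Fin n => if j.castSucc < i then h else P h) := by
  simp only [dividedSeries, sum_apply]
  refine Finset.sum_congr rfl fun i _ => ?_
  rw [ContinuousMultilinearMap.compContinuousLinearMap_apply,
    ContinuousLinearMap.flipMultilinear_apply_apply, ContinuousMultilinearMap.curryMid_apply]
  congr 2
  funext j
  split_ifs <;> rfl

/-- Telescoping: the arguments h are replaced by P h one at a time, and the i-th summand is the
change at position i. -/
theorem dividedSeries_apply_sub (p : FormalMultilinearSeries 𝕜 E F) (P : E →L[𝕜] E) (n : ℕ)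
    (h : E) : dividedSeries p P n (fun _ => h) (h - P h) =
      p (n + 1) (fun _ => h) - p (n + 1) fun _ => P h := by
  rw [map_sub, dividedSeries_apply, dividedSeries_apply, ← Finset.sum_sub_distrib]
  let A : ℕ → F := fun m => p (n + 1) fun j => if j.1 < m then h else P h
  have hA : ∀ i : Fin (n + 1), p (n + 1)
      (i.insertNth h fun j : Fin n => if j.castSucc < i then h else P h) -
      p (n + 1) (i.insertNth (P h) fun j : Fin n => if j.castSucc < i then h else P h) =
      A (i.1 + 1) - A i.1 := by
    intro i
    -- Both values of m give the same arguments away from position i; position i receives h exactly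
    -- when i < m.
    have key : ∀ m, (m = i.1 ∨ m = i.1 + 1) →
        (i.insertNth (if i.1 < m then h else P h)
          fun j : Fin n => if j.castSucc < i then h else P h) =
        fun j : Fin (n + 1) => if j.1 < m then h else P h := by
      intro m hm
      refine (Fin.insertNth_eq_iff).mpr ⟨rfl, ?_⟩
      funext j
      simp only [Fin.removeNth_apply]
      congr 1
      rw [Fin.lt_def, eq_iff_iff]
      rcases lt_or_ge j.castSucc i with hj | hj
      · rw [Fin.succAbove_of_castSucc_lt _ _ hj]
        rw [Fin.lt_def] at hj
        simp only [Fin.val_castSucc] at hj ⊢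
        omega
      · rw [Fin.succAbove_of_le_castSucc _ _ hj]
        rw [Fin.le_def] at hj
        simp only [Fin.val_castSucc, Fin.val_succ] at hj ⊢
        omega
    have h1 := key (i.1 + 1) (Or.inr rfl)
    have h2 := key i.1 (Or.inl rfl)
    rw [if_pos (Nat.lt_succ_self _)] at h1
    rw [if_neg (lt_irrefl _)] at h2
    rw [h1, h2]
  rw [Finset.sum_congr rfl fun i _ => hA i, Fin.sum_univ_eq_sum_range (fun i => A (i + 1) - A i),
    Finset.sum_range_sub]
  have h1 : A (n + 1) = p (n + 1) fun _ => h := by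
    refine congrArg (p (n + 1)) (funext fun j => ?_)
    exact if_pos j.2
  rw [h1]
  rfl

theorem norm_dividedSeries_le (p : FormalMultilinearSeries 𝕜 E F) (P : E →L[𝕜] E) (n : ℕ) :
    ‖dividedSeries p P n‖ ≤ (n + 1) * (‖p (n + 1)‖ * (max 1 ‖P‖) ^ n) := by
  have h : ∀ i : Fin (n + 1), ‖(ContinuousLinearMap.flipMultilinear ((p (n + 1)).curryMid i)
    ).compContinuousLinearMap
      fun j : Fin n => if j.castSucc < i then ContinuousLinearMap.id 𝕜 E else P‖ ≤
      ‖p (n + 1)‖ * (max 1 ‖P‖) ^ n := by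
    intro i
    refine (ContinuousMultilinearMap.norm_compContinuousLinearMap_le _ _).trans ?_
    refine mul_le_mul ?_ ?_ (Finset.prod_nonneg fun _ _ => norm_nonneg _) (norm_nonneg _)
    · rw [← ContinuousMultilinearMap.norm_curryMid i (p (n + 1))]
      exact MultilinearMap.mkContinuous_norm_le _ (norm_nonneg _) _
    · refine (Finset.prod_le_prod (fun _ _ => norm_nonneg _) (g := fun _ => max 1 ‖P‖)
        fun j _ => ?_).trans ?_
      · split_ifs
        · exact ContinuousLinearMap.norm_id_le.trans (le_max_left _ _)
        · exact le_max_right _ _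
      · rw [Finset.prod_const, Finset.card_univ, Fintype.card_fin]
  refine (norm_sum_le_of_le (E := E [×n]→L[𝕜] (E →L[𝕜] F)) (Finset.univ : Finset (Fin (n + 1)))
    fun i _ => h i).trans (le_of_eq ?_)
  rw [Finset.sum_const, Finset.card_univ, Fintype.card_fin, nsmul_eq_mul, Nat.cast_succ]

theorem dividedSeries_radius_pos {p : FormalMultilinearSeries 𝕜 E F} (hp : 0 < p.radius)
    (P : E →L[𝕜] E) : 0 < (dividedSeries p P).radius := by
  obtain ⟨C, r, hC, hr, h⟩ := p.le_mul_pow_of_radius_pos hp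
  let D := max 1 ‖P‖
  have hD : 0 < D := lt_max_of_lt_left one_pos
  -- The factor 2 absorbs the number n + 1 ≤ 2^n of summands, r the growth of p, and D the powers of
  -- the norm of P.
  let ρ : NNReal := ⟨1 / (2 * r * D), by positivity⟩
  have hρ : 0 < ρ := NNReal.coe_pos.mp (show (0 : ℝ) < 1 / (2 * r * D) by positivity)
  refine lt_of_lt_of_le (ENNReal.coe_pos.mpr hρ)
    ((dividedSeries p P).le_radius_of_bound (C * r) fun n => ?_)
  have h1 : ‖dividedSeries p P n‖ ≤ (n + 1) * (C * r ^ (n + 1) * D ^ n) :=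
    (norm_dividedSeries_le p P n).trans (by gcongr; exact h _)
  have h2 : ((n : ℝ) + 1) ≤ 2 ^ n := by exact_mod_cast Nat.lt_two_pow_self
  calc ‖dividedSeries p P n‖ * (ρ : ℝ) ^ n
      ≤ (2 ^ n * (C * r ^ (n + 1) * D ^ n)) * (1 / (2 * r * D)) ^ n := by
        gcongr
        · exact h1.trans (by gcongr)
        · exact le_refl _
    _ = C * r := by
        rw [div_pow, one_pow, mul_pow, mul_pow, pow_succ]
        field_simp

/-- The power series of f at x - a and at P(x - a) are subtracted degree by degree and factored by
the telescoping identity. The case P = 0 is Hadamard's lemma; a projection P gives division by a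
coordinate. -/
theorem _root_.AnalyticAt.exists_divided [CompleteSpace F] {f : E → F} {a : E}
    (hf : AnalyticAt 𝕜 f a) (P : E →L[𝕜] E) :
    ∃ G : E → (E →L[𝕜] F), AnalyticAt 𝕜 G a ∧
      ∀ᶠ x in 𝓝 a, f x - f (a + P (x - a)) = G x ((x - a) - P (x - a)) := by
  obtain ⟨p, hp⟩ := hf
  let q := dividedSeries p P
  have hq : HasFPowerSeriesAt q.sum q 0 :=
    (q.hasFPowerSeriesOnBall (dividedSeries_radius_pos hp.radius_pos P)).hasFPowerSeriesAt
  have hs : Tendsto (fun x => x - a) (𝓝 a) (𝓝 0) := by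
    have : Tendsto (fun x => x - a) (𝓝 a) (𝓝 (a - a)) :=
      (continuous_id.sub continuous_const).tendsto a
    rwa [sub_self] at this
  have hPs : Tendsto (fun x => P (x - a)) (𝓝 a) (𝓝 0) := by
    have := (P.continuous.tendsto 0).comp hs
    rwa [map_zero] at this
  refine ⟨fun x => q.sum (x - a), ?_, ?_⟩
  · have h1 : AnalyticAt 𝕜 (fun x : E => x - a) a := analyticAt_id.sub analyticAt_const
    have h2 : AnalyticAt 𝕜 q.sum (a - a) := by rw [sub_self]; exact hq.analyticAt
    exact h2.comp_of_eq h1 rfl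
  · have e1 := hs.eventually hp.eventually_hasSum
    have e2 := hPs.eventually hp.eventually_hasSum
    have e3 := hs.eventually hq.eventually_hasSum
    filter_upwards [e1, e2, e3] with x h1 h2 h3
    rw [add_sub_cancel] at h1
    rw [zero_add] at h3
    have h4 := (h1.sub h2)
    have h5 := ((hasSum_nat_add_iff' 1).mpr h4)
    have h6 : HasSum (fun n => q n (fun _ => x - a) ((x - a) - P (x - a)))
        (q.sum (x - a) ((x - a) - P (x - a))) :=
      (ContinuousLinearMap.apply 𝕜 F ((x - a) - P (x - a))).hasSum h3
    -- The constant terms cancel; this accounts for the shift of degree by one in the divided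
    -- series.
    have h7 : (∑ i ∈ Finset.range 1, ((p i fun _ => x - a) - p i fun _ => P (x - a))) = 0 := by
      rw [Finset.sum_range_one, sub_eq_zero]
      congr 1
      exact Subsingleton.elim _ _
    rw [h7, sub_zero] at h5
    refine h5.unique ?_
    convert h6 using 1
    funext n
    exact (dividedSeries_apply_sub p P n (x - a)).symm

end Division

/-! ### Functions vanishing to infinite order -/

/-- By induction on the degree, once the lower Taylor terms vanish, the homogeneous term of degree k
is O(‖y‖^(k+1)) and hence zero. -/
theorem _root_.AnalyticAt.eventually_eq_zero_of_isBigO {𝕜 E F : Type*} [RCLike 𝕜]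
    [NormedAddCommGroup E] [NormedSpace 𝕜 E] [NormedAddCommGroup F] [NormedSpace 𝕜 F]
    {f : E → F} {a : E} (hf : AnalyticAt 𝕜 f a)
    (h : ∀ m : ℕ, f =O[𝓝 a] fun x => ‖x - a‖ ^ m) : ∀ᶠ x in 𝓝 a, f x = 0 := by
  obtain ⟨p, hp⟩ := hf
  have hs : Tendsto (fun y => a + y) (𝓝 0) (𝓝 a) := by
    have : Tendsto (fun y => a + y) (𝓝 0) (𝓝 (a + 0)) :=
      (continuous_const.add continuous_id).tendsto 0
    rwa [add_zero] at this
  have hz : ∀ n : ℕ, ∀ y : E, (p n fun _ => y) = 0 := by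
    intro n
    refine Nat.strong_induction_on n fun k hk => ?_
    have psum_eq : p.partialSum (k + 1) = fun y => p k fun _ => y := by
      funext z
      refine Finset.sum_eq_single _ (fun b hb hnb => ?_) fun hn => ?_
      · have := Finset.mem_range_succ_iff.mp hb
        simp only [hk b (this.lt_of_ne hnb)]
      · exact False.elim (hn (Finset.mem_range.mpr (lt_add_one k)))
    have h1 := hp.isBigO_sub_partialSum_pow (k + 1)
    have h2 := (h (k + 1)).comp_tendsto hs
    have h3 := h2.sub (h1.congr_right fun y => by
      simp only [Function.comp_apply, add_sub_cancel_left])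
    simp only [psum_eq, Function.comp_def, sub_sub_cancel, add_sub_cancel_left] at h3
    exact h3.continuousMultilinearMap_apply_eq_zero
  have hs' : Tendsto (fun x => x - a) (𝓝 a) (𝓝 0) := by
    have : Tendsto (fun x => x - a) (𝓝 a) (𝓝 (a - a)) :=
      (continuous_id.sub continuous_const).tendsto a
    rwa [sub_self] at this
  filter_upwards [hs'.eventually hp.eventually_hasSum] with x hx
  rw [add_sub_cancel] at hx
  simp only [hz] at hx
  exact hx.unique hasSum_zero

end GaussMap

end

noncomputable section

namespace GaussMap

open Filter Asymptotics KSpace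

/-! ### Germs of analytic functions -/

section Germs

variable {𝕜 : Type u} [RCLike 𝕜] {N : ℕ}

/-- The coordinates of a point of the analytic space `𝕜^N`. -/
def coords (x : (analyticAffineSpace 𝕜 N).Point) : EuclideanSpace 𝕜 (Fin N) := x

theorem eventually_coords {a : (analyticAffineSpace 𝕜 N).Point}
    {p : EuclideanSpace 𝕜 (Fin N) → Prop} :
    (∀ᶠ y in 𝓝 (coords a), p y) ↔ ∀ᶠ y in 𝓝 a, p (coords y) := Iff.rfl

/-- The open set on which a function is analytic. -/
def analyticSet (f : EuclideanSpace 𝕜 (Fin N) → 𝕜) : Opens (analyticAffineSpace 𝕜 N).Point :=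
  ⟨{x | AnalyticAt 𝕜 f (coords x)}, isOpen_analyticAt 𝕜 f⟩

/-- A function, as a section of the structure sheaf on the open set on which it is analytic. -/
def analyticSection (f : EuclideanSpace 𝕜 (Fin N) → 𝕜) :
    (analyticAffineSpace 𝕜 N).Sections (analyticSet f) :=
  (⟨fun x => f (coords x.1), fun x => ⟨f, x.2, .of_forall fun _ _ => rfl⟩⟩ :
    analyticSubring 𝕜 N (analyticSet f))

/-- The germs of a function at the points at which it is analytic. -/
def germField (f : EuclideanSpace 𝕜 (Fin N) → 𝕜) : (analyticAffineSpace 𝕜 N).GermField :=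
  extend (analyticSection f)

/-- The values of a section of the structure sheaf. -/
def sectionVal {U : Opens (analyticAffineSpace 𝕜 N).Point}
    (s : (analyticAffineSpace 𝕜 N).Sections U) : U → 𝕜 :=
  Subtype.val (p := fun f => f ∈ analyticSubring 𝕜 N U) s

variable {f g : EuclideanSpace 𝕜 (Fin N) → 𝕜} {a : (analyticAffineSpace 𝕜 N).Point}

theorem eventually_analyticAt (hf : AnalyticAt 𝕜 f (coords a)) :
    ∀ᶠ y in 𝓝 a, AnalyticAt 𝕜 f (coords y) := hf.eventually_analyticAt

theorem germField_mem (hf : AnalyticAt 𝕜 f (coords a)) :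
    germField f ∈ (analyticAffineSpace 𝕜 N).regularAt a :=
  extend_mem (analyticSection f) hf

theorem germField_apply (hf : AnalyticAt 𝕜 f (coords a)) : germField f a =
    (analyticAffineSpace 𝕜 N).germ (analyticSet f) a hf (analyticSection f) :=
  extend_apply _ hf

theorem germ_eq_germField (hf : AnalyticAt 𝕜 f (coords a))
    {U : Opens (analyticAffineSpace 𝕜 N).Point}
    (ha : a ∈ U) (s : (analyticAffineSpace 𝕜 N).Sections U)
    (h : ∀ᶠ y in 𝓝 a, ∀ hy : y ∈ U, sectionVal s ⟨y, hy⟩ = f (coords y)) :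
    (analyticAffineSpace 𝕜 N).germ U a ha s = germField f a := by
  obtain ⟨V, hV, hVo, haV⟩ := eventually_nhds_iff.mp h
  let W : Opens (analyticAffineSpace 𝕜 N).Point := U ⊓ analyticSet f ⊓ ⟨V, hVo⟩
  have hW : a ∈ W := ⟨⟨ha, hf⟩, haV⟩
  have h1 : W ≤ U := inf_le_left.trans inf_le_left
  have h2 : W ≤ analyticSet f := inf_le_left.trans inf_le_right
  have key : (analyticAffineSpace 𝕜 N).res h1 s =
      (analyticAffineSpace 𝕜 N).res h2 (analyticSection f) := by
    refine Subtype.ext (funext fun y => ?_)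
    exact hV y.1 y.2.2 (h1 y.2)
  rw [← (analyticAffineSpace 𝕜 N).germ_res h1 a hW, key, germ_res, germField_apply hf]

theorem eventually_eq_of_germField_eq (hf : AnalyticAt 𝕜 f (coords a))
    (hg : AnalyticAt 𝕜 g (coords a)) (h : germField f a = germField g a) :
    ∀ᶠ y in 𝓝 a, f (coords y) = g (coords y) := by
  rw [germField_apply hf, germField_apply hg] at h
  obtain ⟨W, hW, h₁, h₂, e⟩ := exists_res_eq _ _ _ h
  filter_upwards [W.isOpen.mem_nhds hW] with y hy
  exact congrFun (congrArg sectionVal e) ⟨y, hy⟩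

theorem germField_congr (hf : AnalyticAt 𝕜 f (coords a))
    (h : ∀ᶠ y in 𝓝 a, f (coords y) = g (coords y)) : germField f a = germField g a := by
  have hg : AnalyticAt 𝕜 g (coords a) := hf.congr h
  rw [germField_apply hf]
  refine germ_eq_germField hg _ _ ?_
  filter_upwards [h] with y hy _
  exact hy

theorem exists_germField_eq {F : (analyticAffineSpace 𝕜 N).GermField}
    (hF : F ∈ (analyticAffineSpace 𝕜 N).regularAt a) :
    ∃ f : EuclideanSpace 𝕜 (Fin N) → 𝕜, AnalyticAt 𝕜 f (coords a) ∧
      ∀ᶠ y in 𝓝 a, F y = germField f y := by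
  classical
  obtain ⟨U, s, hU, hs⟩ := hF
  let f : (analyticAffineSpace 𝕜 N).Point → 𝕜 :=
    fun y => if hy : y ∈ U then sectionVal s ⟨y, hy⟩ else 0
  let f' : EuclideanSpace 𝕜 (Fin N) → 𝕜 := f
  have hfs : ∀ y (hy : y ∈ U), f' (coords y) = sectionVal s ⟨y, hy⟩ := fun y hy => dif_pos hy
  have hf : ∀ y ∈ U, AnalyticAt 𝕜 f' (coords y) := by
    intro y hy
    obtain ⟨g, hg, h⟩ := (show sectionVal s ∈ analyticSubring 𝕜 N U from
      Subtype.prop (p := fun f => f ∈ analyticSubring 𝕜 N U) s) ⟨y, hy⟩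
    refine AnalyticAt.congr (f := g) hg (eventually_coords.mpr ?_)
    have h' : ∀ᶠ z in 𝓝 y, ∀ hz : z ∈ U, sectionVal s ⟨z, hz⟩ = g (coords z) := h
    filter_upwards [h', U.isOpen.mem_nhds hy] with z hz hzU
    rw [hfs z hzU, hz hzU]
  refine ⟨f', hf a hU, ?_⟩
  filter_upwards [U.isOpen.mem_nhds hU] with y hy
  rw [hs y hy]
  exact germ_eq_germField (hf y hy) hy s (.of_forall fun z hz => (hfs z hz).symm)

theorem exists_eq_germField (s : (analyticAffineSpace 𝕜 N).Stalk a) :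
    ∃ f : EuclideanSpace 𝕜 (Fin N) → 𝕜, AnalyticAt 𝕜 f (coords a) ∧ s = germField f a := by
  obtain ⟨F, hF, rfl⟩ := exists_regularAt s
  obtain ⟨f, hf, h⟩ := exists_germField_eq hF
  exact ⟨f, hf, h.self_of_nhds⟩

theorem germField_add (hf : AnalyticAt 𝕜 f (coords a)) (hg : AnalyticAt 𝕜 g (coords a)) :
    germField (fun x => f x + g x) a = germField f a + germField g a := by
  rw [germField_apply hf, germField_apply hg,
    ← (analyticAffineSpace 𝕜 N).germ_res (inf_le_left : analyticSet f ⊓ analyticSet g ≤ _) a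
      ⟨hf, hg⟩,
    ← (analyticAffineSpace 𝕜 N).germ_res (inf_le_right : analyticSet f ⊓ analyticSet g ≤ _) a
      ⟨hf, hg⟩, ← map_add]
  exact (germ_eq_germField (hf.add hg) _ _ (.of_forall fun y hy => rfl)).symm

theorem germField_mul (hf : AnalyticAt 𝕜 f (coords a)) (hg : AnalyticAt 𝕜 g (coords a)) :
    germField (fun x => f x * g x) a = germField f a * germField g a := by
  rw [germField_apply hf, germField_apply hg,
    ← (analyticAffineSpace 𝕜 N).germ_res (inf_le_left : analyticSet f ⊓ analyticSet g ≤ _) a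
      ⟨hf, hg⟩,
    ← (analyticAffineSpace 𝕜 N).germ_res (inf_le_right : analyticSet f ⊓ analyticSet g ≤ _) a
      ⟨hf, hg⟩, ← map_mul]
  exact (germ_eq_germField (hf.mul hg) _ _ (.of_forall fun y hy => rfl)).symm

variable (a) in
theorem germField_const (c : 𝕜) : germField (fun _ => c) a =
    algebraMap 𝕜 ((analyticAffineSpace 𝕜 N).Stalk a) c :=
  (germ_eq_germField (U := ⊤) analyticAt_const trivial ((analyticAffineSpace 𝕜 N).scalars c)
    (.of_forall fun _ _ => rfl)).symm

theorem germField_sum {ι : Type*} (s : Finset ι) {f : ι → EuclideanSpace 𝕜 (Fin N) → 𝕜}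
    (hf : ∀ i ∈ s, AnalyticAt 𝕜 (f i) (coords a)) :
    germField (fun x => ∑ i ∈ s, f i x) a = ∑ i ∈ s, germField (f i) a := by
  classical
  induction s using Finset.induction_on with
  | empty => simpa using germField_const a (0 : 𝕜)
  | insert i s hi ih =>
    simp only [Finset.sum_insert hi]
    rw [germField_add (hf i (Finset.mem_insert_self i s))
      (Finset.analyticAt_fun_sum s fun j hj => hf j (Finset.mem_insert_of_mem hj)),
      ih fun j hj => hf j (Finset.mem_insert_of_mem hj)]

theorem isUnit_germField_iff (hf : AnalyticAt 𝕜 f (coords a)) :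
    IsUnit (germField f a) ↔ f (coords a) ≠ 0 := by
  constructor
  · intro h h0
    obtain ⟨t, ht⟩ := h.exists_right_inv
    obtain ⟨g, hg, rfl⟩ := exists_eq_germField t
    rw [← germField_mul hf hg, ← map_one (algebraMap 𝕜 _), ← germField_const] at ht
    have : f (coords a) * g (coords a) = 1 :=
      (eventually_eq_of_germField_eq (hf.mul hg) analyticAt_const ht).self_of_nhds
    rw [h0, zero_mul] at this
    exact zero_ne_one this
  · intro h
    rw [germField_apply hf]
    exact analyticPresheaf_isUnit 𝕜 N a (analyticSet f) hf (analyticSection f) h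

theorem eval_germField_eq_zero_iff (hf : AnalyticAt 𝕜 f (coords a)) :
    (analyticAffineSpace 𝕜 N).eval a (germField f a) = 0 ↔ f (coords a) = 0 := by
  rw [eval_eq_zero_iff, isUnit_germField_iff hf, not_not]

theorem germField_eq_zero (hf : AnalyticAt 𝕜 f (coords a))
    (h : ∀ᶠ y in 𝓝 a, f (coords y) = 0) : germField f a = 0 := by
  rw [germField_congr (g := fun _ => 0) hf h, germField_const, map_zero]

end Germs

end GaussMap

end

noncomputable section

namespace GaussMap

open Filter Asymptotics KSpace

/-! ### The cotangent spaces of `𝕜^N` -/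

section Partial

variable {𝕜 : Type u} [RCLike 𝕜] {N : ℕ}

/-- The partial derivatives of a function on `𝕜^N`. -/
def partialDeriv (i : Fin N) (f : EuclideanSpace 𝕜 (Fin N) → 𝕜) : EuclideanSpace 𝕜 (Fin N) → 𝕜 :=
  fun y => fderiv 𝕜 f y (EuclideanSpace.single i 1)

variable {f g : EuclideanSpace 𝕜 (Fin N) → 𝕜} {a : (analyticAffineSpace 𝕜 N).Point}

theorem _root_.AnalyticAt.clm_apply_const {E F G : Type*} [NormedAddCommGroup E] [NormedSpace 𝕜 E]
    [NormedAddCommGroup F] [NormedSpace 𝕜 F] [NormedAddCommGroup G] [NormedSpace 𝕜 G]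
    {c : E → F →L[𝕜] G} {x : E} (hc : AnalyticAt 𝕜 c x) (v : F) :
    AnalyticAt 𝕜 (fun y => c y v) x :=
  ((ContinuousLinearMap.apply 𝕜 G v).analyticAt (c x)).comp hc

theorem germField_congr_coords (hf : AnalyticAt 𝕜 f (coords a))
    (h : ∀ᶠ x in 𝓝 (coords a), f x = g x) : germField f a = germField g a :=
  germField_congr hf h

theorem analyticAt_partialDeriv {x : EuclideanSpace 𝕜 (Fin N)} (hf : AnalyticAt 𝕜 f x)
    (i : Fin N) : AnalyticAt 𝕜 (partialDeriv i f) x :=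
  AnalyticAt.clm_apply_const hf.fderiv _

theorem analyticAt_coord (i : Fin N) (x : EuclideanSpace 𝕜 (Fin N)) :
    AnalyticAt 𝕜 (fun y : EuclideanSpace 𝕜 (Fin N) => y i) x :=
  (EuclideanSpace.proj (𝕜 := 𝕜) i).analyticAt x

/-- This makes `stalkDeriv` independent of the representative chosen in its definition. -/
theorem germField_partialDeriv_congr (i : Fin N) (hf : AnalyticAt 𝕜 f (coords a))
    (hg : AnalyticAt 𝕜 g (coords a)) (h : germField f a = germField g a) :
    germField (partialDeriv i f) a = germField (partialDeriv i g) a := by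
  refine germField_congr_coords (analyticAt_partialDeriv hf i) ?_
  have h' : f =ᶠ[𝓝 (coords a)] g := eventually_coords.mpr (eventually_eq_of_germField_eq hf hg h)
  filter_upwards [h'.fderiv (𝕜 := 𝕜)] with y hy
  simp only [partialDeriv, hy]

variable (a) in
/-- The partial derivatives, on germs. -/
def stalkDeriv (i : Fin N) (s : (analyticAffineSpace 𝕜 N).Stalk a) :
    (analyticAffineSpace 𝕜 N).Stalk a :=
  germField (partialDeriv i (exists_eq_germField s).choose) a

theorem stalkDeriv_germField (i : Fin N) (hf : AnalyticAt 𝕜 f (coords a)) :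
    stalkDeriv a i (germField f a) = germField (partialDeriv i f) a :=
  have h := (exists_eq_germField (germField f a)).choose_spec
  germField_partialDeriv_congr i h.1 hf h.2.symm

theorem stalkDeriv_add (i : Fin N) (s t : (analyticAffineSpace 𝕜 N).Stalk a) :
    stalkDeriv a i (s + t) = stalkDeriv a i s + stalkDeriv a i t := by
  obtain ⟨f, hf, rfl⟩ := exists_eq_germField s
  obtain ⟨g, hg, rfl⟩ := exists_eq_germField t
  rw [← germField_add hf hg, stalkDeriv_germField i (hf.fun_add hg), stalkDeriv_germField i hf,
    stalkDeriv_germField i hg,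
    ← germField_add (analyticAt_partialDeriv hf i) (analyticAt_partialDeriv hg i)]
  refine germField_congr (analyticAt_partialDeriv (hf.fun_add hg) i) ?_
  filter_upwards [eventually_analyticAt hf, eventually_analyticAt hg] with y h h'
  simp only [partialDeriv]
  rw [fderiv_fun_add h.differentiableAt h'.differentiableAt, add_apply]

theorem stalkDeriv_mul (i : Fin N) (s t : (analyticAffineSpace 𝕜 N).Stalk a) :
    stalkDeriv a i (s * t) = s * stalkDeriv a i t + t * stalkDeriv a i s := by
  obtain ⟨f, hf, rfl⟩ := exists_eq_germField s
  obtain ⟨g, hg, rfl⟩ := exists_eq_germField t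
  have hf' := analyticAt_partialDeriv hf i
  have hg' := analyticAt_partialDeriv hg i
  rw [← germField_mul hf hg, stalkDeriv_germField i (hf.fun_mul hg), stalkDeriv_germField i hf,
    stalkDeriv_germField i hg, ← germField_mul hf hg', ← germField_mul hg hf',
    ← germField_add (hf.fun_mul hg') (hg.fun_mul hf')]
  refine germField_congr (analyticAt_partialDeriv (hf.fun_mul hg) i) ?_
  filter_upwards [eventually_analyticAt hf, eventually_analyticAt hg] with y h h'
  simp only [partialDeriv]
  rw [fderiv_fun_mul h.differentiableAt h'.differentiableAt]
  rfl

theorem stalkDeriv_algebraMap (i : Fin N) (c : 𝕜) :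
    stalkDeriv a i (algebraMap 𝕜 _ c) = 0 := by
  rw [← germField_const, stalkDeriv_germField i analyticAt_const]
  refine germField_eq_zero (analyticAt_partialDeriv analyticAt_const i) (.of_forall fun y => ?_)
  simp [partialDeriv]

/-- The coordinate functions of `𝕜^N`. -/
def coordField (𝕜 : Type u) [RCLike 𝕜] {N : ℕ} (i : Fin N) :
    (analyticAffineSpace 𝕜 N).GermField :=
  germField fun y => y i

theorem stalkDeriv_coordField (i j : Fin N) :
    stalkDeriv a i (coordField 𝕜 j a) = if i = j then 1 else 0 := by
  have h : ∀ y, partialDeriv i (fun y : EuclideanSpace 𝕜 (Fin N) => y j) y =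
      if i = j then 1 else 0 := by
    intro y
    have : fderiv 𝕜 (fun y : EuclideanSpace 𝕜 (Fin N) => y j) y = EuclideanSpace.proj j :=
      (EuclideanSpace.proj (𝕜 := 𝕜) j).hasFDerivAt.fderiv
    simp [partialDeriv, this, eq_comm]
  rw [coordField, stalkDeriv_germField i (analyticAt_coord j _),
    germField_congr_coords (g := fun _ => if i = j then 1 else 0)
      (analyticAt_partialDeriv (analyticAt_coord j _) i) (.of_forall h), germField_const]
  split_ifs <;> simp

theorem coordField_sub_mem (i : Fin N) : coordField 𝕜 i a - algebraMap 𝕜 _ (coords a i) ∈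
    IsLocalRing.maximalIdeal ((analyticAffineSpace 𝕜 N).Stalk a) := by
  have h : AnalyticAt 𝕜 (fun y : EuclideanSpace 𝕜 (Fin N) => y i + -coords a i) (coords a) :=
    (analyticAt_coord i _).fun_add analyticAt_const
  rw [sub_eq_add_neg, ← map_neg, ← germField_const, coordField,
    ← germField_add (analyticAt_coord i _) analyticAt_const, IsLocalRing.mem_maximalIdeal,
    mem_nonunits_iff, isUnit_germField_iff h, not_not, add_neg_cancel]

/-- Hadamard's lemma. -/
theorem exists_eq_sum_coordField (s : (analyticAffineSpace 𝕜 N).Stalk a) :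
    ∃ (c : 𝕜) (g : Fin N → (analyticAffineSpace 𝕜 N).Stalk a),
      s = algebraMap 𝕜 _ c + ∑ i, (coordField 𝕜 i a - algebraMap 𝕜 _ (coords a i)) * g i := by
  obtain ⟨f, hf, rfl⟩ := exists_eq_germField s
  -- With P = 0 this reads f(x) - f(a) = G(x)(x - a); the cofactors are the values of G(x) on the
  -- standard basis.
  obtain ⟨G, hG, h⟩ := hf.exists_divided 0
  have hGi : ∀ i : Fin N, AnalyticAt 𝕜 (fun x => G x (EuclideanSpace.single i 1)) (coords a) :=
    fun i => AnalyticAt.clm_apply_const hG _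
  have hc : ∀ i : Fin N, AnalyticAt 𝕜
      (fun y : EuclideanSpace 𝕜 (Fin N) => y i + -coords a i) (coords a) :=
    fun i => (analyticAt_coord i _).fun_add analyticAt_const
  refine ⟨f (coords a), fun i => germField (fun x => G x (EuclideanSpace.single i 1)) a, ?_⟩
  have e : ∀ i, coordField 𝕜 i a - algebraMap 𝕜 _ (coords a i) =
      germField (fun y : EuclideanSpace 𝕜 (Fin N) => y i + -coords a i) a := fun i => by
    rw [germField_add (analyticAt_coord i _) analyticAt_const, germField_const, map_neg,
      ← sub_eq_add_neg, coordField]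
  simp only [e]
  simp only [← germField_mul (hc _) (hGi _)]
  rw [← germField_sum _ fun i _ => (hc i).fun_mul (hGi i), ← germField_const,
    ← germField_add analyticAt_const
      (Finset.analyticAt_fun_sum _ fun i _ => (hc i).fun_mul (hGi i))]
  refine germField_congr_coords hf ?_
  filter_upwards [h] with x hx
  simp only [zero_apply, add_zero, sub_zero] at hx
  rw [← sub_eq_iff_eq_add', hx]
  conv_lhs => rw [← (EuclideanSpace.basisFun (Fin N) 𝕜).sum_repr (x - coords a)]
  simp [sub_eq_add_neg]

/-- The difference δ of the two sides is a derivation killing constants and coordinates. Hadamard's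
lemma gives δ(s) = ∑ (x_i - a_i) δ(g_i), so iteration places δ(s) in 𝔪^k Ω for all k, and the
separated module leaves only zero. -/
theorem d_eq_sum_coordField (s : (analyticAffineSpace 𝕜 N).Stalk a) :
    (analyticAffineSpace 𝕜 N).d a s =
      ∑ i, stalkDeriv a i s • (analyticAffineSpace 𝕜 N).d a (coordField 𝕜 i a) := by
  let δ : (analyticAffineSpace 𝕜 N).Stalk a →+ (analyticAffineSpace 𝕜 N).Cotangent a := AddMonoidHom.mk'
    (fun s => (analyticAffineSpace 𝕜 N).d a s - ∑ i, stalkDeriv a i s • (analyticAffineSpace 𝕜 N).d a (coordField 𝕜 i a)) fun s t => by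
      simp only [d_add, stalkDeriv_add, add_smul, Finset.sum_add_distrib]
      abel
  have hmul : ∀ s t, δ (s * t) = s • δ t + t • δ s := by
    intro s t
    change (analyticAffineSpace 𝕜 N).d a (s * t) - ∑ i, stalkDeriv a i (s * t) • (analyticAffineSpace 𝕜 N).d a (coordField 𝕜 i a) =
      s • ((analyticAffineSpace 𝕜 N).d a t - ∑ i, stalkDeriv a i t • (analyticAffineSpace 𝕜 N).d a (coordField 𝕜 i a)) +
      t • ((analyticAffineSpace 𝕜 N).d a s - ∑ i, stalkDeriv a i s • (analyticAffineSpace 𝕜 N).d a (coordField 𝕜 i a))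
    simp only [d_mul, stalkDeriv_mul, add_smul, mul_smul, Finset.sum_add_distrib, smul_sub,
      Finset.smul_sum]
    abel
  have hconst : ∀ c : 𝕜, δ (algebraMap 𝕜 _ c) = 0 := by
    intro c
    change (analyticAffineSpace 𝕜 N).d a _ - ∑ i, stalkDeriv a i _ • (analyticAffineSpace 𝕜 N).d a (coordField 𝕜 i a) = 0
    simp [d_algebraMap, stalkDeriv_algebraMap]
  have hcoord : ∀ j, δ (coordField 𝕜 j a) = 0 := by
    intro j
    change (analyticAffineSpace 𝕜 N).d a _ - ∑ i, stalkDeriv a i _ • (analyticAffineSpace 𝕜 N).d a (coordField 𝕜 i a) = 0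
    simp [stalkDeriv_coordField, ite_smul]
  have key : ∀ (k : ℕ) (s : (analyticAffineSpace 𝕜 N).Stalk a), δ s ∈ IsLocalRing.maximalIdeal ((analyticAffineSpace 𝕜 N).Stalk a) ^ k •
      (⊤ : Submodule ((analyticAffineSpace 𝕜 N).Stalk a) ((analyticAffineSpace 𝕜 N).Cotangent a)) := by
    intro k
    induction k with
    | zero => intro s; simp
    | succ k ih =>
      intro s
      obtain ⟨c, g, rfl⟩ := exists_eq_sum_coordField s
      rw [map_add, hconst, zero_add, map_sum]
      refine Submodule.sum_mem _ fun i _ => ?_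
      rw [hmul, map_sub, hcoord, hconst, sub_zero, smul_zero, add_zero, pow_succ', mul_smul]
      exact Submodule.smul_mem_smul (coordField_sub_mem i) (ih (g i))
  have h0 : δ s ∈ (⊥ : Submodule ((analyticAffineSpace 𝕜 N).Stalk a) ((analyticAffineSpace 𝕜 N).Cotangent a)) := by
    rw [← (analyticAffineSpace 𝕜 N).cotangent_separated a, Submodule.mem_iInf]
    exact fun k => key k s
  exact sub_eq_zero.mp ((Submodule.mem_bot _).mp h0)

theorem exists_isBigO_of_mem_pow (k : ℕ) {s : (analyticAffineSpace 𝕜 N).Stalk a}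
    (hs : s ∈ IsLocalRing.maximalIdeal ((analyticAffineSpace 𝕜 N).Stalk a) ^ k) :
    ∃ f : EuclideanSpace 𝕜 (Fin N) → 𝕜, AnalyticAt 𝕜 f (coords a) ∧ s = germField f a ∧
      f =O[𝓝 (coords a)] fun x => ‖x - coords a‖ ^ k := by
  induction k generalizing s with
  | zero =>
    obtain ⟨f, hf, rfl⟩ := exists_eq_germField s
    refine ⟨f, hf, rfl, ?_⟩
    simpa using hf.continuousAt.tendsto.isBigO_one ℝ
  | succ k ih =>
    rw [pow_succ] at hs
    refine Submodule.mul_induction_on hs (fun r hr t ht => ?_) ?_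
    · obtain ⟨f, hf, rfl, hfO⟩ := ih hr
      obtain ⟨g, hg, rfl⟩ := exists_eq_germField t
      rw [IsLocalRing.mem_maximalIdeal, mem_nonunits_iff, isUnit_germField_iff hg, not_not] at ht
      refine ⟨fun x => f x * g x, hf.fun_mul hg, (germField_mul hf hg).symm, ?_⟩
      simp only [pow_succ]
      refine hfO.mul ?_
      have := hg.differentiableAt.hasFDerivAt.isBigO_sub.norm_right
      simpa [ht] using this
    · rintro _ _ ⟨f, hf, rfl, hfO⟩ ⟨g, hg, rfl, hgO⟩
      exact ⟨_, hf.fun_add hg, (germField_add hf hg).symm, hfO.add hgO⟩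

variable (a) in
-- A germ in all powers of 𝔪 vanishes to infinite order, so its Taylor series is zero. No Noetherian
-- property of the stalk is invoked.
theorem iInf_maximalIdeal_pow_eq_bot :
    ⨅ k : ℕ, IsLocalRing.maximalIdeal ((analyticAffineSpace 𝕜 N).Stalk a) ^ k = ⊥ := by
  rw [eq_bot_iff]
  intro s hs
  obtain ⟨f, hf, rfl⟩ := exists_eq_germField s
  refine germField_eq_zero hf (eventually_coords.mp (hf.eventually_eq_zero_of_isBigO fun k => ?_))
  obtain ⟨g, hg, e, h⟩ := exists_isBigO_of_mem_pow k ((Submodule.mem_iInf _).mp hs k)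
  have : f =ᶠ[𝓝 (coords a)] g := eventually_coords.mpr (eventually_eq_of_germField_eq hf hg e)
  exact this.trans_isBigO h

variable (a) in
-- Since the stalk is separated, the partial derivatives factor through the cotangent space and form
-- the family dual to the dx_i. This gives independence.
theorem isCoordinatesAt_coordField :
    IsCoordinatesAt (X := analyticAffineSpace 𝕜 N) (coordField 𝕜) a := by
  let X := analyticAffineSpace 𝕜 N
  have hT : ∀ i : Fin N, ∃ T : X.Cotangent a →ₛₗ[RingHom.id (X.Stalk a)] X.Stalk a,
      ∀ s, T (X.d a s) = stalkDeriv a i s := fun i =>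
    exists_cotangent_lift (RingHom.id _) (stalkDeriv a i) (stalkDeriv_add i)
      (stalkDeriv_algebraMap i) (stalkDeriv_mul i) (by
        simpa [Ideal.map_id] using iInf_maximalIdeal_pow_eq_bot a)
  choose T hT using hT
  have hli : LinearIndependent (X.Stalk a) fun i : Fin N => X.d a (coordField 𝕜 i a) := by
    rw [Fintype.linearIndependent_iff]
    intro g hg i
    have := congrArg (T i) hg
    simpa [map_sum, hT, stalkDeriv_coordField] using this
  have hsp : ⊤ ≤ Submodule.span (X.Stalk a)
      (Set.range fun i : Fin N => X.d a (coordField 𝕜 i a)) := by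
    rw [← span_range_d, Submodule.span_le]
    rintro _ ⟨s, rfl⟩
    rw [d_eq_sum_coordField]
    exact Submodule.sum_mem _ fun i _ => Submodule.smul_mem _ _ (Submodule.subset_span ⟨i, rfl⟩)
  exact ⟨Module.Basis.mk hli hsp, fun i => Module.Basis.mk_apply hli hsp i⟩

end Partial

/-! ### Division by the equation of a smooth hypersurface -/

section Division

variable {𝕜 : Type u} [RCLike 𝕜] {N : ℕ}

/-- The Jacobian of the change of coordinates that replaces the `i`-th coordinate by a function with
differential `L`. -/
theorem exists_replaceCoord (L : EuclideanSpace 𝕜 (Fin N) →L[𝕜] 𝕜) (i : Fin N)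
    (hL : L (EuclideanSpace.single i 1) ≠ 0) :
    ∃ e : EuclideanSpace 𝕜 (Fin N) ≃L[𝕜] EuclideanSpace 𝕜 (Fin N),
      (e : EuclideanSpace 𝕜 (Fin N) →L[𝕜] EuclideanSpace 𝕜 (Fin N)) =
        ContinuousLinearMap.id 𝕜 _ +
          (L - EuclideanSpace.proj i).smulRight (EuclideanSpace.single i (1 : 𝕜)) := by
  set A : EuclideanSpace 𝕜 (Fin N) →L[𝕜] EuclideanSpace 𝕜 (Fin N) := ContinuousLinearMap.id 𝕜 _ +
    (L - EuclideanSpace.proj i).smulRight (EuclideanSpace.single i (1 : 𝕜))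
  have hA : ∀ v, A v = v + (L v - v i) • EuclideanSpace.single i (1 : 𝕜) := fun v => rfl
  -- The i-th coordinate of A v is L v. If A v = 0 then v is a multiple of e_i with L v = 0, hence
  -- zero as L e_i ≠ 0.
  have hinj : Function.Injective A.toLinearMap := by
    rw [injective_iff_map_eq_zero]
    intro v hv
    have hv' : v + (L v - v i) • EuclideanSpace.single i (1 : 𝕜) = 0 := hv
    have h1 : L v = 0 := by
      have := congrArg (fun w : EuclideanSpace 𝕜 (Fin N) => w i) hv'
      simpa using this
    rw [h1, zero_sub, neg_smul, ← sub_eq_add_neg, sub_eq_zero] at hv'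
    have h2 := h1
    rw [hv', map_smul, smul_eq_mul, mul_eq_zero, or_iff_left hL] at h2
    rw [hv', h2, zero_smul]
  refine ⟨(LinearEquiv.ofInjectiveEndo A.toLinearMap hinj).toContinuousLinearEquiv, ?_⟩
  ext v
  rfl

/-- Since ∂f/∂x_i ≠ 0, the inverse function theorem makes f a coordinate up to a constant; a
function vanishing on a coordinate hyperplane is then divided by that coordinate. -/
theorem _root_.AnalyticAt.exists_eq_mul_of_eq_zero {f h : EuclideanSpace 𝕜 (Fin N) → 𝕜}
    {α : EuclideanSpace 𝕜 (Fin N)} (hf : AnalyticAt 𝕜 f α) (hh : AnalyticAt 𝕜 h α)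
    (h0 : f α = 0) {i : Fin N} (hi : partialDeriv i f α ≠ 0)
    (hz : ∀ᶠ x in 𝓝 α, f x = 0 → h x = 0) :
    ∃ g : EuclideanSpace 𝕜 (Fin N) → 𝕜, AnalyticAt 𝕜 g α ∧ ∀ᶠ x in 𝓝 α, h x = f x * g x := by
  let e : EuclideanSpace 𝕜 (Fin N) := EuclideanSpace.single i 1
  -- The i-th coordinate is replaced by f(x) + α_i. The shift by α_i makes Ψ fix α.
  let Ψ : EuclideanSpace 𝕜 (Fin N) → EuclideanSpace 𝕜 (Fin N) :=
    fun x => x + (f x - (x i - α i)) • e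
  have hΨα : Ψ α = α := by simp [Ψ, h0]
  have hΨi : ∀ x, Ψ x i = f x + α i := fun x => by simp [Ψ, e]; ring
  have hΨ : AnalyticAt 𝕜 Ψ α := analyticAt_id.fun_add
    ((hf.fun_sub ((analyticAt_coord i α).fun_sub analyticAt_const)).fun_smul analyticAt_const)
  obtain ⟨A, hA⟩ := exists_replaceCoord (fderiv 𝕜 f α) i hi
  have hder : HasFDerivAt Ψ (A : EuclideanSpace 𝕜 (Fin N) →L[𝕜] EuclideanSpace 𝕜 (Fin N)) α := by
    rw [hA]
    exact (hasFDerivAt_id α).fun_add ((hf.differentiableAt.hasFDerivAt.fun_sub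
      ((EuclideanSpace.proj (𝕜 := 𝕜) i).hasFDerivAt.sub_const (α i))).smul_const e)
  have hstrict : HasStrictFDerivAt Ψ
      (A : EuclideanSpace 𝕜 (Fin N) →L[𝕜] EuclideanSpace 𝕜 (Fin N)) α := by
    rw [← hder.fderiv]
    exact hΨ.hasStrictFDerivAt
  let Φ := hstrict.toOpenPartialHomeomorph Ψ
  have hΦ : ∀ x, Φ x = Ψ x := fun x => rfl
  have hα : α ∈ Φ.source := hstrict.mem_toOpenPartialHomeomorph_source
  have hα' : α ∈ Φ.target := by
    have := Φ.map_source hα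
    rwa [hΦ, hΨα] at this
  have hΘα : Φ.symm α = α := by
    have := Φ.left_inv hα
    rwa [hΦ, hΨα] at this
  have hΘ : AnalyticAt 𝕜 Φ.symm α := by
    have := Φ.analyticAt_symm' (i := A) hα hΨ hder.fderiv
    rwa [hΦ, hΨα] at this
  have hu : AnalyticAt 𝕜 (fun y => h (Φ.symm y)) α := by
    refine AnalyticAt.comp (g := h) ?_ hΘ
    rwa [hΘα]
  have huz : ∀ᶠ y in 𝓝 α, y i = α i → h (Φ.symm y) = 0 := by
    have h1 : Tendsto Φ.symm (𝓝 α) (𝓝 α) := by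
      have := hΘ.continuousAt.tendsto
      rwa [hΘα] at this
    filter_upwards [h1.eventually hz, Φ.open_target.mem_nhds hα'] with y hy hyt hyi
    refine hy ?_
    have h2 := hΨi (Φ.symm y)
    rw [← hΦ, Φ.right_inv hyt, hyi] at h2
    exact right_eq_add.mp h2
  -- The projection along e_i: α + P(x - α) lies on the hyperplane where the straightened h
  -- vanishes, so the divided difference is the function itself.
  let P : EuclideanSpace 𝕜 (Fin N) →L[𝕜] EuclideanSpace 𝕜 (Fin N) :=
    ContinuousLinearMap.id 𝕜 _ - (EuclideanSpace.proj (𝕜 := 𝕜) i).smulRight e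
  have hP : ∀ v, P v = v - v i • e := fun v => rfl
  obtain ⟨G, hG, hGu⟩ := hu.exists_divided P
  have hPz : ∀ᶠ x in 𝓝 α, h (Φ.symm (α + P (x - α))) = 0 := by
    have h1 : Tendsto (fun x => α + P (x - α)) (𝓝 α) (𝓝 α) := by
      have : Continuous fun x => α + P (x - α) := by fun_prop
      simpa using this.tendsto α
    filter_upwards [h1.eventually huz] with x hx
    exact hx (by simp [hP, e])
  have hdiv : ∀ᶠ x in 𝓝 α, h (Φ.symm x) = (x i - α i) * G x e := by
    filter_upwards [hGu, hPz] with x hx hx'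
    rw [hx', sub_zero, hP, sub_sub_cancel, map_smul, smul_eq_mul] at hx
    exact hx
  have hΨt : Tendsto Ψ (𝓝 α) (𝓝 α) := by
    have := hΨ.continuousAt.tendsto
    rwa [hΨα] at this
  refine ⟨fun x => G (Ψ x) e, ?_, ?_⟩
  · refine AnalyticAt.clm_apply_const (AnalyticAt.comp (g := G) ?_ hΨ) e
    rwa [hΨα]
  · filter_upwards [hΨt.eventually hdiv, Φ.open_source.mem_nhds hα] with x hx hxs
    rw [← hΦ x, Φ.left_inv hxs, hΦ, hΨi, add_sub_cancel_right] at hx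
    exact hx

end Division

theorem isRegularPoint_analyticAffineSpace (𝕜 : Type u) [RCLike 𝕜] (N : ℕ)
    (a : (analyticAffineSpace 𝕜 N).Point) : (analyticAffineSpace 𝕜 N).IsRegularPoint a where
  reduced F hF h := by
    obtain ⟨f, hf, hFf⟩ := exists_germField_eq hF
    rw [hFf.self_of_nhds]
    refine germField_eq_zero hf ?_
    filter_upwards [h, hFf, eventually_analyticAt hf] with y h1 h2 h3
    rwa [h2, eval_germField_eq_zero_iff h3] at h1
  frame := by
    refine ⟨N, coordField 𝕜, fun i => germField_mem (analyticAt_coord i _),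
      .of_forall fun y => isCoordinatesAt_coordField y, fun F hF => ?_⟩
    obtain ⟨f, hf, hFf⟩ := exists_germField_eq hF
    refine ⟨fun i => germField (partialDeriv i f),
      fun i => germField_mem (analyticAt_partialDeriv hf i), ?_⟩
    filter_upwards [hFf, eventually_analyticAt hf] with y h1 h2
    rw [h1, d_eq_sum_coordField]
    simp only [stalkDeriv_germField _ h2]
  dvd T hT T' hT' := by
    rintro ⟨φ, hφ⟩ hz
    obtain ⟨f, hf, hTf⟩ := exists_germField_eq hT
    obtain ⟨h, hh, hTh⟩ := exists_germField_eq hT'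
    rw [hTf.self_of_nhds] at hφ ⊢
    rw [hTh.self_of_nhds]
    by_cases h0 : f (coords a) = 0
    · have hi : ∃ i, partialDeriv i f (coords a) ≠ 0 := by
        -- If all partial derivatives vanished at `a`, then φ(dT) = ∑ ∂_i T · φ(dx_i) would lie in
        -- 𝔪, whereas it is 1.
        by_contra! hi
        refine (IsLocalRing.maximalIdeal ((analyticAffineSpace 𝕜 N).Stalk a)).ne_top_iff_one.mp
          (IsLocalRing.maximalIdeal.isMaximal _).ne_top ?_
        rw [← hφ, d_eq_sum_coordField, map_sum]
        refine Ideal.sum_mem _ fun i _ => ?_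
        rw [map_smul, smul_eq_mul, stalkDeriv_germField i hf]
        refine Ideal.mul_mem_right _ _ ?_
        rw [IsLocalRing.mem_maximalIdeal, mem_nonunits_iff,
          isUnit_germField_iff (analyticAt_partialDeriv hf i), not_not, hi i]
      obtain ⟨i, hi⟩ := hi
      have hz' : ∀ᶠ x in 𝓝 (coords a), f x = 0 → h x = 0 := by
        refine eventually_coords.mpr ?_
        filter_upwards [hz, hTf, hTh, eventually_analyticAt hf, eventually_analyticAt hh]
          with y h1 h2 h3 h4 h5
        rwa [h2, h3, eval_germField_eq_zero_iff h4, eval_germField_eq_zero_iff h5] at h1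
      obtain ⟨g, hg, e⟩ := hf.exists_eq_mul_of_eq_zero hh h0 hi hz'
      exact ⟨germField g a, by
        rw [← germField_mul hf hg]
        exact germField_congr hh (eventually_coords.mp e)⟩
    · exact ((isUnit_germField_iff hf).mpr h0).dvd

end GaussMap

end

/-! ### The theorem in the algebraic and analytic categories. -/

theorem theorem2p5 :
    -- algebraic varieties over a field of characteristic zero
    (∀ (k : Type u) [Field k] [CharZero k] (n : ℕ) (X₀ X : Scheme.{u})
        (s₀ : X₀ ⟶ Spec (CommRingCat.of k)) (s : X ⟶ Spec (CommRingCat.of k))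
        [IsReduced X₀] [LocallyOfFinitePresentation s₀] [QuasiCompact s₀] [IsSeparated s₀]
        [SmoothOfRelativeDimension n s]
        (σ : X ⟶ X₀) (hσ : σ ≫ s₀ = s) [IsProper σ]
        (ι : Type v) (E : ι → Set (GaussMap.ofScheme s).Point),
        (GaussMap.homOfScheme s s₀ σ hσ).ResolvesWith s₀.smoothLocus E n →
      ∀ (J : Type w) (M : J → Scheme.{u}) (t : ∀ j, M j ⟶ Spec (CommRingCat.of k))
        (_ : ∀ j, Smooth (t j))
        (i : ∀ j, GaussMap.KSpace.LocalEmbedding (GaussMap.ofScheme s₀) (GaussMap.ofScheme (t j)))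
        (_ : ∀ b : (GaussMap.ofScheme s₀).Point, ∃ j, b ∈ (i j).V),
        [ ∀ j, (i j).GaussExtends (GaussMap.homOfScheme s s₀ σ hσ) s₀.smoothLocus n,
          (GaussMap.homOfScheme s s₀ σ hσ).PullFormsLocallyFree n,
          (GaussMap.ofScheme s).IsPrincipalIdeal
            ((GaussMap.homOfScheme s s₀ σ hσ).logFitting E n 0) ].TFAE) ∧
    -- real and complex analytic varieties
    (∀ (𝕜 : Type u) [RCLike 𝕜] (n : ℕ) (X₀ X : GaussMap.KSpace.{u} 𝕜)
        (_ : GaussMap.IsAnalyticSpace X₀) (_ : ∀ b, _root_.IsReduced (X₀.Stalk b))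
        (_ : GaussMap.IsAnalyticManifoldOfDim X n)
        (σ : GaussMap.KSpace.Hom X X₀) (_ : IsProperMap σ.pt)
        (ι : Type v) (E : ι → Set X.Point),
        σ.ResolvesWith (GaussMap.analyticSmoothLocus X₀) E n →
      ∀ (J : Type w) (M : J → GaussMap.KSpace.{u} 𝕜)
        (_ : ∀ j, GaussMap.IsAnalyticManifold (M j))
        (i : ∀ j, GaussMap.KSpace.LocalEmbedding X₀ (M j))
        (_ : ∀ b, ∃ j, b ∈ (i j).V),
        [ ∀ j, (i j).GaussExtends σ (GaussMap.analyticSmoothLocus X₀) n,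
          σ.PullFormsLocallyFree n,
          X.IsPrincipalIdeal (σ.logFitting E n 0) ].TFAE) := by
  refine ⟨?_, ?_⟩
  · intro k _ _ n X₀ X s₀ s _ _ _ _ _ σ hσ _ ι E h J M t ht i hi
    have : Smooth s := SmoothOfRelativeDimension.smooth n s
    exact h.tfae (GaussMap.KSpace.isRegularPoint_ofScheme s)
      (fun j => by have := ht j; exact GaussMap.KSpace.isRegularPoint_ofScheme (t j)) i hi
  · intro 𝕜 _ n X₀ X _ _ hX σ _ ι E h J M hM i hi
    exact h.tfae
      (fun a => (hX.smooth a).isRegularPoint (GaussMap.isRegularPoint_analyticAffineSpace 𝕜 n))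
      (fun j m => ((hM j).smooth m).elim fun N hN =>
        hN.isRegularPoint (GaussMap.isRegularPoint_analyticAffineSpace 𝕜 N)) i hi
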